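/- We work in the smooth category, in the standardly oriented $S^3\subset\mathbb C^2$. Notation: for an oriented knot $J\subset S^3$ let $N(J)$ be a closed tubular neighbourhood, $E(J)=S^3-\operatorname{int}N(J)$, let $m_J$ be a meridian (right-handed about $J$) and $l_J\subset\partial N(J)$ the preferred longitude (parallel to $J$, null-homologous in $S^3-J$). A simple closed curve on $\partial N(J)$ homologous to $\pm(a\,l_J+b\,m_J)$ with $a\neq 0$ has slope $b/a$. The boundary slope of a surface $S$ on $J$ is $s$ if $S\cap\partial N(J)$ is non-empty and each of its components is a simple closed curve of slope $s$. Let $L_{\beta/\alpha}=K_1\cup K_2\subset S^3$ be a 2-bridge link, where $\alpha\ge 4$ is even, $0<\beta<\alpha$ and $\gcd(\alpha,\beta)=1$, with disjoint neighbourhoods $N(K_1),N(K_2)$, and suppose that $lk(K_1,K_2)\neq 0$. Let $p,q$ be coprime integers with $|p|,|q|\ge 2$, and let $K_0$ be the $(p,q)$-torus knot $u\mapsto(u^p,u^q)/\sqrt2$ $(|u|=1)$, with $N(K_0)$ a union of orbits of the circle action $u\cdot(z,w)=(u^pz,u^qw)$, whose orbits are the fibres of the Seifert fibration of $E(K_0)$.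 Let $f:E(K_1)\to N(K_0)$ be an orientation-preserving diffeomorphism which takes a meridian of $K_1$ to a fibre $h\subset\partial N(K_0)$, and let $K=f(K_2)$ be the resulting satellite knot $K(\alpha,\beta;p,q)$, with $N(K)=f(N(K_2))$. Let $F$ be a Seifert surface for $K$ (for example one of minimal genus), properly embedded in $E(K)$, such that $F\cap\partial N(K_0)$ consists of $|lk(K_1,K_2)|$ preferred longitudes of $K_0$ and $\partial N(K_0)$ cuts $F$ along them, i.e. $F\cap N(K_0)$ is a compact orientable surface with boundary $\partial F\cup(F\cap\partial N(K_0))$. Put $F'=f^{-1}(F\cap N(K_0))$, a surface in the exterior of $L_{\beta/\alpha}$. Then the boundary slope of $F'$ on $K_2$ is $-lk(K_1,K_2)^2\,pq$, and the boundary slope of $F'$ on $K_1$ is $-\dfrac{1}{pq}$. -/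

import Mathlib

open Set Metric AlgebraicTopology
open scoped ContDiff

noncomputable section

namespace Satellite

/-! ### The oriented 3-sphere in `ℝ⁴ = ℂ²` -/

/-- `ℝ⁴`, thought of as `ℂ²` through `(z, w) ↔ (re z, im z, re w, im w)`. -/
abbrev E4 : Type := EuclideanSpace ℝ (Fin 4)

/-- The unit 3-sphere. -/
abbrev S3 : Set E4 := sphere (0 : E4) 1

/-- The point `(z, w)` of `ℂ² = ℝ⁴`. -/
def pt (z w : ℂ) : E4 := !₂[z.re, z.im, w.re, w.im]

/-- First complex coordinate. -/
def zc (x : E4) : ℂ := ⟨x 0, x 1⟩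

/-- Second complex coordinate. -/
def wc (x : E4) : ℂ := ⟨x 2, x 3⟩

/-- The determinant with rows `a, b, c, d`. Vectors `u, v, w` tangent to the sphere at `x` form a
positive basis (for the orientation as boundary of the unit ball of `ℂ²`) iff `0 < det4 x u v w`. -/
def det4 (a b c d : E4) : ℝ := Matrix.det (Matrix.of fun i j : Fin 4 => (![a, b, c, d] i) j)

/-! ### Degree of a self-map of the circle -/

/-- `g : S¹ → S¹` is continuous of degree `n`: it has a continuous lift `θ : ℝ → ℝ` with
`θ (t + 2π) = θ t + 2πn`. -/
def HasDegree (g : Circle → Circle) (n : ℤ) : Prop :=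
  ∃ θ : ℝ → ℝ, Continuous θ ∧ (∀ t, g (Circle.exp t) = Circle.exp (θ t)) ∧
    ∀ t, θ (t + 2 * Real.pi) = θ t + 2 * Real.pi * n

/-! ### Homology classes of loops -/

/-- The map induced by a loop on first integral singular homology. As `H₁(S¹; ℤ)` is infinite
cyclic, it carries the same information as the homology class of the loop. -/
def H1map {X : Set E4} (g : C(Circle, X)) :=
  ((singularHomologyFunctor (ModuleCat.{0} ℤ) 1).obj (ModuleCat.of ℤ ℤ)).map
    (TopCat.ofHom g)

/-- `[γ] = n [δ]` in `H₁(X; ℤ)`, for loops `γ`, `δ` in `X`. -/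
def HomologyMultiple (X : Set E4) (γ δ : Circle → E4) (n : ℤ) : Prop :=
  ∃ g d : C(Circle, X), (∀ u, (g u : E4) = γ u) ∧ (∀ u, (d u : E4) = δ u) ∧
    H1map g = n • H1map d

/-- `[γ] = 0` in `H₁(X; ℤ)`, for a loop `γ` in `X`. -/
def NullHomologous (X : Set E4) (γ : Circle → E4) : Prop :=
  ∃ g : C(Circle, X), (∀ u, (g u : E4) = γ u) ∧ H1map g = 0

/-! ### Knots with tubular neighbourhoods -/

/-- A smooth oriented knot in `S³` with a parametrised tubular neighbourhood: an
orientation-preserving smooth open embedding `S¹ × ℂ → S³`. The knot is the image of `S¹ × {0}`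
and its closed tubular neighbourhood is the image of `S¹ × D²`. -/
structure TubedKnot where
  toFun : Circle × ℂ → E4
  mem : ∀ x, toFun x ∈ S3
  inj : Function.Injective toFun
  smooth : ContDiff ℝ ∞ (fun y : ℝ × ℂ => toFun (Circle.exp y.1, y.2))
  /-- The images of `∂/∂θ, ∂/∂x, ∂/∂y` form a positive basis of the tangent space of `S³`;
  in particular the map is an immersion. -/
  pos : ∀ y : ℝ × ℂ,
    0 < det4 (toFun (Circle.exp y.1, y.2))
      (fderiv ℝ (fun y : ℝ × ℂ => toFun (Circle.exp y.1, y.2)) y (1, 0))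
      (fderiv ℝ (fun y : ℝ × ℂ => toFun (Circle.exp y.1, y.2)) y (0, 1))
      (fderiv ℝ (fun y : ℝ × ℂ => toFun (Circle.exp y.1, y.2)) y (0, Complex.I))

namespace TubedKnot

variable (K : TubedKnot)

/-- The knot itself. -/
def core (u : Circle) : E4 := K.toFun (u, 0)

/-- A meridian of the knot (right-handed with respect to the orientation of the knot). -/
def meridian (v : Circle) : E4 := K.toFun (1, (v : ℂ))

/-- The longitude determined by the parametrisation. -/
def longitude (u : Circle) : E4 := K.toFun (u, 1)

/-- The closed tubular neighbourhood `N(K)`. -/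
def nbhd : Set E4 := K.toFun '' (univ ×ˢ closedBall (0 : ℂ) 1)

/-- The torus `∂N(K)`. -/
def boundary : Set E4 := K.toFun '' (univ ×ˢ sphere (0 : ℂ) 1)

/-- The exterior `E(K) = S³ - int N(K)`. -/
def exterior : Set E4 := S3 \ K.toFun '' (univ ×ˢ ball (0 : ℂ) 1)

/-- The complement `S³ - K`. -/
def complement : Set E4 := S3 \ range K.core

/-- The longitude of the parametrisation is the preferred one: it is null-homologous in the
complement of the knot. -/
def Preferred : Prop := NullHomologous K.complement K.longitude

/-- `γ` is a loop on `∂N(K)` of homology class `a·(longitude) + b·(meridian)`. -/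
def HasClass (γ : Circle → E4) (a b : ℤ) : Prop :=
  ∃ g h : Circle → Circle, HasDegree g a ∧ HasDegree h b ∧
    ∀ u, γ u = K.toFun (g u, (h u : ℂ))

/-- `γ` parametrises a meridian of `K`: a simple closed curve on `∂N(K)` of class `± (meridian)`
(the curves on `∂N(K)` that bound a disc in `N(K)` but not in `∂N(K)`). -/
def IsMeridian (γ : Circle → E4) : Prop :=
  Function.Injective γ ∧ (K.HasClass γ 0 1 ∨ K.HasClass γ 0 (-1))

/-- `C` is a simple closed curve on `∂N(K)` which, suitably oriented, has homology class
`a·(longitude) + b·(meridian)`. -/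
def IsCurveOfClass (C : Set E4) (a b : ℤ) : Prop :=
  ∃ γ : Circle → E4, Function.Injective γ ∧ range γ = C ∧ K.HasClass γ a b

/-- `C` is a simple closed curve on `∂N(K)` of (finite) slope `s`: its class is
`a·(longitude) + b·(meridian)` with `a ≠ 0` and `s = b / a`. -/
def HasSlope (C : Set E4) (s : ℚ) : Prop :=
  ∃ a b : ℤ, a ≠ 0 ∧ K.IsCurveOfClass C a b ∧ s = b / a

/-- The boundary slope of `F` on `K` is `s`: `F` meets `∂N(K)`, and every component of
`F ∩ ∂N(K)` is a simple closed curve of slope `s`. -/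
def HasBoundarySlope (F : Set E4) (s : ℚ) : Prop :=
  (F ∩ K.boundary).Nonempty ∧
    ∀ x ∈ F ∩ K.boundary, K.HasSlope (connectedComponentIn (F ∩ K.boundary) x) s

end TubedKnot

/-- `n` is the linking number of `K₁` and `K₂`: `[K₂] = n [m₁]` in `H₁(S³ - K₁; ℤ)`, where `m₁` is
the meridian of `K₁`. -/
def IsLinkingNumber (K₁ K₂ : TubedKnot) (n : ℤ) : Prop :=
  HomologyMultiple K₁.complement K₂.core K₁.meridian n

/-! ### Two-bridge links -/

/-- `x` and `y` in `ℝ²` are equivalent under the group generated by the rotations by `π` about the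
points of `ℤ²`, i.e. the maps `x ↦ ± x + 2v` with `v ∈ ℤ²`. -/
def PillowRel (x y : ℝ × ℝ) : Prop :=
  ∃ a b : ℤ, y = (x.1 + 2 * a, x.2 + 2 * b) ∨ y = (-x.1 + 2 * a, -x.2 + 2 * b)

/-- The 2-sphere `ℝ²/Γ`, with the quotient topology. -/
abbrev Pillow : Type := Quot PillowRel

/-- The component through `(i, 0)`, `i = 0, 1`, of the standard two-bridge link of type `β/α` in
`ℝ²/Γ × ℝ`: vertical segments over `(i, 0)` and `(i, 1)`, an arc of slope `1/0` at level `0` and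
an arc of slope `β/α` at level `1`. -/
def stdComponent (α β : ℤ) (i : ℝ) : Set (Pillow × ℝ) :=
  {y | ∃ t ∈ Icc (0 : ℝ) 1,
    y = (Quot.mk _ (i, 0), t) ∨ y = (Quot.mk _ (i, 1), t) ∨
    y = (Quot.mk _ (i, t), 0) ∨ y = (Quot.mk _ (i + t * α, t * β), 1)}

/-- `K₁ ∪ K₂` is the two-bridge link `L_{β/α}`: regarding `S³` as a two-point compactification of
`ℝ²/Γ × ℝ`, the knots `K₁` and `K₂` become the standard components. -/
def IsTwoBridgeLink (α β : ℤ) (K₁ K₂ : TubedKnot) : Prop :=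
  ∃ P Q : E4, P ∈ S3 ∧ Q ∈ S3 ∧ P ≠ Q ∧
    ∃ e : Pillow × ℝ ≃ₜ {x : E4 // x ∈ S3 ∧ x ≠ P ∧ x ≠ Q},
      range K₁.core = (fun y => (e y : E4)) '' stdComponent α β 0 ∧
      range K₂.core = (fun y => (e y : E4)) '' stdComponent α β 1

/-! ### Torus knots and the Seifert fibration of their exteriors -/

/-- The orbit of `x` under the circle action `u · (z, w) = (u ^ p z, u ^ q w)` on `S³`. The orbits
are the fibres of the Seifert fibration of the exterior of the `(p, q)`-torus knot. -/
def seifertFiber (p q : ℤ) (x : E4) (u : Circle) : E4 :=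
  pt ((u : ℂ) ^ p * zc x) ((u : ℂ) ^ q * wc x)

/-- The `(p, q)`-torus knot `u ↦ (u ^ p, u ^ q) / √2`. -/
def torusKnot (p q : ℤ) (u : Circle) : E4 :=
  seifertFiber p q (pt ((1 / √2 : ℝ) : ℂ) ((1 / √2 : ℝ) : ℂ)) u

/-- `K₀` is the `(p, q)`-torus knot with a neighbourhood `N(K₀)` that is a union of Seifert
fibres (so that `∂N(K₀)` and `E(K₀)` are unions of fibres, too). -/
def IsFiberedTorusKnot (p q : ℤ) (K₀ : TubedKnot) : Prop :=
  (∀ u, K₀.core u = torusKnot p q u) ∧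
    ∀ x ∈ K₀.nbhd, ∀ u, seifertFiber p q x u ∈ K₀.nbhd

/-! ### Orientation-preserving diffeomorphisms between pieces of the sphere -/

/-- `f` restricts to an orientation-preserving diffeomorphism from `A ⊆ S³` onto `B ⊆ S³`
(smooth up to the boundary, that is, extending smoothly, with its inverse, to neighbourhoods). -/
structure IsOrientedDiffeo (f : OpenPartialHomeomorph E4 E4) (A B : Set E4) : Prop where
  subset_source : A ⊆ f.source
  subset_sphere : A ⊆ S3
  image_eq : f '' A = B
  mapsTo_sphere : MapsTo f (f.source ∩ S3) S3
  symm_mapsTo_sphere : MapsTo f.symm (f.target ∩ S3) S3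
  smooth : ContDiffOn ℝ ∞ f f.source
  symm_smooth : ContDiffOn ℝ ∞ f.symm f.target
  oriented : ∀ x ∈ A, ∀ u v w : E4, inner ℝ x u = 0 → inner ℝ x v = 0 → inner ℝ x w = 0 →
    0 < det4 x u v w → 0 < det4 (f x) (fderiv ℝ f x u) (fderiv ℝ f x v) (fderiv ℝ f x w)

/-! ### Compact orientable surfaces -/

/-- The vertices of a triangle. -/
def triVerts {n : ℕ} (t : Fin n × Fin n × Fin n) : Finset (Fin n) := {t.1, t.2.1, t.2.2}

/-- The directed edges in the boundary of an oriented triangle. -/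
def triEdges {n : ℕ} (t : Fin n × Fin n × Fin n) : Finset (Fin n × Fin n) :=
  {(t.1, t.2.1), (t.2.1, t.2.2), (t.2.2, t.1)}

/-- A finite simplicial complex which is a coherently oriented triangulated surface with
(possibly empty) boundary. -/
structure OrientedTriangulation where
  /-- The vertices are `0, …, n - 1`. -/
  n : ℕ
  /-- The triangles, each with an ordering of its vertices that gives its orientation. -/
  tri : Finset (Fin n × Fin n × Fin n)
  nondegenerate : ∀ t ∈ tri, (triVerts t).card = 3
  verts_inj : ∀ s ∈ tri, ∀ t ∈ tri, triVerts s = triVerts t → s = t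
  /-- Each directed edge lies in at most one oriented triangle: an edge is in at most two
  triangles, and two triangles with a common edge induce opposite directions on it. -/
  edge_unique : ∀ s ∈ tri, ∀ t ∈ tri, ∀ e, e ∈ triEdges s → e ∈ triEdges t → s = t
  /-- The link of each vertex is connected (hence an arc or a circle). -/
  link_connected : ∀ v, ∀ s ∈ tri, ∀ t ∈ tri, v ∈ triVerts s → v ∈ triVerts t →
    Relation.ReflTransGen
      (fun a b => b ∈ tri ∧ ∃ e ∈ triEdges a, e.swap ∈ triEdges b ∧ (v = e.1 ∨ v = e.2)) s t

namespace OrientedTriangulation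

variable (T : OrientedTriangulation)

/-- The geometric realisation, in barycentric coordinates. -/
def space : Set (Fin T.n → ℝ) :=
  {x | x ∈ stdSimplex ℝ (Fin T.n) ∧ ∃ t ∈ T.tri, ∀ i, x i ≠ 0 → i ∈ triVerts t}

/-- The union of the edges that lie in exactly one triangle. -/
def boundarySpace : Set (Fin T.n → ℝ) :=
  {x | x ∈ stdSimplex ℝ (Fin T.n) ∧ ∃ e : Fin T.n × Fin T.n,
    (∃ t ∈ T.tri, e ∈ triEdges t) ∧ (∀ t ∈ T.tri, e.swap ∉ triEdges t) ∧
    ∀ i, x i ≠ 0 → i = e.1 ∨ i = e.2}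

end OrientedTriangulation

/-- `F` is a compact orientable embedded surface with boundary `B`. -/
def IsOrientableSurface (F B : Set E4) : Prop :=
  ∃ (T : OrientedTriangulation) (ι : (Fin T.n → ℝ) → E4),
    ContinuousOn ι T.space ∧ InjOn ι T.space ∧ ι '' T.space = F ∧ ι '' T.boundarySpace = B

/-- `F` is a Seifert surface for `K`, properly embedded in the exterior of `K`: a compact,
connected, orientable surface whose boundary is `F ∩ ∂N(K)`, a curve on `∂N(K)` parallel to `K`
in `N(K)`. -/
def IsSeifertSurface (K : TubedKnot) (F : Set E4) : Prop :=
  F ⊆ K.exterior ∧ IsConnected F ∧ IsOrientableSurface F (F ∩ K.boundary) ∧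
    ∃ b : ℤ, K.IsCurveOfClass (F ∩ K.boundary) 1 b

/-- `F ∩ ∂N(K₀)` consists of `n` preferred longitudes of `K₀`
(for a parametrisation of `N(K₀)` with the preferred longitude). -/
def MeetsInLongitudes (K₀ : TubedKnot) (F : Set E4) (n : ℕ) : Prop :=
  ∃ C : Fin n → Set E4, Pairwise (fun i j => Disjoint (C i) (C j)) ∧
    (∀ i, K₀.IsCurveOfClass (C i) 1 0) ∧ F ∩ K₀.boundary = ⋃ i, C i

end Satellite

end

/-!
The proof computes homology classes of curves through degrees of maps to the circle: for a map `φ`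
from a subset of `S³` to the circle and a loop `γ` in it, `deg (φ ∘ γ)` depends only on the class of
`γ` in first homology (`deg_comp_of_homology_eq`), and it vanishes if `γ` is the boundary of a
compact orientable surface (`IsOrientableSurface.deg_eq_zero`). Every knot `K` has a dual map on its
complement, of degree one on the meridian (`TubedKnot.exists_dual_map`); it is obtained from the
Pontryagin-Thom collapse onto the tube, whose line bundle is trivial over the exterior together
with a meridian disc, because this set misses a point of the sphere.

A Seifert fibre on `∂N(K₀)` is homologous to `l₀ + pq m₀` (`IsFiberedTorusKnot.deg_fiber`): it is
homotopic to `K₀` in `N(K₀)`, and (for positive `p` and `q`, say) the function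
`(√2 z)^q - (√2 w)^p`, which cuts out the torus knot, winds `pq` times along it and once along
`m₀`. On the boundary tori, `f` therefore takes `m₁` to `ε (l₀ + pq m₀)` with `ε = ± 1`.
The longitude `l₁` is null-homologous in `E(K₁)`, so it goes to `± m₀`, and the sign is
`ε`, because `f` preserves the orientation of the sphere and exchanges the two sides of the tori
(`IsOrientedDiffeo.det_torusMap_neg`). Hence `f⁻¹` takes `l₀` to `ε (m₁ - pq l₁)`
(`exists_gluing_matrix`), a curve of slope `-1 / pq`; this is the boundary slope of `F'` on `K₁`.

For the boundary slope on `K₂`, let `φ` be dual to the satellite `K` and let `lk` be the linking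
number of `K₁` and `K₂`. The winding number of `K` in `N(K₀)` is `ε lk`, and it is also the degree
of `φ` on `m₀` (`TubedKnot.deg_meridian_eq_deg_core`, by counting the crossings of `K` with a
generic meridian disc), so `φ` has degree `pq lk` on `f(m₁)`. Divide `φ ∘ f` by a map dual to
`K₂`. The quotient has degree zero on `m₂`, so it extends over `N(K₂)`
(`TubedKnot.exists_extension`), and its degree on `l₂` is `lk` times its degree on `m₁`, that is
`pq lk²`. Thus `f(l₂)` differs from the preferred longitude of `K` by `pq lk²` meridians
(`deg_longitude_satellite`). The boundary of `F` is a preferred longitude, so its slope in the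
parametrisation by `f` and `N(K₂)` is `-pq lk²`.
-/

open Set Metric AlgebraicTopology
open scoped ContDiff

noncomputable section

namespace Satellite

/-! ### Degrees of maps from the circle to itself -/

theorem exists_continuous_circle_lift {A : Type*} [TopologicalSpace A] [SimplyConnectedSpace A]
    [LocallyPathConnectedSpace A] {g : A → Circle} (hg : Continuous g) (a₀ : A) (x₀ : ℝ)
    (hx₀ : Circle.exp x₀ = g a₀) :
    ∃ θ : A → ℝ, Continuous θ ∧ (∀ a, g a = Circle.exp (θ a)) ∧ θ a₀ = x₀ := by
  obtain ⟨F, ⟨hF₀, hF⟩, -⟩ :=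
    Circle.isCoveringMap_exp.existsUnique_continuousMap_lifts ⟨g, hg⟩ a₀ x₀ hx₀
  exact ⟨F, F.continuous, fun a => (congrFun hF a).symm, hF₀⟩

/-- Two lifts of the same map differ by a constant. -/
theorem circle_lift_sub_eq {A : Type*} [TopologicalSpace A] {S : Set A} (hS : IsPreconnected S)
    {θ θ' : A → ℝ} (hθ : ContinuousOn θ S) (hθ' : ContinuousOn θ' S)
    (h : ∀ a ∈ S, Circle.exp (θ a) = Circle.exp (θ' a)) {a b : A} (ha : a ∈ S) (hb : b ∈ S) :
    θ a - θ' a = θ b - θ' b := by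
  have hpi := Real.two_pi_pos
  have hint : ∀ c ∈ S, ∃ m : ℤ, θ c - θ' c = m * (2 * Real.pi) := fun c hc => by
    obtain ⟨m, hm⟩ := Circle.exp_eq_exp.1 (h c hc)
    exact ⟨m, by rw [hm]; ring⟩
  have hcont : ContinuousOn (fun c => (θ c - θ' c) / (2 * Real.pi)) S :=
    (hθ.sub hθ').div_const _
  have himg := hS.image _ hcont
  have hsub : (fun c => (θ c - θ' c) / (2 * Real.pi)) '' S ⊆ range ((↑) : ℤ → ℝ) := by
    rintro _ ⟨c, hc, rfl⟩
    obtain ⟨m, hm⟩ := hint c hc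
    exact ⟨m, by simp only [hm]; field_simp⟩
  have hss : ((fun c => (θ c - θ' c) / (2 * Real.pi)) '' S).Subsingleton := by
    intro x hx y hy
    obtain ⟨m, rfl⟩ := hsub hx
    obtain ⟨n, rfl⟩ := hsub hy
    have hoc := himg.ordConnected
    by_contra hne
    wlog hlt : m < n generalizing m n
    · exact this n hy m hx (Ne.symm hne)
        (lt_of_le_of_ne (not_lt.1 hlt) fun h => hne (by rw [h]))
    have h1 : (m : ℝ) + 1 ≤ n := by exact_mod_cast hlt
    obtain ⟨k, hk⟩ := hsub (hoc.out hx hy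
      (show (m : ℝ) + 1 / 2 ∈ Icc (m : ℝ) n from ⟨by linarith, by linarith⟩))
    have h2 : (2 * k : ℤ) = 2 * m + 1 := by
      have : (2 * k : ℝ) = 2 * m + 1 := by rw [hk]; ring
      exact_mod_cast this
    omega
  have := hss (mem_image_of_mem _ ha) (mem_image_of_mem _ hb)
  field_simp at this
  exact this

theorem HasDegree.continuous {g : Circle → Circle} {n : ℤ} (h : HasDegree g n) :
    Continuous g := by
  obtain ⟨θ, hθ, hg, -⟩ := h
  have hq : Topology.IsQuotientMap (Circle.exp : ℝ → Circle) :=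
    Circle.isCoveringMap_exp.isQuotientMap Circle.exp_surjective
  refine hq.continuous_iff.2 ?_
  have : g ∘ Circle.exp = Circle.exp ∘ θ := funext hg
  rw [this]
  exact Circle.exp.continuous.comp hθ

theorem HasDegree.unique {g : Circle → Circle} {m n : ℤ} (hm : HasDegree g m)
    (hn : HasDegree g n) : m = n := by
  obtain ⟨θ, hθ, hg, hper⟩ := hm
  obtain ⟨θ', hθ', hg', hper'⟩ := hn
  have := circle_lift_sub_eq isPreconnected_univ hθ.continuousOn hθ'.continuousOn
    (fun t _ => (hg t).symm.trans (hg' t)) (mem_univ 0) (mem_univ (0 + 2 * Real.pi))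
  rw [hper, hper'] at this
  have h2 : 2 * Real.pi * (m - n : ℝ) = 0 := by linarith
  have h3 : (m - n : ℝ) = 0 := by
    rcases mul_eq_zero.1 h2 with h | h
    · exact absurd h Real.two_pi_pos.ne'
    · exact h
  exact_mod_cast sub_eq_zero.1 h3

theorem exists_hasDegree {g : Circle → Circle} (hg : Continuous g) : ∃ n, HasDegree g n := by
  obtain ⟨x₀, hx₀⟩ := Circle.exp_surjective (g (Circle.exp 0))
  obtain ⟨θ, hθ, hgθ, -⟩ := exists_continuous_circle_lift (hg.comp Circle.exp.continuous) 0 x₀ hx₀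
  have hgθ' : ∀ t, g (Circle.exp t) = Circle.exp (θ t) := hgθ
  obtain ⟨n, hn⟩ := Circle.exp_eq_exp.1
    (show Circle.exp (θ (0 + 2 * Real.pi)) = Circle.exp (θ 0) by
      rw [← hgθ', ← hgθ', Circle.exp_add_two_pi])
  refine ⟨n, θ, hθ, hgθ', fun t => ?_⟩
  have := circle_lift_sub_eq (θ := fun t => θ (t + 2 * Real.pi)) (θ' := θ) isPreconnected_univ
    (by fun_prop) (by fun_prop)
    (fun t _ => by rw [← hgθ', ← hgθ', Circle.exp_add_two_pi]) (mem_univ t) (mem_univ 0)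
  linarith

open Classical in
/-- The degree of a continuous self-map of the circle (`0` for a discontinuous map). -/
def deg (g : Circle → Circle) : ℤ := if h : ∃ n, HasDegree g n then h.choose else 0

theorem hasDegree_deg {g : Circle → Circle} (hg : Continuous g) : HasDegree g (deg g) := by
  have h := exists_hasDegree hg
  rw [deg, dif_pos h]
  exact h.choose_spec

theorem HasDegree.deg_eq {g : Circle → Circle} {n : ℤ} (h : HasDegree g n) : deg g = n :=
  (hasDegree_deg h.continuous).unique h

theorem deg_mul {g h : Circle → Circle} (hg : Continuous g) (hh : Continuous h) :
    deg (fun u => g u * h u) = deg g + deg h := by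
  obtain ⟨θ, hθ, hgθ, hper⟩ := hasDegree_deg hg
  obtain ⟨θ', hθ', hgθ', hper'⟩ := hasDegree_deg hh
  refine HasDegree.deg_eq ⟨fun t => θ t + θ' t, by fun_prop, fun t => ?_, fun t => ?_⟩
  · simp only [hgθ, hgθ', Circle.exp_add]
  · simp only [hper, hper']; push_cast; ring

theorem deg_id : deg (fun u => u) = 1 :=
  HasDegree.deg_eq ⟨id, continuous_id, fun _ => rfl, fun t => by simp⟩

theorem deg_zpow {g : Circle → Circle} (hg : Continuous g) (n : ℤ) :
    deg (fun u => g u ^ n) = n * deg g := by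
  obtain ⟨θ, hθ, hgθ, hper⟩ := hasDegree_deg hg
  refine HasDegree.deg_eq ⟨fun t => n * θ t, by fun_prop, fun t => ?_, fun t => ?_⟩
  · simp only [hgθ, ← Circle.exp_intCast_mul]
  · simp only [hper]; push_cast; ring

theorem deg_inv {g : Circle → Circle} (hg : Continuous g) :
    deg (fun u => (g u)⁻¹) = - deg g := by
  have := deg_zpow hg (-1)
  simpa using this

theorem deg_mul_inv {g h : Circle → Circle} (hg : Continuous g) (hh : Continuous h) :
    deg (fun u => g u * (h u)⁻¹) = deg g - deg h := by
  have hi : Continuous fun u => (h u)⁻¹ := hh.inv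
  rw [deg_mul hg hi, deg_inv hh, sub_eq_add_neg]

theorem deg_exp {k : Circle → ℝ} (hk : Continuous k) : deg (fun u => Circle.exp (k u)) = 0 := by
  refine HasDegree.deg_eq ⟨fun t => k (Circle.exp t), hk.comp Circle.exp.continuous,
    fun t => rfl, fun t => ?_⟩
  simp

theorem deg_const (c : Circle) : deg (fun _ => c) = 0 := by
  obtain ⟨x, rfl⟩ := Circle.exp_surjective c
  exact deg_exp (k := fun _ => x) continuous_const

theorem exists_eq_exp_of_ne_neg_one {A : Type*} [TopologicalSpace A] {g : A → Circle}
    (hg : Continuous g) (h : ∀ a, (g a : ℂ) ≠ -1) :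
    ∃ k : A → ℝ, Continuous k ∧ ∀ a, g a = Circle.exp (k a) := by
  refine ⟨fun a => (g a : ℂ).arg, ?_, fun a => (Circle.exp_arg _).symm⟩
  refine continuous_iff_continuousAt.2 fun a => ?_
  have hs : (g a : ℂ) ∈ Complex.slitPlane := by
    rw [Complex.mem_slitPlane_iff_arg]
    refine ⟨fun hpi => h a ?_, Circle.coe_ne_zero _⟩
    have := Circle.exp_arg (g a)
    rw [hpi] at this
    rw [← this]
    simp
  have hc : Continuous fun a => (g a : ℂ) := continuous_subtype_val.comp hg
  exact ContinuousAt.comp (f := fun a => (g a : ℂ)) (Complex.continuousAt_arg hs)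
    hc.continuousAt

/-- The degree is invariant under homotopies, here parametrised by a preconnected set. -/
theorem deg_eq_of_homotopy {Y : Type*} [TopologicalSpace Y] {S : Set Y} (hS : IsPreconnected S)
    {H : Y → Circle → Circle} (hH : ContinuousOn (fun x : Y × Circle => H x.1 x.2) (S ×ˢ univ))
    {y y' : Y} (hy : y ∈ S) (hy' : y' ∈ S) : deg (H y) = deg (H y') := by
  have hcont : Continuous fun x : S × Circle => H x.1 x.2 := by
    have := hH.comp_continuous (f := fun x : S × Circle => ((x.1 : Y), x.2)) (by fun_prop)
      (fun x => ⟨x.1.2, mem_univ _⟩)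
    exact this
  have : PreconnectedSpace S := isPreconnected_iff_preconnectedSpace.1 hS
  have hc1 : ∀ z : S, Continuous (H z) := fun z =>
    hcont.comp (f := fun u => (z, u)) (by fun_prop)
  have hloc : IsLocallyConstant fun z : S => deg (H z) := by
    refine IsLocallyConstant.iff_eventually_eq _ |>.2 fun z₀ => ?_
    have hopen : IsOpen {x : S × Circle | ((H x.1 x.2 * (H z₀ x.2)⁻¹ : Circle) : ℂ) ≠ -1} := by
      refine isOpen_ne_fun ?_ continuous_const
      exact continuous_subtype_val.comp (hcont.mul ((hc1 z₀).comp continuous_snd).inv)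
    obtain ⟨U, V, hU, -, hzU, huV, hUV⟩ := generalized_tube_lemma
      (isCompact_singleton (x := z₀)) (isCompact_univ (X := Circle)) hopen (by
        rintro ⟨a, u⟩ ⟨rfl, -⟩
        simp only [mem_ofPred_eq, mul_inv_cancel, Circle.coe_one]
        norm_num)
    filter_upwards [hU.mem_nhds (hzU rfl)] with z hz
    obtain ⟨k, hk, hke⟩ := exists_eq_exp_of_ne_neg_one
      (g := fun u => H z u * (H z₀ u)⁻¹) ((hc1 z).mul (hc1 z₀).inv)
      (fun u => hUV (show (z, u) ∈ U ×ˢ V from ⟨hz, huV (mem_univ u)⟩))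
    have h1 := deg_mul_inv (hc1 z) (hc1 z₀)
    rw [show (fun u => H z u * (H z₀ u)⁻¹) = _ from funext hke, deg_exp hk] at h1
    linarith
  exact hloc.apply_eq_of_isPreconnected isPreconnected_univ (mem_univ ⟨y, hy⟩) (mem_univ ⟨y', hy'⟩)

/-- A continuous map from the circle to itself is a power map times the exponential of a real
function. -/
theorem exists_eq_zpow_mul_exp {g : Circle → Circle} (hg : Continuous g) :
    ∃ k : Circle → ℝ, Continuous k ∧ ∀ u, g u = u ^ deg g * Circle.exp (k u) := by
  obtain ⟨θ, hθ, hgθ, hper⟩ := hasDegree_deg hg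
  have hq : Topology.IsQuotientMap (Circle.exp : ℝ → Circle) :=
    Circle.isCoveringMap_exp.isQuotientMap Circle.exp_surjective
  let f : C(ℝ, ℝ) := ⟨fun t => θ t - deg g * t, by fun_prop⟩
  have hf : ∀ (m : ℤ) (t : ℝ), f (t + m * (2 * Real.pi)) = f t := by
    have h : Function.Periodic f (2 * Real.pi) := fun t => by
      change θ _ - _ = θ _ - _
      rw [hper]; ring
    exact fun m t => h.int_mul m t
  have hfac : ∀ a b : ℝ, Circle.exp a = Circle.exp b → f a = f b := by
    intro a b hab
    obtain ⟨m, rfl⟩ := Circle.exp_eq_exp.1 hab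
    exact hf m b
  refine ⟨hq.lift (f := ⟨Circle.exp, Circle.exp.continuous⟩) f hfac, ContinuousMap.continuous _, fun u => ?_⟩
  obtain ⟨t, rfl⟩ := Circle.exp_surjective u
  have : hq.lift (f := ⟨Circle.exp, Circle.exp.continuous⟩) f hfac (Circle.exp t) = f t :=
    congrFun (congrArg DFunLike.coe (hq.lift_comp (f := ⟨Circle.exp, Circle.exp.continuous⟩) f hfac)) t
  rw [this, hgθ, ← Circle.exp_intCast_mul, ← Circle.exp_add]
  congr 1
  change _ = _ + (θ t - deg g * t)
  ring

/-- A continuous map from the torus to the circle is a monomial times the exponential of a real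
function. -/
theorem exists_torus_eq {φ : Circle × Circle → Circle} (hφ : Continuous φ) :
    ∃ k : Circle × Circle → ℝ, Continuous k ∧ ∀ x, φ x =
      x.1 ^ deg (fun u => φ (u, 1)) * x.2 ^ deg (fun v => φ (1, v)) * Circle.exp (k x) := by
  set A := deg (fun u => φ (u, 1)) with hA
  set B := deg (fun v => φ (1, v)) with hB
  have hq : Topology.IsQuotientMap (Prod.map Circle.exp Circle.exp : ℝ × ℝ → Circle × Circle) :=
    ((Circle.isCoveringMap_exp.isLocalHomeomorph.isOpenMap.prodMap
      Circle.isCoveringMap_exp.isLocalHomeomorph.isOpenMap).isQuotientMap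
      (Circle.exp.continuous.prodMap Circle.exp.continuous)
      (Circle.exp_surjective.prodMap Circle.exp_surjective))
  set χ : Circle × Circle → Circle := fun x => φ x * (x.1 ^ A)⁻¹ * (x.2 ^ B)⁻¹ with hχ
  have hχc : Continuous χ := by
    have h1 : Continuous fun x : Circle × Circle => x.1 ^ A := continuous_fst.zpow A
    have h2 : Continuous fun x : Circle × Circle => x.2 ^ B := continuous_snd.zpow B
    exact (hφ.mul h1.inv).mul h2.inv
  have hd1 : ∀ v, deg (fun u => χ (u, v)) = 0 := by
    intro v
    have e : deg (fun u => χ (u, v)) = deg (fun u => χ (u, 1)) :=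
      deg_eq_of_homotopy (S := univ) (H := fun v u => χ (u, v)) isPreconnected_univ
        (hχc.comp (continuous_snd.prodMk continuous_fst)).continuousOn (mem_univ _) (mem_univ _)
    have hc : Continuous fun u : Circle => φ (u, 1) := by fun_prop
    have hz : Continuous fun u : Circle => u ^ A := continuous_id.zpow A
    rw [e]
    simp only [hχ, one_zpow, inv_one, mul_one]
    rw [deg_mul_inv hc hz, deg_zpow continuous_id', deg_id]
    simp [hA]
  have hd2 : ∀ u, deg (fun v => χ (u, v)) = 0 := by
    intro u
    have e : deg (fun v => χ (u, v)) = deg (fun v => χ (1, v)) :=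
      deg_eq_of_homotopy (S := univ) (H := fun u v => χ (u, v)) isPreconnected_univ
        hχc.continuousOn (mem_univ _) (mem_univ _)
    have hc : Continuous fun u : Circle => φ (1, u) := by fun_prop
    have hz : Continuous fun u : Circle => u ^ B := continuous_id.zpow B
    rw [e]
    simp only [hχ, one_zpow, inv_one, mul_one]
    rw [deg_mul_inv hc hz, deg_zpow continuous_id', deg_id]
    simp [hB]
  obtain ⟨x₀, hx₀⟩ := Circle.exp_surjective (χ (Circle.exp 0, Circle.exp 0))
  obtain ⟨θ, hθ, hχθ, -⟩ := exists_continuous_circle_lift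
    (A := ℝ × ℝ) (g := fun x => χ (Circle.exp x.1, Circle.exp x.2))
    (by fun_prop) (0, 0) x₀ hx₀
  have hper1 : ∀ s, Function.Periodic (fun t => θ (t, s)) (2 * Real.pi) := by
    intro s t
    have hdeg : HasDegree (fun u => χ (u, Circle.exp s)) 0 := by
      rw [← hd1 (Circle.exp s)]; exact hasDegree_deg (by fun_prop)
    obtain ⟨η, hη, he, hp⟩ := hdeg
    have := circle_lift_sub_eq (θ := fun t => θ (t, s)) (θ' := η) isPreconnected_univ
      (by fun_prop) hη.continuousOn (fun t _ => by exact (hχθ _).symm.trans (he t)) (mem_univ (t + 2 * Real.pi))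
      (mem_univ t)
    rw [hp] at this
    simp at this
    linarith
  have hper2 : ∀ t, Function.Periodic (fun s => θ (t, s)) (2 * Real.pi) := by
    intro s t
    have hdeg : HasDegree (fun u => χ (Circle.exp s, u)) 0 := by
      rw [← hd2 (Circle.exp s)]; exact hasDegree_deg (by fun_prop)
    obtain ⟨η, hη, he, hp⟩ := hdeg
    have := circle_lift_sub_eq (θ := fun t => θ (s, t)) (θ' := η) isPreconnected_univ
      (by fun_prop) hη.continuousOn (fun t _ => by exact (hχθ _).symm.trans (he t)) (mem_univ (t + 2 * Real.pi))
      (mem_univ t)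
    rw [hp] at this
    simp at this
    linarith
  let f : C(ℝ × ℝ, ℝ) := ⟨θ, hθ⟩
  let pr : C(ℝ × ℝ, Circle × Circle) :=
    ⟨Prod.map Circle.exp Circle.exp, Circle.exp.continuous.prodMap Circle.exp.continuous⟩
  have hfac : ∀ a b : ℝ × ℝ, pr a = pr b → f a = f b := by
    rintro ⟨a, b⟩ ⟨c, d⟩ hab
    have h1 : Circle.exp a = Circle.exp c := congrArg Prod.fst hab
    have h2 : Circle.exp b = Circle.exp d := congrArg Prod.snd hab
    obtain ⟨m, rfl⟩ := Circle.exp_eq_exp.1 h1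
    obtain ⟨n, rfl⟩ := Circle.exp_eq_exp.1 h2
    exact ((hper1 _).int_mul m c).trans ((hper2 c).int_mul n d)
  refine ⟨hq.lift (f := pr) f hfac, ContinuousMap.continuous _, fun u => ?_⟩
  obtain ⟨t, rfl⟩ := hq.surjective u
  have : hq.lift (f := pr) f hfac (pr t) = f t :=
    congrFun (congrArg DFunLike.coe (hq.lift_comp (f := pr) f hfac)) t
  change φ (pr t) = (pr t).1 ^ A * (pr t).2 ^ B * _
  erw [this]
  have h3 : χ (pr t) = Circle.exp (θ t) := hχθ t
  change _ = _ * Circle.exp (θ t)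
  rw [← h3]
  simp only [hχ]
  rw [mul_assoc (φ _), ← mul_inv, mul_comm (_ * _), inv_mul_cancel_right]

theorem deg_torus_comp {φ : Circle × Circle → Circle} (hφ : Continuous φ) {g h : Circle → Circle}
    (hg : Continuous g) (hh : Continuous h) :
    deg (fun u => φ (g u, h u)) =
      deg (fun u => φ (u, 1)) * deg g + deg (fun v => φ (1, v)) * deg h := by
  obtain ⟨k, hk, he⟩ := exists_torus_eq hφ
  have h1 : Continuous fun u => g u ^ deg (fun u => φ (u, 1)) := hg.zpow _
  have h2 : Continuous fun u => h u ^ deg (fun v => φ (1, v)) := hh.zpow _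
  have h3 : Continuous fun u => k (g u, h u) := by fun_prop
  rw [show (fun u => φ (g u, h u)) = _ from funext fun u => he (g u, h u)]
  have h12 : Continuous fun u => g u ^ deg (fun u => φ (u, 1)) * h u ^ deg (fun v => φ (1, v)) :=
    h1.mul h2
  rw [deg_mul h12 (by fun_prop), deg_mul h1 h2, deg_exp h3, deg_zpow hg, deg_zpow hh]
  ring

/-! ### Homologous loops have the same degree under a map to the circle -/

theorem exists_circle_lift_of_contractible {A : Type*} [TopologicalSpace A] [ContractibleSpace A]
    {g : A → Circle} (hg : Continuous g) :
    ∃ θ : A → ℝ, Continuous θ ∧ ∀ a, g a = Circle.exp (θ a) := by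
  obtain ⟨a₀, ⟨H⟩⟩ := id_nullhomotopic A
  obtain ⟨x₀, hx₀⟩ := Circle.exp_surjective (g a₀)
  let G : C(unitInterval × A, Circle) := ⟨fun x => g (H.symm x), by fun_prop⟩
  have hG : ∀ a, G (0, a) = Circle.exp ((ContinuousMap.const A x₀) a) := fun a => by
    simp [G, hx₀]
  refine ⟨fun a => Circle.isCoveringMap_exp.liftHomotopy G _ hG (1, a), by fun_prop, fun a => ?_⟩
  have := congrFun (Circle.isCoveringMap_exp.liftHomotopy_lifts G _ hG) (1, a)
  rw [Function.comp_apply] at this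
  rw [this]
  simp [G]

theorem exists_circle_lift_unitInterval (p : C(unitInterval, Circle)) :
    ∃ θ : unitInterval → ℝ, Continuous θ ∧ ∀ t, p t = Circle.exp (θ t) :=
  have : ContractibleSpace unitInterval :=
    (convex_Icc (0 : ℝ) 1).contractibleSpace ⟨0, unitInterval.zero_mem⟩
  exists_circle_lift_of_contractible p.continuous

/-- The total variation of the argument along a path in the circle. -/
def variation (p : C(unitInterval, Circle)) : ℝ :=
  (exists_circle_lift_unitInterval p).choose 1 - (exists_circle_lift_unitInterval p).choose 0

theorem variation_eq {p : C(unitInterval, Circle)} {θ : unitInterval → ℝ} (hθ : Continuous θ)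
    (h : ∀ t, p t = Circle.exp (θ t)) : variation p = θ 1 - θ 0 := by
  have hs := (exists_circle_lift_unitInterval p).choose_spec
  have := circle_lift_sub_eq isPreconnected_univ hs.1.continuousOn hθ.continuousOn
    (fun t _ => (hs.2 t).symm.trans (h t)) (mem_univ 1) (mem_univ 0)
  rw [variation]
  linarith

section homology

open CategoryTheory Simplicial

/-- The path parametrised by a singular 1-simplex of the circle. -/
def simplexPath (x : (TopCat.toSSet.obj (TopCat.of Circle)) _⦋1⦌) : C(unitInterval, Circle) :=
  ((TopCat.of Circle).toSSetObjEquiv _ x).comp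
    (stdSimplexHomeomorphUnitInterval.symm : C(unitInterval, stdSimplex ℝ (Fin 2)))

/-- The winding cochain of the circle, on singular 1-chains. -/
def windingCochain :
    ((TopCat.toSSet.obj (TopCat.of Circle)).chainComplex (ModuleCat.of ℤ ℤ)).X 1 ⟶
      ModuleCat.of ℤ ℝ :=
  Limits.Cofan.IsColimit.desc (SSet.isColimitChainComplexXCofan _ _ 1) fun x =>
    ModuleCat.ofHom (LinearMap.toSpanSingleton ℤ ℝ (variation (simplexPath x)))

theorem ι_windingCochain (x : (TopCat.toSSet.obj (TopCat.of Circle)) _⦋1⦌) :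
    (TopCat.toSSet.obj (TopCat.of Circle)).ιChainComplex x ≫ windingCochain =
      ModuleCat.ofHom (LinearMap.toSpanSingleton ℤ ℝ (variation (simplexPath x))) :=
  Limits.Cofan.IsColimit.fac (SSet.isColimitChainComplexXCofan _ _ 1) _ _

theorem variation_simplexPath_face (x : (TopCat.toSSet.obj (TopCat.of Circle)) _⦋2⦌)
    {θ : stdSimplex ℝ (Fin 3) → ℝ} (hθ : Continuous θ)
    (h : ∀ y, (TopCat.of Circle).toSSetObjEquiv _ x y = Circle.exp (θ y)) (i : Fin 3) :
    variation (simplexPath ((TopCat.toSSet.obj (TopCat.of Circle)).δ i x)) =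
      θ (stdSimplex.vertex (i.succAbove 1)) - θ (stdSimplex.vertex (i.succAbove 0)) := by
  rw [variation_eq (θ := fun t => θ (stdSimplex.map (SimplexCategory.δ i)
    (stdSimplexHomeomorphUnitInterval.symm t)))
    (hθ.comp ((stdSimplex.continuous_map _).comp (Homeomorph.continuous _))) (fun t => h _)]
  have h0 : stdSimplexHomeomorphUnitInterval.symm 0 = stdSimplex.vertex 0 := by
    rw [Homeomorph.symm_apply_eq]; simp
  have h1 : stdSimplexHomeomorphUnitInterval.symm 1 = stdSimplex.vertex 1 := by
    rw [Homeomorph.symm_apply_eq]; simp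
  rw [h0, h1, stdSimplex.map_vertex, stdSimplex.map_vertex]
  rfl

/-- The winding cochain is a cocycle: a singular 2-simplex of the circle lifts to the line, so the
variations along its faces cancel. -/
theorem d_windingCochain :
    ((TopCat.toSSet.obj (TopCat.of Circle)).chainComplex (ModuleCat.of ℤ ℤ)).d 2 1 ≫
      windingCochain = 0 := by
  refine SSet.chainComplex_hom_ext fun x => ?_
  have : ContractibleSpace (stdSimplex ℝ (Fin 3)) :=
    (convex_stdSimplex ℝ (Fin 3)).contractibleSpace ⟨_, single_mem_stdSimplex ℝ 0⟩
  obtain ⟨θ, hθ, h⟩ := exists_circle_lift_of_contractible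
    ((TopCat.of Circle).toSSetObjEquiv _ x).continuous
  rw [SSet.ιChainComplex_d_assoc, Preadditive.sum_comp, Limits.comp_zero]
  simp only [Preadditive.zsmul_comp, ι_windingCochain]
  ext
  have key := variation_simplexPath_face x hθ h
  simp [Fin.sum_univ_three, key]
  exact sub_self _

/-- The singular 1-simplex running once around the circle. -/
def loopSimplex : (TopCat.toSSet.obj (TopCat.of Circle)) _⦋1⦌ :=
  ((TopCat.of Circle).toSSetObjEquiv _).symm
    ⟨fun y => Circle.exp (2 * Real.pi * (y : Fin 2 → ℝ) 1), by
      have : Continuous fun y : stdSimplex ℝ (Fin 2) => (y : Fin 2 → ℝ) 1 :=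
        (continuous_apply 1).comp continuous_subtype_val
      exact Circle.exp.continuous.comp (continuous_const.mul this)⟩

theorem loopSimplex_d :
    (TopCat.toSSet.obj (TopCat.of Circle)).ιChainComplex (R := ModuleCat.of ℤ ℤ) loopSimplex ≫
      ((TopCat.toSSet.obj (TopCat.of Circle)).chainComplex (ModuleCat.of ℤ ℤ)).d 1 0 = 0 := by
  have h : ∀ i : Fin 2, (TopCat.toSSet.obj (TopCat.of Circle)).δ i loopSimplex =
      ((TopCat.of Circle).toSSetObjEquiv _).symm (ContinuousMap.const _ 1) := by
    intro i
    rw [Equiv.eq_symm_apply]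
    ext y
    have hy : y = stdSimplex.vertex (0 : Fin 1) := Subsingleton.elim _ _
    have : (TopCat.of Circle).toSSetObjEquiv _
        ((TopCat.toSSet.obj (TopCat.of Circle)).δ i loopSimplex) y =
        Circle.exp (2 * Real.pi * (stdSimplex.map (SimplexCategory.δ i) y : Fin 2 → ℝ) 1) := rfl
    rw [this, hy, stdSimplex.map_vertex]
    change ((Circle.exp (2 * Real.pi * (stdSimplex.vertex (S := ℝ) (i.succAbove 0) : Fin 2 → ℝ) 1) : Circle) : ℂ) = 1
    fin_cases i <;> simp [stdSimplex.vertex]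
  rw [SSet.ιChainComplex_d, Fin.sum_univ_two, h, h]
  simp

/-- The fundamental class of the circle. -/
def circleClass : ModuleCat.of ℤ ℤ ⟶
    (TopCat.toSSet.obj (TopCat.of Circle)).homology (ModuleCat.of ℤ ℤ) 1 :=
  HomologicalComplex.liftCycles _ ((TopCat.toSSet.obj (TopCat.of Circle)).ιChainComplex loopSimplex)
    0 (by simp) loopSimplex_d ≫ HomologicalComplex.homologyπ _ 1

/-- The map on first homology induced by the winding cochain. -/
def windingHom : (TopCat.toSSet.obj (TopCat.of Circle)).homology (ModuleCat.of ℤ ℤ) 1 ⟶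
    ModuleCat.of ℤ ℝ :=
  HomologicalComplex.homologyι _ 1 ≫ HomologicalComplex.descOpcycles _ windingCochain 2
    (by simp) d_windingCochain

/-- The winding homomorphism takes the image of the fundamental class under `g` to `2π deg g`. -/
theorem circleClass_map_windingHom {g : C(Circle, Circle)} :
    circleClass ≫ SSet.homologyMap (TopCat.toSSet.map (TopCat.ofHom g)) (ModuleCat.of ℤ ℤ) 1 ≫
      windingHom = ModuleCat.ofHom (LinearMap.toSpanSingleton ℤ ℝ (2 * Real.pi * deg g)) := by
  have h1 : variation (simplexPath ((TopCat.toSSet.map (TopCat.ofHom g)).app _ loopSimplex)) =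
      2 * Real.pi * deg g := by
    obtain ⟨θ, hθ, hg, hper⟩ := hasDegree_deg g.continuous
    rw [variation_eq (θ := fun t => θ (2 * Real.pi * t)) (by fun_prop)]
    · have := hper 0
      simp at this ⊢
      linarith
    · intro t
      rw [← hg]
      change g (Circle.exp (2 * Real.pi * (stdSimplexHomeomorphUnitInterval.symm t : Fin 2 → ℝ) 1)) = _
      congr 3
  simp only [circleClass, windingHom, Category.assoc, SSet.homologyMap,
    HomologicalComplex.homologyπ_naturality_assoc, HomologicalComplex.homology_π_ι_assoc,
    HomologicalComplex.p_descOpcycles, HomologicalComplex.cyclesMap_i_assoc,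
    HomologicalComplex.liftCycles_i_assoc, SSet.ι_chainComplexMap_f_assoc, ι_windingCochain, h1]

/-- A relation between the maps induced on first homology by two loops passes to the degrees of
their composites with a map to the circle: evaluate on the fundamental class. -/
theorem deg_comp_of_homology_eq (c : ℤ) {X : Set E4} {g d : C(Circle, X)}
    (h : H1map g = c • H1map d) {φ : E4 → Circle} (hφ : ContinuousOn φ X) :
    deg (fun u => φ (g u)) = c * deg (fun u => φ (d u)) := by
  let f : C(X, Circle) := ⟨X.domRestrict φ, hφ.domRestrict⟩
  have key : ∀ e : C(Circle, X), ModuleCat.ofHom (LinearMap.toSpanSingleton ℤ ℝ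
      (2 * Real.pi * deg (fun u => φ (e u)))) = circleClass ≫
      SSet.homologyMap (TopCat.toSSet.map (TopCat.ofHom e)) (ModuleCat.of ℤ ℤ) 1 ≫
      SSet.homologyMap (TopCat.toSSet.map (TopCat.ofHom f)) (ModuleCat.of ℤ ℤ) 1 ≫ windingHom := by
    intro e
    have := circleClass_map_windingHom (g := f.comp e)
    rw [TopCat.ofHom_comp, Functor.map_comp, SSet.homologyMap_comp, Category.assoc] at this
    exact this.symm
  have h' : SSet.homologyMap (TopCat.toSSet.map (TopCat.ofHom g)) (ModuleCat.of ℤ ℤ) 1 =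
      c • SSet.homologyMap (TopCat.toSSet.map (TopCat.ofHom d)) (ModuleCat.of ℤ ℤ) 1 := h
  have hg := key g
  rw [h', Preadditive.zsmul_comp, Preadditive.comp_zsmul, ← key d] at hg
  have := congrArg (fun w => ModuleCat.Hom.hom w (1 : ℤ)) hg
  simp only [ModuleCat.hom_zsmul, ModuleCat.hom_ofHom, LinearMap.smul_apply,
    LinearMap.toSpanSingleton_apply, one_smul, zsmul_eq_mul] at this
  have h2 : 2 * Real.pi * (deg (fun u => φ (g u)) : ℝ) =
      2 * Real.pi * ((c * deg (fun u => φ (d u)) : ℤ) : ℝ) := by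
    rw [this]; push_cast; ring
  exact_mod_cast mul_left_cancel₀ Real.two_pi_pos.ne' h2

end homology

theorem NullHomologous.deg_eq_zero {X : Set E4} {γ : Circle → E4} (h : NullHomologous X γ)
    {φ : E4 → Circle} (hφ : ContinuousOn φ X) : deg (fun u => φ (γ u)) = 0 := by
  obtain ⟨g, hg, h0⟩ := h
  have := deg_comp_of_homology_eq 0 (d := g) (by rw [h0]; simp) hφ
  simpa [hg] using this

theorem HomologyMultiple.deg_eq {X : Set E4} {γ δ : Circle → E4} {n : ℤ}
    (h : HomologyMultiple X γ δ n) {φ : E4 → Circle} (hφ : ContinuousOn φ X) :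
    deg (fun u => φ (γ u)) = n * deg (fun u => φ (δ u)) := by
  obtain ⟨g, d, hg, hd, h0⟩ := h
  have := deg_comp_of_homology_eq n h0 hφ
  simpa [hg, hd] using this

/-! ### Local coordinates on tubular neighbourhoods -/

theorem det4_eq (a b c d : E4) : det4 a b c d =
    a 0 * (b 1 * (c 2 * d 3 - c 3 * d 2) - b 2 * (c 1 * d 3 - c 3 * d 1)
      + b 3 * (c 1 * d 2 - c 2 * d 1))
    - a 1 * (b 0 * (c 2 * d 3 - c 3 * d 2) - b 2 * (c 0 * d 3 - c 3 * d 0)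
      + b 3 * (c 0 * d 2 - c 2 * d 0))
    + a 2 * (b 0 * (c 1 * d 3 - c 3 * d 1) - b 1 * (c 0 * d 3 - c 3 * d 0)
      + b 3 * (c 0 * d 1 - c 1 * d 0))
    - a 3 * (b 0 * (c 1 * d 2 - c 2 * d 1) - b 1 * (c 0 * d 2 - c 2 * d 0)
      + b 2 * (c 0 * d 1 - c 1 * d 0)) := by
  rw [det4, Matrix.det_succ_row_zero]
  simp [Fin.sum_univ_succ, Matrix.det_fin_three, Fin.succAbove]
  ring

/-- Change of basis in the last three arguments of `det4`. -/
theorem det4_comb (x T X Y : E4) (a b c : Fin 3 → ℝ) :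
    det4 x (a 0 • T + a 1 • X + a 2 • Y) (b 0 • T + b 1 • X + b 2 • Y)
      (c 0 • T + c 1 • X + c 2 • Y) =
    (a 0 * (b 1 * c 2 - b 2 * c 1) - a 1 * (b 0 * c 2 - b 2 * c 0)
      + a 2 * (b 0 * c 1 - b 1 * c 0)) * det4 x T X Y := by
  simp only [det4_eq, PiLp.add_apply, PiLp.smul_apply, smul_eq_mul]
  ring

theorem eq_zero_of_det4_pos {x T X Y : E4} (h : 0 < det4 x T X Y) {r a b c : ℝ}
    (h0 : r • x + a • T + b • X + c • Y = 0) : r = 0 ∧ a = 0 ∧ b = 0 ∧ c = 0 := by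
  have key : ∀ s : ℝ, s * det4 x T X Y = 0 → s = 0 := fun s hs =>
    (mul_eq_zero.1 hs).resolve_right h.ne'
  have hz : ∀ A B C : E4, det4 0 A B C = 0 ∧ det4 A 0 B C = 0 ∧ det4 A B 0 C = 0 ∧
      det4 A B C 0 = 0 := fun A B C => by
    simp [det4_eq]
  refine ⟨key _ ?_, key _ ?_, key _ ?_, key _ ?_⟩
  · rw [← (hz T X Y).1, ← h0]
    simp only [det4_eq, PiLp.add_apply, PiLp.smul_apply, smul_eq_mul]
    ring
  · rw [← (hz x X Y).2.1, ← h0]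
    simp only [det4_eq, PiLp.add_apply, PiLp.smul_apply, smul_eq_mul]
    ring
  · rw [← (hz x T Y).2.2.1, ← h0]
    simp only [det4_eq, PiLp.add_apply, PiLp.smul_apply, smul_eq_mul]
    ring
  · rw [← (hz x T X).2.2.2, ← h0]
    simp only [det4_eq, PiLp.add_apply, PiLp.smul_apply, smul_eq_mul]
    ring

namespace TubedKnot

variable (K : TubedKnot)

/-- The parametrisation of a tube, on the universal cover `ℝ × ℂ` of `S¹ × ℂ`. -/
def lift (y : ℝ × ℂ) : E4 := K.toFun (Circle.exp y.1, y.2)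

theorem contDiff_lift : ContDiff ℝ ∞ K.lift := K.smooth

theorem lift_mem (y : ℝ × ℂ) : K.lift y ∈ S3 := K.mem _

theorem lift_pos (y : ℝ × ℂ) : 0 < det4 (K.lift y) (fderiv ℝ K.lift y (1, 0))
    (fderiv ℝ K.lift y (0, 1)) (fderiv ℝ K.lift y (0, Complex.I)) := K.pos y

theorem fderiv_lift_apply (y : ℝ × ℂ) (a : ℝ) (b : ℂ) : fderiv ℝ K.lift y (a, b) =
    a • fderiv ℝ K.lift y (1, 0) + b.re • fderiv ℝ K.lift y (0, 1)
      + b.im • fderiv ℝ K.lift y (0, Complex.I) := by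
  rw [← map_smul, ← map_smul, ← map_smul, ← map_add, ← map_add]
  congr 1
  ext <;> simp

/-- Near a point of a tube, the parametrisation has a differentiable inverse. -/
theorem exists_local_coords (y₀ : ℝ × ℂ) : ∃ Θ : E4 → ℝ × ℂ, Θ (K.lift y₀) = y₀ ∧
    DifferentiableAt ℝ Θ (K.lift y₀) ∧
    ∀ᶠ x in nhds (K.lift y₀), x ∈ S3 → K.lift (Θ x) = x := by
  set L : ℝ × (ℝ × ℂ) →L[ℝ] E4 :=
    (ContinuousLinearMap.fst ℝ ℝ (ℝ × ℂ)).smulRight (K.lift y₀) +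
      (fderiv ℝ K.lift y₀).comp (ContinuousLinearMap.snd ℝ ℝ (ℝ × ℂ)) with hL
  have hinj : Function.Injective L := by
    rw [injective_iff_map_eq_zero]
    rintro ⟨r, a, b⟩ h
    have h' : r • K.lift y₀ + a • fderiv ℝ K.lift y₀ (1, 0) + b.re • fderiv ℝ K.lift y₀ (0, 1)
      + b.im • fderiv ℝ K.lift y₀ (0, Complex.I) = 0 := by
      rw [← h, hL]
      simp only [add_apply, ContinuousLinearMap.smulRight_apply,
        ContinuousLinearMap.coe_fst', ContinuousLinearMap.comp_apply, ContinuousLinearMap.coe_snd']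
      rw [K.fderiv_lift_apply y₀ a b]
      abel
    obtain ⟨rfl, rfl, h1, h2⟩ := eq_zero_of_det4_pos (K.lift_pos y₀) h'
    have : b = 0 := Complex.ext h1 h2
    simp [this]
  have hfr : Module.finrank ℝ (ℝ × (ℝ × ℂ)) = Module.finrank ℝ E4 := by
    simp [Complex.finrank_real_complex]
  let e : (ℝ × (ℝ × ℂ)) ≃L[ℝ] E4 :=
    (LinearEquiv.ofInjectiveOfFinrankEq (L : ℝ × (ℝ × ℂ) →ₗ[ℝ] E4) hinj hfr).toContinuousLinearEquiv
  have he : (e : ℝ × (ℝ × ℂ) →L[ℝ] E4) = L := by ext x <;> rfl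
  -- add a radial coordinate, to apply the inverse function theorem in `ℝ⁴`; the sphere is `r = 0`
  let G : ℝ × (ℝ × ℂ) → E4 := fun z => (1 + z.1) • K.lift z.2
  have hG : HasStrictFDerivAt G (e : ℝ × (ℝ × ℂ) →L[ℝ] E4) (0, y₀) := by
    rw [he]
    have h1 : HasStrictFDerivAt (fun z : ℝ × (ℝ × ℂ) => K.lift z.2)
        ((fderiv ℝ K.lift y₀).comp (ContinuousLinearMap.snd ℝ ℝ (ℝ × ℂ))) (0, y₀) :=
      (K.contDiff_lift.contDiffAt.hasStrictFDerivAt (by simp)).comp (0, y₀) hasStrictFDerivAt_snd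
    have h2 : HasStrictFDerivAt (fun z : ℝ × (ℝ × ℂ) => 1 + z.1)
        (ContinuousLinearMap.fst ℝ ℝ (ℝ × ℂ)) (0, y₀) := hasStrictFDerivAt_fst.const_add 1
    refine (h2.smul h1).congr_fderiv ?_
    ext z <;> simp [hL, add_comm]
  have hG0 : G (0, y₀) = K.lift y₀ := by simp [G]
  refine ⟨fun x => (hG.localInverse G e (0, y₀) x).2, ?_, ?_, ?_⟩
  · have := hG.localInverse_apply_image
    rw [hG0] at this
    simp only [this]
  · have := hG.to_localInverse.differentiableAt
    rw [hG0] at this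
    exact this.snd
  · have h1 := hG.eventually_right_inverse
    have h2 : ContinuousAt (hG.localInverse G e (0, y₀)) (K.lift y₀) := by
      have := hG.localInverse_continuousAt
      rwa [hG0] at this
    rw [hG0] at h1
    have h3 : ∀ᶠ x in nhds (K.lift y₀), 0 < 1 + (hG.localInverse G e (0, y₀) x).1 := by
      have : ContinuousAt (fun x => 1 + (hG.localInverse G e (0, y₀) x).1) (K.lift y₀) := by
        fun_prop
      refine this.eventually (lt_mem_nhds ?_)
      have := hG.localInverse_apply_image
      rw [hG0] at this
      simp [this]
    filter_upwards [h1, h3] with x hx hx' hxS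
    set z := hG.localInverse G e (0, y₀) x with hz
    have hn : ‖G z‖ = ‖x‖ := by rw [hx]
    have hx1 : ‖x‖ = 1 := by simpa using hxS
    have hl1 : ‖K.lift z.2‖ = 1 := by simpa using K.lift_mem z.2
    rw [hx1] at hn
    simp only [G, norm_smul, hl1, mul_one, Real.norm_eq_abs, abs_of_pos hx'] at hn
    have : z.1 = 0 := by linarith
    simpa [G, this] using hx

theorem continuous_toFun : Continuous K.toFun := by
  have hq : Topology.IsQuotientMap (Prod.map Circle.exp id : ℝ × ℂ → Circle × ℂ) :=
    (Circle.isCoveringMap_exp.isLocalHomeomorph.isOpenMap.prodMap IsOpenMap.id).isQuotientMap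
      (Circle.exp.continuous.prodMap continuous_id)
      (Circle.exp_surjective.prodMap Function.surjective_id)
  exact hq.continuous_iff.2 K.contDiff_lift.continuous

/-- The coordinates of a point of the tube. -/
def coords (x : E4) : Circle × ℂ := Function.invFun K.toFun x

@[simp] theorem coords_toFun (c : Circle × ℂ) : K.coords (K.toFun c) = c :=
  Function.leftInverse_invFun K.inj c

theorem toFun_coords {x : E4} (hx : x ∈ range K.toFun) : K.toFun (K.coords x) = x :=
  Function.invFun_eq hx

theorem exists_lift_eq (c : Circle × ℂ) : ∃ t : ℝ, Circle.exp t = c.1 ∧ K.lift (t, c.2) = K.toFun c := by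
  obtain ⟨t, ht⟩ := Circle.exp_surjective c.1
  exact ⟨t, ht, by rw [lift, ht]⟩

theorem image_mem_nhdsWithin {U : Set (Circle × ℂ)} {c : Circle × ℂ} (hU : U ∈ nhds c) :
    K.toFun '' U ∈ nhdsWithin (K.toFun c) S3 := by
  obtain ⟨t, ht, hl⟩ := K.exists_lift_eq c
  obtain ⟨Θ, h0, hd, h⟩ := K.exists_local_coords (t, c.2)
  rw [hl] at h0 hd h
  have hc : ContinuousAt (fun x => (Circle.exp (Θ x).1, (Θ x).2)) (K.toFun c) :=
    (Circle.exp.continuous.continuousAt.comp hd.continuousAt.fst).prodMk hd.continuousAt.snd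
  have hU' : U ∈ nhds (Circle.exp (Θ (K.toFun c)).1, (Θ (K.toFun c)).2) := by
    rw [h0]; simpa [ht] using hU
  rw [mem_nhdsWithin_iff_eventually]
  filter_upwards [h, hc hU'] with x hx hxU hxS
  exact ⟨_, hxU, hx hxS⟩

theorem continuousOn_coords : ContinuousOn K.coords (range K.toFun) := by
  rintro _ ⟨c, rfl⟩
  rw [ContinuousWithinAt, coords_toFun]
  intro U hU
  have h := K.image_mem_nhdsWithin hU
  have hsub : range K.toFun ⊆ S3 := by
    rintro _ ⟨c, rfl⟩; exact K.mem c
  refine Filter.mem_map.2 (Filter.mem_of_superset (nhdsWithin_mono _ hsub h) ?_)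
  rintro _ ⟨d, hd, rfl⟩
  simpa using hd

/-- The images of open sets are open in the sphere. -/
theorem exists_isOpen_image {U : Set (Circle × ℂ)} (hU : IsOpen U) :
    ∃ V : Set E4, IsOpen V ∧ K.toFun '' U = S3 ∩ V := by
  have : ∀ x ∈ K.toFun '' U, ∃ V : Set E4, IsOpen V ∧ x ∈ V ∧ S3 ∩ V ⊆ K.toFun '' U := by
    rintro _ ⟨c, hc, rfl⟩
    obtain ⟨V, hV, hcV, hs⟩ := mem_nhdsWithin.1 (K.image_mem_nhdsWithin (hU.mem_nhds hc))
    exact ⟨V, hV, hcV, by rwa [inter_comm]⟩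
  choose! V hV hxV hs using this
  refine ⟨⋃ x ∈ K.toFun '' U, V x, isOpen_biUnion fun x hx => hV x hx, Subset.antisymm ?_ ?_⟩
  · intro x hx
    refine ⟨?_, mem_biUnion hx (hxV x hx)⟩
    obtain ⟨c, -, rfl⟩ := hx
    exact K.mem c
  · rintro x ⟨hxS, hx⟩
    obtain ⟨y, hy, hxy⟩ := mem_iUnion₂.1 hx
    exact hs y hy ⟨hxS, hxy⟩

theorem isCompact_nbhd : IsCompact K.nbhd :=
  (isCompact_univ.prod (isCompact_closedBall 0 1)).image K.continuous_toFun

theorem isClosed_exterior : IsClosed K.exterior := by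
  obtain ⟨V, hV, h⟩ := K.exists_isOpen_image (isOpen_univ.prod (isOpen_ball (x := (0 : ℂ)) (ε := 1)))
  rw [exterior, h, sdiff_self_inter]
  exact isClosed_sphere.sdiff hV

theorem toFun_mem_nbhd {c : Circle × ℂ} : K.toFun c ∈ K.nbhd ↔ ‖c.2‖ ≤ 1 := by
  rw [nbhd, K.inj.mem_set_image]; simp

theorem toFun_mem_boundary {c : Circle × ℂ} : K.toFun c ∈ K.boundary ↔ ‖c.2‖ = 1 := by
  rw [boundary, K.inj.mem_set_image]; simp

theorem toFun_mem_exterior {c : Circle × ℂ} : K.toFun c ∈ K.exterior ↔ 1 ≤ ‖c.2‖ := by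
  rw [exterior, mem_sdiff, K.inj.mem_set_image, and_iff_right (K.mem c)]; simp

theorem toFun_mem_complement {c : Circle × ℂ} : K.toFun c ∈ K.complement ↔ c.2 ≠ 0 := by
  have h : K.toFun c ∈ range K.core ↔ c.2 = 0 := by
    constructor
    · rintro ⟨u, hu⟩
      have := K.inj hu
      rw [← this]
    · intro h
      exact ⟨c.1, by rw [core, ← h]⟩
  rw [complement, mem_sdiff, h, and_iff_right (K.mem c)]

theorem nbhd_subset_range : K.nbhd ⊆ range K.toFun := image_subset_range _ _

theorem mem_exterior_of_notMem_nbhd {x : E4} (hx : x ∈ S3) (h : x ∉ K.nbhd) : x ∈ K.exterior :=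
  ⟨hx, fun h' => h (image_mono (prod_mono Subset.rfl ball_subset_closedBall) h')⟩

theorem exterior_subset_complement : K.exterior ⊆ K.complement := by
  rintro x ⟨hx, h⟩
  refine ⟨hx, ?_⟩
  rintro ⟨u, rfl⟩
  exact h ⟨(u, 0), by simp, rfl⟩

open Classical in
/-- The retraction of the complement of a knot onto its exterior along the rays of the tube. -/
def retract (x : E4) : E4 :=
  if x ∈ range K.toFun then
    K.toFun ((K.coords x).1, ((max 1 ‖(K.coords x).2‖ / ‖(K.coords x).2‖ : ℝ) : ℂ) * (K.coords x).2)
  else x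

theorem retract_toFun (u : Circle) (v : ℂ) :
    K.retract (K.toFun (u, v)) = K.toFun (u, ((max 1 ‖v‖ / ‖v‖ : ℝ) : ℂ) * v) := by
  rw [retract, if_pos (mem_range_self _), coords_toFun]

theorem retract_of_mem_exterior {x : E4} (hx : x ∈ K.exterior) : K.retract x = x := by
  by_cases h : x ∈ range K.toFun
  · obtain ⟨⟨u, v⟩, rfl⟩ := h
    have hv : 1 ≤ ‖v‖ := K.toFun_mem_exterior.1 hx
    have hv0 : ‖v‖ ≠ 0 := by positivity
    rw [retract_toFun, max_eq_right hv, div_self hv0]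
    simp
  · rw [retract, if_neg h]

theorem retract_mem_exterior {x : E4} (hx : x ∈ K.complement) : K.retract x ∈ K.exterior := by
  by_cases h : x ∈ range K.toFun
  · obtain ⟨⟨u, v⟩, rfl⟩ := h
    have hv : v ≠ 0 := K.toFun_mem_complement.1 hx
    have hv0 : ‖v‖ ≠ 0 := norm_ne_zero_iff.2 hv
    rw [retract_toFun, toFun_mem_exterior]
    simp only [norm_mul, Complex.norm_real, Real.norm_eq_abs, abs_div, abs_norm]
    rw [div_mul_cancel₀ _ hv0]
    exact (le_max_left _ _).trans (le_abs_self _)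
  · rw [retract, if_neg h]
    exact K.mem_exterior_of_notMem_nbhd hx.1 fun h' => h (K.nbhd_subset_range h')

theorem continuousOn_retract : ContinuousOn K.retract K.complement := by
  intro x hx
  by_cases h : x ∈ range K.toFun
  · have hr : range K.toFun ∈ nhdsWithin x S3 := by
      obtain ⟨c, rfl⟩ := h
      rw [← image_univ]
      exact K.image_mem_nhdsWithin Filter.univ_mem
    have hsub : K.complement ⊆ S3 := sdiff_subset
    have hc : ContinuousWithinAt K.coords K.complement x :=
      (K.continuousOn_coords x h).mono_of_mem_nhdsWithin (nhdsWithin_mono _ hsub hr)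
    have hv : (K.coords x).2 ≠ 0 := by
      rw [← K.toFun_mem_complement, K.toFun_coords h]; exact hx
    have hv0 : ‖(K.coords x).2‖ ≠ 0 := norm_ne_zero_iff.2 hv
    have hf : ContinuousWithinAt (fun x => K.toFun ((K.coords x).1,
        ((max 1 ‖(K.coords x).2‖ / ‖(K.coords x).2‖ : ℝ) : ℂ) * (K.coords x).2)) K.complement x := by
      refine K.continuous_toFun.continuousAt.comp_continuousWithinAt (hc.fst.prodMk ?_)
      refine ContinuousWithinAt.mul ?_ hc.snd
      refine Complex.continuous_ofReal.continuousAt.comp_continuousWithinAt ?_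
      exact (continuousWithinAt_const.max hc.snd.norm).div hc.snd.norm hv0
    refine hf.congr_of_eventuallyEq ?_ ?_
    · filter_upwards [nhdsWithin_mono _ hsub hr] with y hy
      rw [retract, if_pos hy]
    · rw [retract, if_pos h]
  · have hn : K.nbhdᶜ ∈ nhds x := K.isCompact_nbhd.isClosed.isOpen_compl.mem_nhds
      fun h' => h (K.nbhd_subset_range h')
    refine continuousWithinAt_id.congr_of_eventuallyEq ?_ ?_
    · filter_upwards [nhdsWithin_le_nhds hn, self_mem_nhdsWithin] with y hy hy'
      exact K.retract_of_mem_exterior (K.mem_exterior_of_notMem_nbhd hy'.1 hy)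
    · rw [retract, if_neg h, id]

end TubedKnot

/-! ### A map to the circle dual to a knot -/

/-- The direction `z / |z|` of a non-zero complex number (and `1` for `z = 0`). -/
def dir (z : ℂ) : Circle := Circle.exp z.arg

theorem coe_dir {z : ℂ} (h : z ≠ 0) : (dir z : ℂ) = z / ‖z‖ := by
  have h0 : (‖z‖ : ℂ) ≠ 0 := by simpa using h
  rw [dir, Circle.coe_exp, eq_div_iff h0, mul_comm, Complex.norm_mul_exp_arg_mul_I]

theorem dir_mul {z w : ℂ} (hz : z ≠ 0) (hw : w ≠ 0) : dir (z * w) = dir z * dir w := by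
  ext
  rw [Circle.coe_mul, coe_dir hz, coe_dir hw, coe_dir (mul_ne_zero hz hw)]
  push_cast [norm_mul]
  field_simp

@[simp] theorem dir_coe (u : Circle) : dir (u : ℂ) = u := by
  ext
  rw [coe_dir (Circle.coe_ne_zero u), Circle.norm_coe]
  simp

theorem dir_ofReal {r : ℝ} (hr : 0 < r) : dir (r : ℂ) = 1 := by
  ext
  have : (r : ℂ) ≠ 0 := by exact_mod_cast hr.ne'
  rw [coe_dir this]
  simp [abs_of_pos hr, this]

theorem dir_ofReal_mul {r : ℝ} (hr : 0 < r) {z : ℂ} (hz : z ≠ 0) : dir (r * z) = dir z := by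
  rw [dir_mul (by exact_mod_cast hr.ne') hz, dir_ofReal hr, one_mul]

theorem continuousOn_dir : ContinuousOn dir {0}ᶜ := by
  rw [continuousOn_iff_continuous_domRestrict]
  refine Continuous.congr (f := fun z : ({0}ᶜ : Set ℂ) => (⟨z / ‖(z : ℂ)‖, by
    change (z : ℂ) / ‖(z : ℂ)‖ ∈ sphere (0 : ℂ) 1
    have : (z : ℂ) ≠ 0 := z.2
    simp [this]⟩ : Circle)) ?_ ?_
  · refine Continuous.subtype_mk ?_ _
    refine continuous_subtype_val.div (by fun_prop) fun z => ?_
    have : (z : ℂ) ≠ 0 := z.2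
    simpa using this
  · intro z
    ext
    have : (z : ℂ) ≠ 0 := z.2
    simp [coe_dir this]

theorem continuousOn_dir_comp {A : Type*} [TopologicalSpace A] {f : A → ℂ} {S : Set A}
    (hf : ContinuousOn f S) (h : ∀ a ∈ S, f a ≠ 0) : ContinuousOn (fun a => dir (f a)) S :=
  continuousOn_dir.comp hf h

theorem continuous_dir {A : Type*} [TopologicalSpace A] {f : A → ℂ}
    (hf : Continuous f) (h : ∀ a, f a ≠ 0) : Continuous (fun a => dir (f a)) :=
  continuousOn_univ.1 (continuousOn_dir_comp hf.continuousOn fun a _ => h a)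

theorem continuous_circle_coe : Continuous ((↑) : Circle → ℂ) := continuous_subtype_val

/-- A loop in the circle that extends over the disc has degree zero. -/
theorem deg_eq_zero_of_disc {g : ℂ → Circle} (hg : ContinuousOn g (closedBall 0 1)) :
    deg (fun v => g v) = 0 := by
  have h := deg_eq_of_homotopy (S := Icc (0 : ℝ) 1) (H := fun r v => g (r * v)) isPreconnected_Icc
    (by
      refine hg.comp ?_ ?_
      · have := continuous_circle_coe
        fun_prop
      · rintro ⟨r, v⟩ ⟨hr, -⟩
        simp only [mem_Icc] at hr
        simp [abs_of_nonneg hr.1, Circle.norm_coe, hr.2])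
    (y := 1) (y' := 0) (by simp) (by simp)
  simp only [Complex.ofReal_one, one_mul, Complex.ofReal_zero, zero_mul] at h
  rw [h, deg_const]

/-- A field of projections along a null-homotopy admits a nowhere vanishing section: project
successively along a fine subdivision of the homotopy. -/
theorem exists_section {X E : Type*} [PseudoMetricSpace X] [CompactSpace X]
    [NormedAddCommGroup E] [NormedSpace ℂ E] {A : unitInterval × X → E →L[ℂ] E}
    (hA : Continuous A) (hproj : ∀ z w, A z (A z w) = A z w) {s₀ : E} (hs₀ : s₀ ≠ 0)
    (h0 : ∀ x, A (0, x) s₀ = s₀) :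
    ∃ s : X → E, Continuous s ∧ ∀ x, s x ≠ 0 ∧ A (1, x) (s x) = s x := by
  obtain ⟨δ, hδ, hu⟩ := Metric.uniformContinuous_iff.1
    (CompactSpace.uniformContinuous_of_continuous hA) 1 one_pos
  obtain ⟨N, hN⟩ := exists_nat_gt (1 / δ)
  have hN0 : (0 : ℝ) < N := lt_trans (by positivity) hN
  let τ : ℕ → unitInterval := fun k => projIcc 0 1 zero_le_one (k / N : ℝ)
  have key : ∀ k : ℕ, ∃ s : X → E, Continuous s ∧ ∀ x, s x ≠ 0 ∧ A (τ k, x) (s x) = s x := by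
    intro k
    induction k with
    | zero =>
      refine ⟨fun _ => s₀, continuous_const, fun x => ⟨hs₀, ?_⟩⟩
      have : τ 0 = 0 := by
        simp only [τ, Nat.cast_zero, zero_div]
        exact projIcc_left _
      rw [this, h0]
    | succ k ih =>
      obtain ⟨s, hs, h⟩ := ih
      refine ⟨fun x => A (τ (k + 1), x) (s x), by fun_prop, fun x => ⟨fun hz => ?_, hproj _ _⟩⟩
      change A (τ (k + 1), x) (s x) = 0 at hz
      have hd : dist (τ k, x) (τ (k + 1), x) < δ := by
        rw [Prod.dist_eq, dist_self, max_eq_left dist_nonneg]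
        have h1 : dist (τ k) (τ (k + 1)) ≤ dist (k / N : ℝ) ((k + 1 : ℕ) / N : ℝ) := by
          have := (LipschitzWith.projIcc (zero_le_one (α := ℝ))).dist_le_mul (k / N : ℝ)
            ((k + 1 : ℕ) / N : ℝ)
          simpa [τ] using this
        refine h1.trans_lt ?_
        rw [Real.dist_eq, ← sub_div, abs_div, abs_of_pos hN0]
        push_cast
        rw [div_lt_iff₀ hN0]
        rw [div_lt_iff₀ hδ] at hN
        simp
        linarith
      have h2 := hu hd
      rw [dist_eq_norm] at h2
      have h3 : ‖(A (τ k, x) - A (τ (k + 1), x)) (s x)‖ = ‖s x‖ := by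
        rw [sub_apply, hz, sub_zero, (h x).2]
      have h4 := (A (τ k, x) - A (τ (k + 1), x)).le_opNorm (s x)
      have h5 : 0 < ‖s x‖ := norm_pos_iff.2 (h x).1
      nlinarith
  obtain ⟨s, hs, h⟩ := key N
  refine ⟨s, hs, fun x => ?_⟩
  have : τ N = 1 := by
    simp only [τ, div_self hN0.ne']
    exact projIcc_right _
  rw [← this]
  exact h x

/-- A vector in `ℂ²` spanning the line over the point with coordinate `v` in a fibre of the tube. -/
def collapseVec (v : ℂ) : EuclideanSpace ℂ (Fin 2) := !₂[v, ((max 0 (1 - ‖v‖) : ℝ) : ℂ)]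

/-- The orthogonal projection onto the line spanned by `collapseVec v`. -/
def collapseProj (v : ℂ) : EuclideanSpace ℂ (Fin 2) →L[ℂ] EuclideanSpace ℂ (Fin 2) :=
  (((‖collapseVec v‖ ^ 2)⁻¹ : ℝ) : ℂ) • InnerProductSpace.rankOne ℂ (collapseVec v) (collapseVec v)

theorem continuous_collapseVec : Continuous collapseVec := by
  unfold collapseVec
  refine (PiLp.continuous_toLp 2 _).comp (continuous_pi fun i => ?_)
  fin_cases i <;> simp <;> fun_prop

theorem collapseVec_ne_zero (v : ℂ) : collapseVec v ≠ 0 := by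
  intro h
  have h0 : v = 0 := congrArg (fun w : EuclideanSpace ℂ (Fin 2) => w 0) h
  have h1 : ((max 0 (1 - ‖v‖) : ℝ) : ℂ) = 0 :=
    congrArg (fun w : EuclideanSpace ℂ (Fin 2) => w 1) h
  rw [h0] at h1
  simp at h1

theorem collapseProj_apply (v : ℂ) (w : EuclideanSpace ℂ (Fin 2)) : collapseProj v w =
    ((((‖collapseVec v‖ ^ 2)⁻¹ : ℝ) : ℂ) * inner ℂ (collapseVec v) w) • collapseVec v := by
  simp [collapseProj, smul_smul]

theorem collapseProj_self (v : ℂ) : collapseProj v (collapseVec v) = collapseVec v := by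
  have : (‖collapseVec v‖ : ℂ) ≠ 0 := by simpa using collapseVec_ne_zero v
  rw [collapseProj_apply, inner_self_eq_norm_sq_to_K]
  have h2 : (((‖collapseVec v‖ ^ 2)⁻¹ : ℝ) : ℂ) * (RCLike.ofReal ‖collapseVec v‖ : ℂ) ^ 2 = 1 := by
    rw [Complex.coe_algebraMap.symm.trans rfl]
    push_cast
    exact inv_mul_cancel₀ (pow_ne_zero 2 this)
  rw [h2, one_smul]

theorem collapseProj_idem (v : ℂ) (w : EuclideanSpace ℂ (Fin 2)) :
    collapseProj v (collapseProj v w) = collapseProj v w := by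
  rw [collapseProj_apply v w, map_smul, collapseProj_self]

theorem continuous_collapseProj : Continuous collapseProj := by
  unfold collapseProj
  have h := continuous_collapseVec
  have h0 : ∀ v, ‖collapseVec v‖ ^ 2 ≠ 0 := fun v => by simpa using collapseVec_ne_zero v
  refine Continuous.smul (Complex.continuous_ofReal.comp ((h.norm.pow 2).inv₀ h0)) ?_
  simp only [InnerProductSpace.rankOne_def]
  exact (ContinuousLinearMap.smulRightL ℂ (EuclideanSpace ℂ (Fin 2))
    (EuclideanSpace ℂ (Fin 2))).continuous₂.comp (((innerSL ℂ).continuous.comp h).prodMk h)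

theorem collapseProj_eq_of_one_le {v : ℂ} (hv : 1 ≤ ‖v‖) : collapseProj v = collapseProj 1 := by
  have h1 : collapseVec v = v • collapseVec 1 := by
    ext i
    fin_cases i <;> simp [collapseVec, hv]
  have hv0 : v ≠ 0 := norm_pos_iff.1 (by linarith)
  ext1 w
  rw [collapseProj_apply, collapseProj_apply, h1, smul_smul, norm_smul, inner_smul_left]
  congr 1
  have h2 : (‖collapseVec 1‖ : ℂ) ≠ 0 := by simpa using collapseVec_ne_zero 1
  have h3 : (‖v‖ : ℂ) ≠ 0 := by simpa using hv0
  have h4 : v * (starRingEnd ℂ) v = (‖v‖ : ℂ) ^ 2 := by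
    rw [Complex.mul_conj, Complex.normSq_eq_norm_sq]; push_cast; rfl
  push_cast
  field_simp
  linear_combination (inner ℂ (collapseVec 1) w) * h4

namespace TubedKnot

variable (K : TubedKnot)

open Classical in
/-- The field of complex lines given by the Pontryagin-Thom collapse onto the tube: constant
outside the tube, it turns once around the projective line on each fibre disc. -/
def collapse (x : E4) : EuclideanSpace ℂ (Fin 2) →L[ℂ] EuclideanSpace ℂ (Fin 2) :=
  if x ∈ range K.toFun then collapseProj (K.coords x).2 else collapseProj 1

theorem collapse_toFun (c : Circle × ℂ) : K.collapse (K.toFun c) = collapseProj c.2 := by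
  rw [collapse, if_pos (mem_range_self _), coords_toFun]

theorem collapse_of_mem_exterior {x : E4} (hx : x ∈ K.exterior) :
    K.collapse x = collapseProj 1 := by
  by_cases h : x ∈ range K.toFun
  · obtain ⟨c, rfl⟩ := h
    rw [collapse_toFun, collapseProj_eq_of_one_le (K.toFun_mem_exterior.1 hx)]
  · rw [collapse, if_neg h]

theorem exists_collapse_eq (x : E4) : ∃ v, K.collapse x = collapseProj v := by
  unfold collapse
  split_ifs
  exacts [⟨_, rfl⟩, ⟨_, rfl⟩]

theorem continuousOn_collapse : ContinuousOn K.collapse S3 := by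
  intro x hx
  by_cases h : x ∈ range K.toFun
  · have hr : range K.toFun ∈ nhdsWithin x S3 := by
      obtain ⟨c, rfl⟩ := h
      rw [← image_univ]
      exact K.image_mem_nhdsWithin Filter.univ_mem
    have hc : ContinuousWithinAt K.coords S3 x :=
      (K.continuousOn_coords x h).mono_of_mem_nhdsWithin hr
    refine (continuous_collapseProj.continuousAt.comp_continuousWithinAt
      hc.snd).congr_of_eventuallyEq ?_ ?_
    · filter_upwards [hr] with y hy
      rw [collapse, if_pos hy]; rfl
    · rw [collapse, if_pos h]; rfl
  · have hn : K.nbhdᶜ ∈ nhds x := K.isCompact_nbhd.isClosed.isOpen_compl.mem_nhds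
      fun h' => h (K.nbhd_subset_range h')
    refine (continuousWithinAt_const (b := collapseProj 1)).congr_of_eventuallyEq ?_ ?_
    · filter_upwards [nhdsWithin_le_nhds hn, self_mem_nhdsWithin] with y hy hy'
      exact K.collapse_of_mem_exterior (K.mem_exterior_of_notMem_nbhd hy' hy)
    · rw [collapse, if_neg h]

/-- The exterior of a knot together with one meridian disc is a compact set that misses a point of
the sphere, so the collapse map has a section over it. -/
theorem exists_collapse_section : ∃ s : E4 → EuclideanSpace ℂ (Fin 2),
    ContinuousOn s (K.exterior ∪ K.toFun '' ({1} ×ˢ closedBall 0 1)) ∧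
    ∀ x ∈ K.exterior ∪ K.toFun '' ({1} ×ˢ closedBall 0 1), s x ≠ 0 ∧ K.collapse x (s x) = s x := by
  classical
  set C := K.exterior ∪ K.toFun '' ({1} ×ˢ closedBall 0 1) with hC
  set P := K.toFun (Circle.exp Real.pi, 0) with hP
  have hCS : C ⊆ S3 := by
    refine union_subset sdiff_subset ?_
    rintro _ ⟨c, -, rfl⟩
    exact K.mem c
  have hPC : P ∉ C := by
    rintro (h | ⟨c, hc, h⟩)
    · have := K.toFun_mem_exterior.1 h
      simp at this
      linarith
    · have h1 := congrArg Prod.fst (K.inj h)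
      rw [mem_singleton_iff.1 hc.1] at h1
      have h2 := congrArg (fun u : Circle => (u : ℂ)) h1
      simp [Circle.coe_exp] at h2
      norm_num at h2
  have hCc : IsCompact C := by
    refine IsCompact.union ?_ ?_
    · exact (isCompact_sphere (0 : E4) 1).of_isClosed_subset K.isClosed_exterior sdiff_subset
    · exact (isCompact_singleton.prod (isCompact_closedBall 0 1)).image K.continuous_toFun
  have : CompactSpace C := isCompact_iff_compactSpace.1 hCc
  have hP1 : ‖P‖ = 1 := by simpa using K.mem (Circle.exp Real.pi, 0)
  -- the great circle arcs from `-P` to the points of `C` avoid `P`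
  let ν : unitInterval × C → E4 := fun z => (z.1 : ℝ) • (z.2 : E4) - (1 - (z.1 : ℝ)) • P
  have hν : Continuous ν := by fun_prop
  have hν0 : ∀ z, ν z ≠ 0 := by
    rintro ⟨⟨t, ht⟩, ⟨x, hx⟩⟩ h
    have hx1 : ‖x‖ = 1 := by simpa using hCS hx
    have h1 : t • x = (1 - t) • P := sub_eq_zero.1 h
    have h2 := congrArg norm h1
    rw [norm_smul, norm_smul, hx1, hP1, mul_one, mul_one, Real.norm_of_nonneg ht.1,
      Real.norm_of_nonneg (by linarith [ht.2])] at h2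
    have h3 : t = 1 / 2 := by linarith
    rw [h3, show (1 - 1 / 2 : ℝ) = 1 / 2 by norm_num] at h1
    have h4 : x = P := smul_right_injective E4 (show (1 / 2 : ℝ) ≠ 0 by norm_num) h1
    exact hPC (h4 ▸ hx)
  let G : unitInterval × C → E4 := fun z => ‖ν z‖⁻¹ • ν z
  have hG : Continuous G := (hν.norm.inv₀ fun z => norm_ne_zero_iff.2 (hν0 z)).smul hν
  have hGS : ∀ z, G z ∈ S3 := fun z => by
    have := norm_ne_zero_iff.2 (hν0 z)
    simp [G, norm_smul, this]
  have hG0 : ∀ x, G (0, x) = -P := fun x => by simp [G, ν, hP1]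
  have hG1 : ∀ x : C, G (1, x) = x := fun x => by
    have hx1 : ‖(x : E4)‖ = 1 := by simpa using hCS x.2
    simp [G, ν, hx1]
  obtain ⟨v₀, hv₀⟩ := K.exists_collapse_eq (-P)
  obtain ⟨s, hs, h⟩ := exists_section (A := fun z => K.collapse (G z))
    (K.continuousOn_collapse.comp_continuous hG hGS)
    (fun z w => by
      obtain ⟨v, hv⟩ := K.exists_collapse_eq (G z)
      rw [hv, collapseProj_idem])
    (collapseVec_ne_zero v₀) (fun x => by rw [hG0, hv₀, collapseProj_self])
  refine ⟨fun x => if hx : x ∈ C then s ⟨x, hx⟩ else 0, ?_, fun x hx => ?_⟩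
  · rw [continuousOn_iff_continuous_domRestrict]
    refine hs.congr fun x => ?_
    simp
  · have := h ⟨x, hx⟩
    rw [hG1] at this
    simpa [hx] using this

/-- For every knot there is a map from its complement to the circle which has degree one on the
meridian. -/
theorem exists_dual_map : ∃ φ : E4 → Circle, ContinuousOn φ K.complement ∧
    deg (fun v => φ (K.meridian v)) = 1 := by
  obtain ⟨s, hs, h⟩ := K.exists_collapse_section
  have hs0 : ContinuousOn (fun x => s x 0) K.exterior := by
    have := hs.mono subset_union_left
    exact (PiLp.continuous_apply 2 _ 0).comp_continuousOn this
  have hne : ∀ x ∈ K.exterior, s x 0 ≠ 0 := by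
    intro x hx h0
    obtain ⟨h1, h2⟩ := h x (Or.inl hx)
    rw [K.collapse_of_mem_exterior hx, collapseProj_apply] at h2
    refine h1 ?_
    have h3 := congrArg (fun w : EuclideanSpace ℂ (Fin 2) => w 0) h2
    simp only [PiLp.smul_apply, h0] at h3
    have h4 : collapseVec 1 0 = 1 := rfl
    rw [h4, smul_eq_mul, mul_one] at h3
    rw [← h2, h3, zero_smul]
  refine ⟨fun x => dir (s (K.retract x) 0),
    (continuousOn_dir_comp hs0 hne).comp K.continuousOn_retract fun x hx =>
      K.retract_mem_exterior hx, ?_⟩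
  -- on the meridian disc the section is `c z • collapseVec z`
  let c : ℂ → ℂ := fun z => (((‖collapseVec z‖ ^ 2)⁻¹ : ℝ) : ℂ) *
    inner ℂ (collapseVec z) (s (K.toFun (1, z)))
  have hmem : ∀ z ∈ closedBall (0 : ℂ) 1,
      K.toFun (1, z) ∈ K.exterior ∪ K.toFun '' ({1} ×ˢ closedBall 0 1) :=
    fun z hz => Or.inr ⟨(1, z), ⟨rfl, hz⟩, rfl⟩
  have hcs : ∀ z ∈ closedBall (0 : ℂ) 1, s (K.toFun (1, z)) = c z • collapseVec z := fun z hz => by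
    have := (h _ (hmem z hz)).2
    rw [collapse_toFun, collapseProj_apply] at this
    exact this.symm
  have hc0 : ∀ z ∈ closedBall (0 : ℂ) 1, c z ≠ 0 := fun z hz h0 => by
    refine (h _ (hmem z hz)).1 ?_
    rw [hcs z hz, h0, zero_smul]
  have hcc : ContinuousOn c (closedBall 0 1) := by
    have h1 : ContinuousOn (fun z => s (K.toFun (1, z))) (closedBall 0 1) :=
      hs.comp (K.continuous_toFun.comp (by fun_prop)).continuousOn hmem
    have h0 : ∀ v, ‖collapseVec v‖ ^ 2 ≠ 0 := fun v => by simpa using collapseVec_ne_zero v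
    refine ContinuousOn.mul ?_ (ContinuousOn.inner (𝕜 := ℂ) continuous_collapseVec.continuousOn h1)
    exact (Complex.continuous_ofReal.comp
      ((continuous_collapseVec.norm.pow 2).inv₀ h0)).continuousOn
  have hball : ∀ v : Circle, (v : ℂ) ∈ closedBall (0 : ℂ) 1 := fun v => by
    simp [Circle.norm_coe]
  have hv : ∀ v : Circle, dir (s (K.retract (K.meridian v)) 0) = dir (c v) * v := fun v => by
    have hx : K.meridian v ∈ K.exterior := K.toFun_mem_exterior.2 (by simp [Circle.norm_coe])
    rw [K.retract_of_mem_exterior hx, meridian, hcs v (hball v)]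
    have : (c v • collapseVec (v : ℂ)) 0 = c v * v := rfl
    rw [this, dir_mul (hc0 v (hball v)) (Circle.coe_ne_zero v), dir_coe]
  have hd := continuousOn_dir_comp hcc hc0
  have hdc : Continuous fun v : Circle => dir (c v) :=
    hd.comp_continuous continuous_circle_coe hball
  rw [funext hv, deg_mul hdc continuous_id', deg_eq_zero_of_disc hd, zero_add]
  exact deg_id

end TubedKnot

/-! ### Indices of zeros in the plane -/

/-- The determinant of a real-linear endomorphism of `ℂ`. -/
def detC (L : ℂ →L[ℝ] ℂ) : ℝ := (L 1).re * (L Complex.I).im - (L 1).im * (L Complex.I).re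

theorem deg_dir_const_mul {a : ℂ} (ha : a ≠ 0) : deg (fun v => dir (a * v)) = 1 := by
  rw [show (fun v : Circle => dir (a * v)) = fun v => dir a * v from funext fun v => by
    rw [dir_mul ha (Circle.coe_ne_zero v), dir_coe],
    deg_mul continuous_const continuous_id', deg_const, deg_id, zero_add]

theorem deg_dir_const_mul_conj {a : ℂ} (ha : a ≠ 0) :
    deg (fun v => dir (a * (starRingEnd ℂ) v)) = -1 := by
  have h : ∀ v : Circle, dir (a * (starRingEnd ℂ) v) = dir a * v⁻¹ := fun v => by
    rw [← Circle.coe_inv_eq_conj, dir_mul ha (Circle.coe_ne_zero _), dir_coe]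
  rw [funext h, deg_mul_inv continuous_const continuous_id', deg_const, deg_id, zero_sub]

/-- The index of a real-linear isomorphism of the plane is the sign of its determinant. -/
theorem deg_dir_linear (L : ℂ →L[ℝ] ℂ) (hL : detC L ≠ 0) :
    deg (fun v => dir (L v)) = (SignType.sign (detC L) : ℤ) := by
  set a := (L 1 - Complex.I * L Complex.I) / 2 with ha
  set b := (L 1 + Complex.I * L Complex.I) / 2 with hb
  have hLv : ∀ v : ℂ, L v = a * v + b * (starRingEnd ℂ) v := fun v => by
    have h1 : v = v.re • (1 : ℂ) + v.im • Complex.I := by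
      apply Complex.ext <;> simp
    conv_lhs => rw [h1, map_add, map_smul, map_smul]
    apply Complex.ext <;> simp [ha, hb] <;> ring
  have hdet : detC L = ‖a‖ ^ 2 - ‖b‖ ^ 2 := by
    rw [← Complex.normSq_eq_norm_sq, ← Complex.normSq_eq_norm_sq, Complex.normSq_apply,
      Complex.normSq_apply]
    simp [detC, ha, hb]
    ring
  have hcoe := continuous_circle_coe
  rcases lt_or_gt_of_ne hL with h | h
  · have hab : ‖a‖ < ‖b‖ := by
      rw [hdet] at h
      exact lt_of_pow_lt_pow_left₀ 2 (norm_nonneg _) (by linarith)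
    have hb0 : b ≠ 0 := norm_pos_iff.1 (lt_of_le_of_lt (norm_nonneg _) hab)
    rw [sign_neg h]
    have := deg_eq_of_homotopy (S := Icc (0 : ℝ) 1)
      (H := fun t v => dir (t * (a * v) + b * (starRingEnd ℂ) v)) isPreconnected_Icc
      (by
        refine continuousOn_dir_comp (Continuous.continuousOn ?_) ?_
        · have := Complex.continuous_conj; fun_prop
        · rintro ⟨t, v⟩ ⟨ht, -⟩ h0
          have h1 : b * (starRingEnd ℂ) v = -(t * (a * v)) := by linear_combination h0
          have h2 := congrArg norm h1
          simp [abs_of_nonneg ht.1, Circle.norm_coe] at h2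
          nlinarith [ht.1, ht.2, norm_nonneg a])
      (y := 1) (y' := 0) (by simp) (by simp)
    simp only [Complex.ofReal_one, one_mul, Complex.ofReal_zero, zero_mul, zero_add] at this
    simp only [hLv, this, deg_dir_const_mul_conj hb0]
    simp
  · have hab : ‖b‖ < ‖a‖ := by
      rw [hdet] at h
      exact lt_of_pow_lt_pow_left₀ 2 (norm_nonneg _) (by linarith)
    have ha0 : a ≠ 0 := norm_pos_iff.1 (lt_of_le_of_lt (norm_nonneg _) hab)
    rw [sign_pos h]
    have := deg_eq_of_homotopy (S := Icc (0 : ℝ) 1)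
      (H := fun t v => dir (a * v + t * (b * (starRingEnd ℂ) v))) isPreconnected_Icc
      (by
        refine continuousOn_dir_comp (Continuous.continuousOn ?_) ?_
        · have := Complex.continuous_conj; fun_prop
        · rintro ⟨t, v⟩ ⟨ht, -⟩ h0
          have h1 : a * v = -(t * (b * (starRingEnd ℂ) v)) := by linear_combination h0
          have h2 := congrArg norm h1
          simp [abs_of_nonneg ht.1, Circle.norm_coe] at h2
          nlinarith [ht.1, ht.2, norm_nonneg b])
      (y := 1) (y' := 0) (by simp) (by simp)
    simp only [Complex.ofReal_one, one_mul, Complex.ofReal_zero, zero_mul, add_zero] at this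
    simp only [hLv, this, deg_dir_const_mul ha0]
    simp

theorem injective_of_detC_ne_zero {L : ℂ →L[ℝ] ℂ} (hL : detC L ≠ 0) : Function.Injective L := by
  rw [injective_iff_map_eq_zero]
  intro v hv
  have h1 : v = v.re • (1 : ℂ) + v.im • Complex.I := by
    apply Complex.ext <;> simp
  rw [h1, map_add, map_smul, map_smul] at hv
  have hre := congrArg Complex.re hv
  have him := congrArg Complex.im hv
  simp at hre him
  have h2 : v.re * detC L = 0 := by
    rw [detC]; linear_combination (L Complex.I).im * hre - (L Complex.I).re * him
  have h3 : v.im * detC L = 0 := by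
    rw [detC]; linear_combination (L 1).re * him - (L 1).im * hre
  exact Complex.ext ((mul_eq_zero.1 h2).resolve_right hL) ((mul_eq_zero.1 h3).resolve_right hL)

theorem exists_pos_mul_le_norm {L : ℂ →L[ℝ] ℂ} (hL : detC L ≠ 0) :
    ∃ c > 0, ∀ v, c * ‖v‖ ≤ ‖L v‖ := by
  obtain ⟨k, hk, hka⟩ := L.toLinearMap.injective_iff_antilipschitz.1 (injective_of_detC_ne_zero hL)
  refine ⟨(k : ℝ)⁻¹, by positivity, fun v => ?_⟩
  have := hka.le_mul_dist v 0
  simp only [dist_zero_right, ContinuousLinearMap.coe_coe, map_zero] at this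
  rw [inv_mul_le_iff₀ (by exact_mod_cast hk)]
  exact this

/-- The index of a non-degenerate zero is the sign of the determinant of the derivative. -/
theorem deg_dir_small_circle {F : ℂ → ℂ} {L : ℂ →L[ℝ] ℂ} {z₀ : ℂ} (hF : HasFDerivAt F L z₀)
    (h0 : F z₀ = 0) (hL : detC L ≠ 0) : ∃ ε > 0, ∀ r ∈ Ioo (0 : ℝ) ε,
      ContinuousOn F (sphere z₀ r) →
      deg (fun v => dir (F (z₀ + r * v))) = (SignType.sign (detC L) : ℤ) := by
  have hinj := injective_of_detC_ne_zero hL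
  obtain ⟨c, hc, hcL⟩ := exists_pos_mul_le_norm hL
  have hlo := hF.isLittleO.def (half_pos hc)
  rw [Metric.eventually_nhds_iff] at hlo
  obtain ⟨ε, hε, hlo⟩ := hlo
  refine ⟨ε, hε, fun r hr hFc => ?_⟩
  have hcoe := continuous_circle_coe
  have hmem : ∀ v : Circle, z₀ + r * v ∈ sphere z₀ r := fun v => by
    simp [Circle.norm_coe, abs_of_pos hr.1]
  have := deg_eq_of_homotopy (S := Icc (0 : ℝ) 1)
    (H := fun t v => dir ((1 - t) * L (r * v) + t * F (z₀ + r * v))) isPreconnected_Icc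
    (by
      refine continuousOn_dir_comp ?_ ?_
      · refine ContinuousOn.add (Continuous.continuousOn (by fun_prop)) ?_
        refine ContinuousOn.mul (Continuous.continuousOn (by fun_prop)) ?_
        exact hFc.comp (Continuous.continuousOn (by fun_prop)) (fun x _ => hmem x.2)
      · rintro ⟨t, v⟩ ⟨ht, -⟩ hz
        have hn : ‖(r * v : ℂ)‖ = r := by simp [Circle.norm_coe, abs_of_pos hr.1]
        have h1 := hlo (y := z₀ + r * v) (by
          rw [dist_eq_norm, add_sub_cancel_left, hn]; exact hr.2)
        rw [h0, sub_zero, add_sub_cancel_left, hn] at h1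
        have h2 := hcL (r * v)
        rw [hn] at h2
        have h3 : L (r * v) = -(t * (F (z₀ + r * v) - L (r * v))) := by linear_combination hz
        have h4 := congrArg norm h3
        rw [norm_neg, norm_mul, Complex.norm_real, Real.norm_of_nonneg ht.1] at h4
        have h5 : t * ‖F (z₀ + r * v) - L (r * v)‖ ≤ 1 * (c / 2 * r) :=
          mul_le_mul ht.2 h1 (norm_nonneg _) zero_le_one
        nlinarith [hr.1])
    (y := 1) (y' := 0) (by simp) (by simp)
  simp only [Complex.ofReal_one, sub_self, zero_mul, one_mul, zero_add, Complex.ofReal_zero,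
    sub_zero, add_zero] at this
  rw [this, ← deg_dir_linear L hL]
  congr 1
  funext v
  have : L (r * v) = r * L v := by
    have := L.map_smul r (v : ℂ)
    simpa using this
  rw [this, dir_ofReal_mul hr.1]
  intro h
  have := hinj (h.trans (map_zero L).symm)
  exact Circle.coe_ne_zero v this

/-- Radial extension of a function on the boundary of a solid torus. -/
theorem continuous_radial {k : Circle × Circle → ℝ} (hk : Continuous k) :
    Continuous fun x : Circle × ℂ => ‖x.2‖ * k (x.1, dir x.2) := by
  obtain ⟨M, hM⟩ := (isCompact_range hk).isBounded.exists_norm_le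
  rw [continuous_iff_continuousAt]
  rintro ⟨u, z⟩
  by_cases hz : z = 0
  · subst hz
    rw [ContinuousAt]
    simp only [norm_zero, zero_mul]
    refine squeeze_zero_norm (a := fun x : Circle × ℂ => ‖x.2‖ * M) (fun x => ?_) ?_
    · rw [norm_mul, norm_norm]
      exact mul_le_mul_of_nonneg_left (hM _ (mem_range_self _)) (norm_nonneg _)
    · have : Continuous fun x : Circle × ℂ => ‖x.2‖ * M := by fun_prop
      simpa using this.tendsto (u, 0)
  · have h1 : ContinuousAt dir z := continuousOn_dir.continuousAt (isOpen_ne.mem_nhds hz)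
    have h2 : ContinuousAt (fun x : Circle × ℂ => dir x.2) (u, z) :=
      ContinuousAt.comp (g := dir) (f := Prod.snd) (x := (u, z)) h1 continuousAt_snd
    exact continuousAt_snd.norm.mul
      (ContinuousAt.comp (f := fun x : Circle × ℂ => (x.1, dir x.2)) hk.continuousAt
        (continuousAt_fst.prodMk h2))

theorem deg_dir_sub_of_lt {a : ℂ} {R : ℝ} (ha : ‖a‖ < R) : deg (fun v => dir (R * v - a)) = 1 := by
  have hR : 0 < R := lt_of_le_of_lt (norm_nonneg _) ha
  have hcoe := continuous_circle_coe
  have := deg_eq_of_homotopy (S := Icc (0 : ℝ) 1)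
    (H := fun t v => dir (R * v - t * a)) isPreconnected_Icc
    (by
      refine continuousOn_dir_comp (Continuous.continuousOn (by fun_prop)) ?_
      rintro ⟨t, v⟩ ⟨ht, -⟩ h0
      have h2 := congrArg norm (sub_eq_zero.1 h0)
      simp [abs_of_nonneg ht.1, abs_of_pos hR, Circle.norm_coe] at h2
      nlinarith [ht.1, ht.2, norm_nonneg a])
    (y := 1) (y' := 0) (by simp) (by simp)
  simp only [Complex.ofReal_one, one_mul, Complex.ofReal_zero, zero_mul, sub_zero] at this
  rw [this, deg_dir_const_mul (by exact_mod_cast hR.ne')]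

theorem deg_dir_add_of_lt {a : ℂ} {r : ℝ} (hr : 0 ≤ r) (ha : r < ‖a‖) :
    deg (fun v => dir (a + r * v)) = 0 := by
  refine deg_eq_zero_of_disc (g := fun v => dir (a + r * v)) ?_
  refine continuousOn_dir_comp (Continuous.continuousOn (by fun_prop)) ?_
  intro v hv h0
  have h2 := congrArg norm (eq_neg_of_add_eq_zero_left h0)
  simp [abs_of_nonneg hr] at h2
  simp at hv
  nlinarith

theorem exists_ball_subset_sdiff {R : ℝ} (Z : Finset ℂ) {b : ℂ} (hb : ‖b‖ < R) :
    ∃ ε > 0, ∀ w, ‖w - b‖ < ε → ‖w‖ < R ∧ (w ≠ b → w ∉ Z) := by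
  classical
  have h : ball (0 : ℂ) R \ (Z.erase b : Set ℂ) ∈ nhds b :=
    (isOpen_ball.sdiff (Z.erase b).finite_toSet.isClosed).mem_nhds ⟨by simpa using hb, by simp⟩
  obtain ⟨ε, hε, hs⟩ := Metric.mem_nhds_iff.1 h
  refine ⟨ε, hε, fun w hw => ?_⟩
  have := hs (show w ∈ ball b ε by rwa [mem_ball, dist_eq_norm])
  refine ⟨by simpa using this.1, fun hwb hwZ => this.2 ?_⟩
  simp [hwb, hwZ]

/-- The degree on the boundary of a disc is the sum of the indices of the singularities. -/
theorem deg_eq_sum_index {R : ℝ} (hR : 0 < R) (ind : ℂ → ℤ) (Z : Finset ℂ) : ∀ φ : ℂ → Circle,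
    (∀ z ∈ Z, ‖z‖ < R) → ContinuousOn φ (closedBall 0 R \ Z) →
    (∀ z ∈ Z, ∃ ε > 0, ∀ r ∈ Ioo (0 : ℝ) ε, deg (fun v => φ (z + r * v)) = ind z) →
    deg (fun v => φ (R * v)) = ∑ z ∈ Z, ind z := by
  classical
  induction Z using Finset.induction_on with
  | empty =>
    intro φ _ hφ _
    rw [Finset.sum_empty]
    refine deg_eq_zero_of_disc (g := fun v => φ (R * v)) (hφ.comp (by fun_prop) ?_)
    intro v hv
    simp at hv
    simp [abs_of_pos hR]
    nlinarith
  | insert a Z haZ ih =>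
    intro φ hZR hφ hind
    have hcoe := continuous_circle_coe
    have haR : ‖a‖ < R := hZR a (Finset.mem_insert_self _ _)
    set d := ind a with hd
    obtain ⟨ε₁, hε₁, h₁⟩ := hind a (Finset.mem_insert_self _ _)
    obtain ⟨ε₂, hε₂, h₂⟩ := exists_ball_subset_sdiff (insert a Z) haR
    obtain ⟨ρ, hρ, hρ'⟩ := exists_between (lt_min hε₁ hε₂)
    have hρ₁ := hρ'.trans_le (min_le_left _ _)
    have hρ₂ := hρ'.trans_le (min_le_right _ _)
    have hρ0 : (ρ : ℂ) ≠ 0 := by exact_mod_cast hρ.ne'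
    -- divide by a standard singularity at `a`, and fill in the resulting function over a disc
    let φ₁ : ℂ → Circle := fun z => φ z * (dir (z - a) ^ d)⁻¹
    have hdir : ContinuousOn (fun z => dir (z - a) ^ d) {a}ᶜ :=
      (continuousOn_dir_comp (by fun_prop) fun z hz => sub_ne_zero.2 hz).zpow d
    have hφ₁ : ContinuousOn φ₁ (closedBall 0 R \ (insert a Z : Finset ℂ)) :=
      hφ.mul (hdir.mono fun z hz h => hz.2 (by rw [mem_singleton_iff.1 h]; simp)).inv
    have hcirc : ∀ v : Circle, a + ρ * v ∈ closedBall 0 R \ ((insert a Z : Finset ℂ) : Set ℂ) := by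
      intro v
      have h3 := h₂ (a + ρ * v) (by simp [abs_of_pos hρ, Circle.norm_coe, hρ₂])
      exact ⟨by simpa using h3.1.le, h3.2 (by simp [hρ0])⟩
    have hg : Continuous fun v : Circle => φ₁ (a + ρ * v) :=
      hφ₁.comp_continuous (by fun_prop) hcirc
    have hg0 : deg (fun v => φ₁ (a + ρ * v)) = 0 := by
      have e : (fun v : Circle => φ₁ (a + ρ * v)) =
          fun v : Circle => φ (a + ρ * v) * (v ^ d)⁻¹ := by
        funext v
        simp only [φ₁, add_sub_cancel_left]
        rw [dir_ofReal_mul hρ (Circle.coe_ne_zero v), dir_coe]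
      have c1 : Continuous fun v : Circle => φ (a + ρ * v) :=
        hφ.comp_continuous (by fun_prop) hcirc
      have c2 : Continuous fun v : Circle => v ^ d := continuous_id.zpow d
      rw [e, deg_mul_inv c1 c2, h₁ ρ ⟨hρ, hρ₁⟩, deg_zpow continuous_id', deg_id]
      ring
    obtain ⟨k, hk, hke⟩ := exists_eq_zpow_mul_exp hg
    simp only [hg0, zpow_zero, one_mul] at hke
    let G : ℂ → Circle := fun z =>
      Circle.exp (‖(z - a) / ρ‖ * k (dir ((z - a) / ρ)))
    have hG : Continuous G := by
      have hk' : Continuous fun x : Circle × Circle => k x.2 := hk.comp continuous_snd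
      exact Circle.exp.continuous.comp ((continuous_radial hk').comp
        (f := fun z => ((1 : Circle), (z - a) / ρ)) (by fun_prop))
    let φ₂ : ℂ → Circle := fun z => if ‖z - a‖ ≤ ρ then G z else φ₁ z
    have hset : {z | ‖z - a‖ ≤ ρ} = closedBall a ρ := by
      ext z; simp [dist_eq_norm]
    have hset' : {z | ¬ ‖z - a‖ ≤ ρ} = (closedBall a ρ)ᶜ := by
      ext z; simp [dist_eq_norm]
    have hφ₂ : ContinuousOn φ₂ (closedBall 0 R \ Z) := by
      refine ContinuousOn.if ?_ hG.continuousOn ?_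
      · rintro z ⟨-, hz⟩
        rw [hset] at hz
        have hz' : ‖z - a‖ = ρ := by
          have := frontier_closedBall_subset_sphere hz
          simpa [dist_eq_norm] using this
        have hn : ‖(z - a) / ρ‖ = 1 := by
          rw [norm_div, hz', Complex.norm_real, Real.norm_of_nonneg hρ.le, div_self hρ.ne']
        have hne : (z - a) / ρ ≠ 0 := norm_pos_iff.1 (by rw [hn]; exact one_pos)
        have hv : (dir ((z - a) / ρ) : ℂ) = (z - a) / ρ := by
          rw [coe_dir hne, hn]; simp
        simp only [G, hn, one_mul]
        rw [← hke, hv, mul_div_cancel₀ _ hρ0, add_sub_cancel]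
      · refine hφ₁.mono ?_
        rintro z ⟨hz, hz'⟩
        refine ⟨hz.1, ?_⟩
        rw [hset', closure_compl] at hz'
        have hza : z ≠ a := fun h => hz' (by
          rw [h]
          exact ball_subset_interior_closedBall (mem_ball_self hρ))
        simpa [hza] using hz.2
    have hout : ∀ z, ρ < ‖z - a‖ → φ₂ z = φ₁ z := fun z hz => if_neg (not_le.2 hz)
    have hind₂ : ∀ b ∈ Z, ∃ ε > 0, ∀ r ∈ Ioo (0 : ℝ) ε, deg (fun v => φ₂ (b + r * v)) = ind b := by
      intro b hb
      have hba : b ≠ a := fun h => haZ (h ▸ hb)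
      have hρb : ρ < ‖b - a‖ := by
        by_contra hle
        exact (h₂ b (lt_of_le_of_lt (not_lt.1 hle) hρ₂)).2 hba (Finset.mem_insert_of_mem hb)
      obtain ⟨ε₃, hε₃, h₃⟩ := hind b (Finset.mem_insert_of_mem hb)
      obtain ⟨ε₄, hε₄, h₄⟩ := exists_ball_subset_sdiff (insert a Z)
        (hZR b (Finset.mem_insert_of_mem hb))
      refine ⟨min (min ε₃ ε₄) (‖b - a‖ - ρ), lt_min (lt_min hε₃ hε₄) (sub_pos.2 hρb),
        fun r hr => ?_⟩
      have hr3 : r < ε₃ := hr.2.trans_le ((min_le_left _ _).trans (min_le_left _ _))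
      have hr4 : r < ε₄ := hr.2.trans_le ((min_le_left _ _).trans (min_le_right _ _))
      have hr5 : r < ‖b - a‖ - ρ := hr.2.trans_le (min_le_right _ _)
      have hr0 : (r : ℂ) ≠ 0 := by exact_mod_cast hr.1.ne'
      have hn : ∀ v : Circle, ‖(r * v : ℂ)‖ = r := fun v => by
        simp [abs_of_pos hr.1, Circle.norm_coe]
      have hfar : ∀ v : Circle, ρ < ‖b + r * v - a‖ := fun v => by
        have := norm_sub_le_norm_add (b - a) (r * v)
        rw [hn, show b - a + r * v = b + r * v - a by ring] at this
        linarith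
      have c1 : Continuous fun v : Circle => φ (b + r * v) :=
        hφ.comp_continuous (by fun_prop) fun v => by
          have h5 := h₄ (b + r * v) (by rw [add_sub_cancel_left, hn]; exact hr4)
          exact ⟨by simpa using h5.1.le, h5.2 (by simp [hr0])⟩
      have hbr : r < ‖b - a‖ := by linarith
      have c2 : Continuous fun v : Circle => dir (b - a + r * v) := by
        refine continuous_dir (by fun_prop) fun v h0 => ?_
        have := hfar v
        rw [show b + r * v - a = b - a + r * v by ring, h0, norm_zero] at this
        linarith
      have c3 : Continuous fun v : Circle => dir (b - a + r * v) ^ d := c2.zpow d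
      have e : (fun v : Circle => φ₂ (b + r * v)) =
          fun v : Circle => φ (b + r * v) * (dir (b - a + r * v) ^ d)⁻¹ := by
        funext v
        rw [hout _ (hfar v)]
        simp only [φ₁]
        rw [show b + r * v - a = b - a + r * v by ring]
      rw [e, deg_mul_inv c1 c3, h₃ r ⟨hr.1, hr3⟩, deg_zpow c2, deg_dir_add_of_lt hr.1.le hbr]
      ring
    have hfin := ih φ₂ (fun z hz => hZR z (Finset.mem_insert_of_mem hz)) hφ₂ hind₂
    have hnR : ∀ v : Circle, ‖(R * v : ℂ)‖ = R := fun v => by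
      simp [abs_of_pos hR, Circle.norm_coe]
    have hfar : ∀ v : Circle, ρ < ‖(R * v : ℂ) - a‖ := fun v => by
      by_contra hle
      have := (h₂ _ (lt_of_le_of_lt (not_lt.1 hle) hρ₂)).1
      rw [hnR] at this
      exact lt_irrefl _ this
    have c1 : Continuous fun v : Circle => φ (R * v) :=
      hφ.comp_continuous (by fun_prop) fun v => by
        refine ⟨by simp [abs_of_pos hR, Circle.norm_coe], fun h => ?_⟩
        have := hZR _ h
        rw [hnR] at this
        exact lt_irrefl _ this
    have c2 : Continuous fun v : Circle => dir (R * v - a) :=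
      continuous_dir (by fun_prop) fun v h0 => by
        have := hfar v
        rw [h0, norm_zero] at this
        linarith
    have c3 : Continuous fun v : Circle => dir (R * v - a) ^ d := c2.zpow d
    have e : (fun v : Circle => φ₂ (R * v)) =
        fun v : Circle => φ (R * v) * (dir (R * v - a) ^ d)⁻¹ := by
      funext v
      rw [hout _ (hfar v)]
    rw [e, deg_mul_inv c1 c3, deg_zpow c2, deg_dir_sub_of_lt haR] at hfin
    rw [Finset.sum_insert haZ, ← hfin]
    ring

/-! ### Winding numbers and linking with meridian discs -/

namespace TubedKnot

variable (K : TubedKnot)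

theorem continuous_lift : Continuous K.lift := K.contDiff_lift.continuous

theorem differentiable_lift : Differentiable ℝ K.lift := K.contDiff_lift.differentiable (by simp)

theorem eq_of_lift_eq {y z : ℝ × ℂ} (h : K.lift y = K.lift z) (hd : |y.1 - z.1| < 2 * Real.pi) :
    y = z := by
  have h' := K.inj h
  simp only [Prod.mk.injEq] at h'
  obtain ⟨m, hm⟩ := Circle.exp_eq_exp.1 h'.1
  have hm0 : m = 0 := by
    rw [hm, add_sub_cancel_left, abs_mul, abs_of_pos Real.two_pi_pos] at hd
    have : |(m : ℝ)| < 1 := by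
      by_contra hc
      nlinarith [Real.two_pi_pos, not_lt.1 hc]
    exact Int.abs_lt_one_iff.1 (by exact_mod_cast this)
  refine Prod.ext ?_ h'.2
  simpa [hm0] using hm

/-- A continuous map into the coordinates of a tube which is differentiable in the sphere is
differentiable. -/
theorem differentiableAt_of_lift {E : Type*} [NormedAddCommGroup E] [NormedSpace ℝ E]
    {y : E → ℝ × ℂ} {x₀ : E} (hy : ContinuousAt y x₀)
    (h : DifferentiableAt ℝ (fun x => K.lift (y x)) x₀) : DifferentiableAt ℝ y x₀ := by
  obtain ⟨Θ, h0, hd, hΘ⟩ := K.exists_local_coords (y x₀)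
  have hl : ContinuousAt (fun x => K.lift (y x)) x₀ := h.continuousAt
  have hc : ContinuousAt (fun x => Θ (K.lift (y x))) x₀ :=
    ContinuousAt.comp (g := Θ) hd.continuousAt hl
  have hD : DifferentiableAt ℝ (fun x => Θ (K.lift (y x))) x₀ :=
    DifferentiableAt.comp x₀ (g := Θ) hd h
  refine hD.congr_of_eventuallyEq ?_
  have hsub : ContinuousAt (fun x => |(y x).1 - (Θ (K.lift (y x))).1|) x₀ :=
    (hy.fst.sub hc.fst).abs
  have hlt : ∀ᶠ x in nhds x₀, |(y x).1 - (Θ (K.lift (y x))).1| < 2 * Real.pi := by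
    refine hsub.eventually (gt_mem_nhds ?_)
    simp only [h0]
    simpa using Real.pi_pos
  filter_upwards [hlt, hl.eventually hΘ] with x hx hx'
  exact K.eq_of_lift_eq (hx' (K.lift_mem _)).symm hx

/-- The value of a map on the complement of a knot on a loop in the tube. -/
theorem deg_comp_toFun {φ : E4 → Circle} (hφ : ContinuousOn φ K.complement) {U : Circle → Circle}
    (hU : Continuous U) {V : Circle → ℂ} (hV : Continuous V) (hV0 : ∀ v, V v ≠ 0) :
    deg (fun v => φ (K.toFun (U v, V v))) = deg (fun u => φ (K.longitude u)) * deg U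
      + deg (fun v => φ (K.meridian v)) * deg (fun v => dir (V v)) := by
  have hcoe := continuous_circle_coe
  have hd : Continuous fun v => dir (V v) := continuous_dir hV hV0
  have hT : Continuous fun x : Circle × Circle => φ (K.toFun (x.1, x.2)) :=
    hφ.comp_continuous (K.continuous_toFun.comp
      (continuous_fst.prodMk (hcoe.comp continuous_snd)))
      fun x => K.toFun_mem_complement.2 (Circle.coe_ne_zero _)
  have h1 := deg_torus_comp hT hU hd
  simp only [Circle.coe_one] at h1
  rw [show deg (fun u => φ (K.longitude u)) = deg (fun u => φ (K.toFun (u, 1))) from rfl,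
    show deg (fun u => φ (K.meridian u)) = deg (fun u : Circle => φ (K.toFun (1, u))) from rfl, ← h1]
  have hs : ∀ t ∈ Icc (0 : ℝ) 1, ∀ v, 0 < (1 - t) + t / ‖V v‖ := fun t ht v => by
    have := norm_pos_iff.2 (hV0 v)
    rcases ht.1.eq_or_lt with h | h
    · simp [← h]
    · have := ht.2
      have : 0 < t / ‖V v‖ := by positivity
      linarith
  have := deg_eq_of_homotopy (S := Icc (0 : ℝ) 1)
    (H := fun t v => φ (K.toFun (U v, (((1 - t) + t / ‖V v‖ : ℝ) : ℂ) * V v))) isPreconnected_Icc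
    (by
      refine hφ.comp (K.continuous_toFun.comp_continuousOn ?_) ?_
      · refine ContinuousOn.prodMk (Continuous.continuousOn (by fun_prop)) ?_
        refine ContinuousOn.mul ?_ (Continuous.continuousOn (by fun_prop))
        refine Complex.continuous_ofReal.comp_continuousOn (Continuous.continuousOn ?_)
        have : Continuous fun x : ℝ × Circle => x.1 / ‖V x.2‖ :=
          continuous_fst.div (by fun_prop) fun x => norm_ne_zero_iff.2 (hV0 x.2)
        fun_prop
      · rintro ⟨t, v⟩ ⟨ht, -⟩
        refine K.toFun_mem_complement.2 (mul_ne_zero ?_ (hV0 v))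
        exact_mod_cast (hs t ht v).ne')
    (y := 0) (y' := 1) (by simp) (by simp)
  simp only [sub_zero, zero_div, add_zero, Complex.ofReal_one, one_mul, sub_self, zero_add] at this
  rw [this]
  congr 1
  funext v
  rw [coe_dir (hV0 v)]
  congr 3
  rw [Complex.ofReal_div, Complex.ofReal_one]
  ring

end TubedKnot

theorem finite_of_isolated {S : Set ℝ} (hS : IsCompact S)
    (h : ∀ t ∈ S, ∀ᶠ s in nhds t, s ∈ S → s = t) : S.Finite := by
  refine hS.finite ?_
  rw [isDiscrete_iff_forall_mem_exists_isOpen]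
  intro t ht
  obtain ⟨V, hV, hVo, htV⟩ := _root_.eventually_nhds_iff.1 (h t ht)
  exact ⟨V, hVo, by ext s; exact ⟨fun hs => hV s hs.1 hs.2, fun hs => by
    rw [mem_singleton_iff.1 hs]; exact ⟨htV, ht⟩⟩⟩

/-- A regular value of a smooth map of the circle, by Sard's theorem in dimension one. -/
theorem exists_regular_value {a : ℝ → ℝ} (ha : Differentiable ℝ a) :
    ∃ s : ℝ, ∀ t, Circle.exp (a t) = Circle.exp s → deriv a t ≠ 0 := by
  have h0 : MeasureTheory.volume (a '' {t | deriv a t = 0}) = 0 := by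
    refine MeasureTheory.addHaar_image_eq_zero_of_det_fderivWithin_eq_zero MeasureTheory.volume
      (f' := fun t => fderiv ℝ a t) (fun t _ => (ha t).hasFDerivAt.hasFDerivWithinAt) ?_
    intro t ht
    have : fderiv ℝ a t = 0 := by
      ext; simpa using ht
    rw [this]
    simp [ContinuousLinearMap.det]
  have h1 : MeasureTheory.volume (⋃ m : ℤ, (fun x => -(m * (2 * Real.pi)) + x) ''
      (a '' {t | deriv a t = 0})) = 0 := by
    rw [MeasureTheory.measure_iUnion_null_iff]
    intro m
    rw [image_add_left, MeasureTheory.measure_preimage_add]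
    exact h0
  obtain ⟨s, hs⟩ : ∃ s, s ∉ ⋃ m : ℤ, (fun x => -(m * (2 * Real.pi)) + x) ''
      (a '' {t | deriv a t = 0}) := by
    by_contra hc
    push Not at hc
    rw [eq_univ_of_forall hc] at h1
    simp at h1
  refine ⟨s, fun t ht hd => hs ?_⟩
  obtain ⟨m, hm⟩ := Circle.exp_eq_exp.1 ht
  exact mem_iUnion.2 ⟨m, a t, ⟨t, hd, rfl⟩, by simp only [hm]; ring⟩

/-- The degree on the boundary of a disc is the sum of the indices of the singularities, indexed
by any finite set. -/
theorem deg_eq_sum_index_of_injOn {ι : Type*} [Nonempty ι] {R : ℝ} (hR : 0 < R) (ind : ι → ℤ)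
    (T : Finset ι) {c : ι → ℂ} (hc : InjOn c T) {φ : ℂ → Circle} (hT : ∀ t ∈ T, ‖c t‖ < R)
    (hφ : ContinuousOn φ (closedBall 0 R \ c '' T))
    (hind : ∀ t ∈ T, ∃ ε > 0, ∀ r ∈ Ioo (0 : ℝ) ε, deg (fun v => φ (c t + r * v)) = ind t) :
    deg (fun v => φ (R * v)) = ∑ t ∈ T, ind t := by
  classical
  have hinv : ∀ t ∈ T, Function.invFunOn c T (c t) = t := fun t ht => hc.leftInvOn_invFunOn ht
  rw [deg_eq_sum_index hR (fun z => ind (Function.invFunOn c T z)) (T.image c) φ,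
    Finset.sum_image hc, Finset.sum_congr rfl fun t ht => by rw [hinv t ht]]
  · simpa using hT
  · simpa using hφ
  · intro z hz
    obtain ⟨t, ht, rfl⟩ := Finset.mem_image.1 hz
    simpa only [hinv t ht] using hind t ht

/-- The radial extension of a differentiable map of the circle, in polar coordinates. -/
theorem hasFDerivAt_polar {α : Circle → Circle} {a : ℝ → ℝ}
    (ha : ∀ t, α (Circle.exp t) = Circle.exp (a t)) {t : ℝ} (hd : DifferentiableAt ℝ a t) :
    ∃ L : ℂ →L[ℝ] ℂ, HasFDerivAt (fun z : ℂ => (‖z‖ * α (dir z) : ℂ)) L (Circle.exp t : ℂ) ∧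
      detC L = deriv a t := by
  set z₀ := (Circle.exp t : ℂ) with hz₀
  have hz0 : z₀ ≠ 0 := Circle.coe_ne_zero _
  -- near `z₀` the map is `exp (ℓ + i a (t + θ))` with `ℓ + i θ = log (z / z₀)`
  let l : ℂ → ℂ := fun z => Complex.log (z / z₀)
  have hl0 : l z₀ = 0 := by simp [l]
  have hl : HasFDerivAt l ((ContinuousLinearMap.toSpanSingleton ℂ (z₀⁻¹)).restrictScalars ℝ) z₀ := by
    have h1 : HasDerivAt l z₀⁻¹ z₀ := by
      have h2 : HasDerivAt (fun z : ℂ => z / z₀) (1 / z₀) z₀ := (hasDerivAt_id z₀).div_const z₀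
      have h3 := h2.clog (by simp [hz0])
      simpa [hz0] using h3
    exact h1.hasFDerivAt.restrictScalars ℝ
  have hre : HasFDerivAt (fun z => (l z).re) (Complex.reCLM.comp
      ((ContinuousLinearMap.toSpanSingleton ℂ (z₀⁻¹)).restrictScalars ℝ)) z₀ :=
    Complex.reCLM.hasFDerivAt.comp z₀ hl
  have him : HasFDerivAt (fun z => (l z).im) (Complex.imCLM.comp
      ((ContinuousLinearMap.toSpanSingleton ℂ (z₀⁻¹)).restrictScalars ℝ)) z₀ :=
    Complex.imCLM.hasFDerivAt.comp z₀ hl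
  have hat : HasFDerivAt (fun z => a (t + (l z).im)) (deriv a t • (Complex.imCLM.comp
      ((ContinuousLinearMap.toSpanSingleton ℂ (z₀⁻¹)).restrictScalars ℝ))) z₀ := by
    have h1 : HasDerivAt a (deriv a t) (t + (l z₀).im) := by
      rw [hl0]; simpa using hd.hasDerivAt
    exact h1.comp_hasFDerivAt z₀ (him.const_add t)
  have hsum := (Complex.equivRealProdCLM.symm.toContinuousLinearMap.hasFDerivAt.comp z₀
    (hre.prodMk hat)).cexp
  refine ⟨_, hsum.congr_of_eventuallyEq ?_, ?_⟩
  · filter_upwards [isOpen_ne.mem_nhds hz0] with z hz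
    have hlz : Complex.exp (l z) = z / z₀ := Complex.exp_log (div_ne_zero hz hz0)
    have hre' : Real.exp (l z).re = ‖z‖ := by
      rw [← Complex.norm_exp, hlz, norm_div, hz₀, Circle.norm_coe, div_one]
    have hdir : dir z = Circle.exp (t + (l z).im) := by
      apply Circle.ext
      rw [coe_dir hz, ← hre', Circle.exp_add, Circle.coe_mul, Circle.coe_exp (l z).im, ← hz₀,
        div_eq_iff (by exact_mod_cast (Real.exp_pos _).ne'), Complex.ofReal_exp, mul_assoc,
        ← Complex.exp_add, add_comm _ ((l z).re : ℂ), Complex.re_add_im, hlz,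
        mul_div_cancel₀ _ hz0]
    rw [hdir, ha, ← hre', Complex.ofReal_exp, Circle.coe_exp, ← Complex.exp_add]
    simp [Complex.equivRealProdCLM_symm_apply]
  · set w := z₀⁻¹ with hw
    have hw1 : w.re * w.re + w.im * w.im = 1 := by
      rw [← Complex.normSq_apply, Complex.normSq_eq_norm_sq, hw, norm_inv, hz₀, Circle.norm_coe]
      simp
    set c := Complex.exp ((⇑Complex.equivRealProdCLM.symm.toContinuousLinearMap ∘
      fun z => ((l z).re, a (t + (l z).im))) z₀) with hc
    have hc1 : c.re * c.re + c.im * c.im = 1 := by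
      rw [← Complex.normSq_apply, Complex.normSq_eq_norm_sq, hc, Complex.norm_exp]
      simp [hl0, Complex.equivRealProdCLM_symm_apply]
    simp [detC, Complex.equivRealProdCLM_symm_apply]
    linear_combination (deriv a t) * (w.re * w.re + w.im * w.im) * hc1 + deriv a t * hw1

/-- The degree of a differentiable map of the circle is the number of preimages of a regular
value, counted with signs. -/
theorem deg_eq_sum_sign {α : Circle → Circle} (hα : Continuous α) {a : ℝ → ℝ}
    (ha : ∀ t, α (Circle.exp t) = Circle.exp (a t)) (hd : Differentiable ℝ a) {u₀ : Circle}
    (T : Finset ℝ) (hT : InjOn Circle.exp T) (hTu : ∀ t ∈ T, α (Circle.exp t) = u₀)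
    (hTall : ∀ u, α u = u₀ → ∃ t ∈ T, Circle.exp t = u) (hreg : ∀ t ∈ T, deriv a t ≠ 0) :
    deg α = ∑ t ∈ T, (SignType.sign (deriv a t) : ℤ) := by
  have hcoe := continuous_circle_coe
  have hG : Continuous fun z : ℂ => (‖z‖ * α (dir z) : ℂ) := by
    rw [continuous_iff_continuousAt]
    intro z
    by_cases hz : z = 0
    · subst hz
      rw [ContinuousAt]
      simp only [norm_zero, Complex.ofReal_zero, zero_mul]
      refine squeeze_zero_norm (a := fun z : ℂ => ‖z‖) (fun z => ?_) ?_
      · simp [Circle.norm_coe]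
      · simpa using (continuous_norm (E := ℂ)).tendsto 0
    · have h1 : ContinuousAt dir z := continuousOn_dir.continuousAt (isOpen_ne.mem_nhds hz)
      have h2 : ContinuousAt (fun z => (α (dir z) : ℂ)) z :=
        (hcoe.comp hα).continuousAt.comp h1
      exact (Complex.continuous_ofReal.comp continuous_norm).continuousAt.mul h2
  let F : ℂ → ℂ := fun z => ‖z‖ * α (dir z) - u₀
  have hF : Continuous F := hG.sub continuous_const
  have hF0 : ∀ z, F z = 0 → ∃ t ∈ T, (Circle.exp t : ℂ) = z := by
    intro z hz
    have h1 : (‖z‖ * α (dir z) : ℂ) = u₀ := sub_eq_zero.1 hz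
    have h2 : ‖z‖ = 1 := by simpa [Circle.norm_coe] using congrArg norm h1
    have hz0 : z ≠ 0 := norm_pos_iff.1 (by rw [h2]; exact one_pos)
    rw [h2, Complex.ofReal_one, one_mul] at h1
    obtain ⟨t, ht, hte⟩ := hTall (dir z) (Circle.ext h1)
    refine ⟨t, ht, ?_⟩
    rw [hte, coe_dir hz0, h2]
    simp
  have key := deg_eq_sum_index_of_injOn (R := 2) two_pos
    (fun t => (SignType.sign (deriv a t) : ℤ)) T (c := fun t => (Circle.exp t : ℂ))
    (fun s hs t ht h => hT hs ht (Circle.ext h)) (φ := fun z => dir (F z))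
    (fun t _ => by rw [Circle.norm_coe]; norm_num)
    (continuousOn_dir_comp hF.continuousOn fun z hz h0 => hz.2 (by
      obtain ⟨t, ht, h⟩ := hF0 z h0
      exact ⟨t, ht, h⟩))
    (fun t ht => by
      obtain ⟨L, hL, hdet⟩ := hasFDerivAt_polar ha (hd t)
      obtain ⟨ε, hε, h⟩ := deg_dir_small_circle (F := F) (hL.sub_const (u₀ : ℂ))
        (by simp only [F, Circle.norm_coe, dir_coe, hTu t ht]; simp) (by rw [hdet]; exact hreg t ht)
      refine ⟨ε, hε, fun r hr => ?_⟩
      rw [h r hr hF.continuousOn, hdet])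
  rw [← key]
  have := deg_eq_of_homotopy (S := Icc (0 : ℝ) 1)
    (H := fun t v => dir (2 * α v - t * u₀)) isPreconnected_Icc
    (by
      refine continuousOn_dir_comp (Continuous.continuousOn (by fun_prop)) ?_
      rintro ⟨t, v⟩ ⟨ht, -⟩ h0
      have h2 := congrArg norm (sub_eq_zero.1 h0)
      simp [abs_of_nonneg ht.1, Circle.norm_coe] at h2
      linarith [ht.2])
    (y := 1) (y' := 0) (by simp) (by simp)
  simp only [Complex.ofReal_one, one_mul, Complex.ofReal_zero, zero_mul, sub_zero] at this
  have h2 : ∀ v : Circle, dir (2 * v) = v := fun v => by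
    rw [show (2 : ℂ) = ((2 : ℝ) : ℂ) by simp, dir_ofReal_mul two_pos (Circle.coe_ne_zero _), dir_coe]
  simp only [h2] at this
  rw [← this]
  congr 1
  funext v
  have h3 : dir ((2 : ℝ) * (v : ℂ)) = v := by rw [Complex.ofReal_ofNat, h2]
  simp only [F, h3]
  simp [Circle.norm_coe]

namespace TubedKnot

variable (K : TubedKnot)

/-- At a transverse intersection of the knot `K` with the meridian disc `s = s₀` of another tube,
a map which is dual to `K` has index `± 1` on the disc, the sign being that of the crossing. -/
theorem deg_small_circle_of_crossing {K K₀ : TubedKnot} {φ : E4 → Circle}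
    (hφ : ContinuousOn φ K.complement) (h1 : deg (fun v => φ (K.meridian v)) = 1) {s₀ t₀ : ℝ} {z₀ : ℂ}
    {y : ℝ → ℝ × ℂ} (hy : ∀ t, K₀.lift (y t) = K.lift (t, 0)) (hy0 : y t₀ = (s₀, z₀))
    (hyd : DifferentiableAt ℝ y t₀) (hreg : (deriv y t₀).1 ≠ 0)
    (hiso : ∀ᶠ z in nhds z₀, z ≠ z₀ → K₀.lift (s₀, z) ∈ K.complement) :
    ∃ ε > 0, ∀ r ∈ Ioo (0 : ℝ) ε, deg (fun v => φ (K₀.lift (s₀, z₀ + r * v))) =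
      (SignType.sign (deriv y t₀).1 : ℤ) := by
  have hcoe := continuous_circle_coe
  let g : ℂ → E4 := fun z => K₀.lift (s₀, z)
  have hg : Continuous g := K₀.continuous_lift.comp (by fun_prop)
  have hg0 : g z₀ = K.lift (t₀, 0) := by rw [← hy, hy0]
  obtain ⟨Θ, hΘ0, hΘd, hΘ⟩ := K.exists_local_coords (t₀, 0)
  rw [← hg0] at hΘ0 hΘd hΘ
  -- the coordinates of the meridian disc with respect to `K`
  let Y : ℂ → ℝ × ℂ := fun z => Θ (g z)
  have hY : ∀ᶠ z in nhds z₀, K.lift (Y z) = g z :=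
    (hg.continuousAt.eventually hΘ).mono fun z hz => hz (K₀.lift_mem _)
  have hi : HasFDerivAt (fun z : ℂ => (s₀, z)) (ContinuousLinearMap.inr ℝ ℝ ℂ) z₀ :=
    (hasFDerivAt_const s₀ z₀).prodMk (hasFDerivAt_id z₀)
  have hgd : HasFDerivAt g ((fderiv ℝ K₀.lift (s₀, z₀)).comp (ContinuousLinearMap.inr ℝ ℝ ℂ)) z₀ :=
    (K₀.differentiable_lift (s₀, z₀)).hasFDerivAt.comp z₀ hi
  have hYd : HasFDerivAt Y (fderiv ℝ Y z₀) z₀ :=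
    (DifferentiableAt.comp z₀ (g := Θ) (f := g) hΘd hgd.differentiableAt).hasFDerivAt
  have hY0 : Y z₀ = (t₀, 0) := hΘ0
  have hchain : (fderiv ℝ K.lift (t₀, 0)).comp (fderiv ℝ Y z₀) =
      (fderiv ℝ K₀.lift (s₀, z₀)).comp (ContinuousLinearMap.inr ℝ ℝ ℂ) := by
    have h2 : HasFDerivAt K.lift (fderiv ℝ K.lift (t₀, 0)) (Y z₀) := by
      rw [hY0]; exact (K.differentiable_lift _).hasFDerivAt
    have h3 := h2.comp z₀ hYd
    refine h3.unique (hgd.congr_of_eventuallyEq ?_)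
    filter_upwards [hY] with z hz
    exact hz
  have hchain' : fderiv ℝ K₀.lift (s₀, z₀) (deriv y t₀) = fderiv ℝ K.lift (t₀, 0) (1, 0) := by
    have h2 : HasFDerivAt K₀.lift (fderiv ℝ K₀.lift (s₀, z₀)) (y t₀) := by
      rw [hy0]; exact (K₀.differentiable_lift _).hasFDerivAt
    have h3 := h2.comp_hasDerivAt t₀ hyd.hasDerivAt
    have h4 : HasDerivAt (fun t : ℝ => ((t, 0) : ℝ × ℂ)) (1, 0) t₀ :=
      (hasDerivAt_id t₀).prodMk (hasDerivAt_const t₀ 0)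
    have h5 : HasDerivAt (fun t => K.lift (t, 0)) (fderiv ℝ K.lift (t₀, 0) (1, 0)) t₀ :=
      HasFDerivAt.comp_hasDerivAt (l := K.lift) t₀ (K.differentiable_lift (t₀, 0)).hasFDerivAt h4
    refine h3.unique ?_
    rwa [show K₀.lift ∘ y = fun t => K.lift (t, 0) from funext hy]
  -- both bases of the tangent space are positive, so the signs agree
  set L : ℂ →L[ℝ] ℂ := (ContinuousLinearMap.snd ℝ ℝ ℂ).comp (fderiv ℝ Y z₀) with hL
  have hdet : (deriv y t₀).1 * det4 (g z₀) (fderiv ℝ K₀.lift (s₀, z₀) (1, 0))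
      (fderiv ℝ K₀.lift (s₀, z₀) (0, 1)) (fderiv ℝ K₀.lift (s₀, z₀) (0, Complex.I)) =
      detC L * det4 (g z₀) (fderiv ℝ K.lift (t₀, 0) (1, 0))
      (fderiv ℝ K.lift (t₀, 0) (0, 1)) (fderiv ℝ K.lift (t₀, 0) (0, Complex.I)) := by
    set T := fderiv ℝ K.lift (t₀, 0) (1, 0)
    set X := fderiv ℝ K.lift (t₀, 0) (0, 1)
    set Z := fderiv ℝ K.lift (t₀, 0) (0, Complex.I)
    set T₀ := fderiv ℝ K₀.lift (s₀, z₀) (1, 0)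
    set X₀ := fderiv ℝ K₀.lift (s₀, z₀) (0, 1)
    set Z₀ := fderiv ℝ K₀.lift (s₀, z₀) (0, Complex.I)
    have e1 : T = (deriv y t₀).1 • T₀ + (deriv y t₀).2.re • X₀ + (deriv y t₀).2.im • Z₀ := by
      rw [← hchain', ← K₀.fderiv_lift_apply]
    have e2 : ∀ v : ℂ, fderiv ℝ K₀.lift (s₀, z₀) (0, v) =
        (fderiv ℝ Y z₀ v).1 • T + (L v).re • X + (L v).im • Z := fun v => by
      rw [← K.fderiv_lift_apply]
      exact (DFunLike.congr_fun hchain v).symm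
    have d1 := det4_comb (g z₀) T₀ X₀ Z₀ ![(deriv y t₀).1, (deriv y t₀).2.re, (deriv y t₀).2.im]
      ![0, 1, 0] ![0, 0, 1]
    have d2 := det4_comb (g z₀) T X Z ![1, 0, 0] ![(fderiv ℝ Y z₀ 1).1, (L 1).re, (L 1).im]
      ![(fderiv ℝ Y z₀ Complex.I).1, (L Complex.I).re, (L Complex.I).im]
    simp only [Matrix.cons_val_zero, Matrix.cons_val_one, Matrix.cons_val, ← e1, ← e2, one_smul,
      zero_smul, zero_add, add_zero] at d1 d2
    rw [detC]
    linear_combination d2 - d1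
  have hp₀ := K₀.lift_pos (s₀, z₀)
  have hp := K.lift_pos (t₀, 0)
  rw [← hg0] at hp
  change 0 < det4 (g z₀) _ _ _ at hp₀
  have hsign : SignType.sign (detC L) = SignType.sign (deriv y t₀).1 := by
    have := congrArg SignType.sign hdet
    rwa [sign_mul, sign_mul, sign_pos hp₀, sign_pos hp, mul_one, mul_one, eq_comm] at this
  have hL0 : detC L ≠ 0 := by
    rw [← sign_ne_zero, hsign, sign_ne_zero]
    exact hreg
  have hrange : ∀ᶠ z in nhds z₀, g z ∈ range K.toFun := hY.mono fun z hz => hz ▸ mem_range_self _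
  have hcY : ∀ᶠ z in nhds z₀, (K.coords (g z)).2 = (Y z).2 := by
    filter_upwards [hY] with z hz
    rw [← hz, lift, coords_toFun]
  have hV0 : (K.coords (g z₀)).2 = 0 := by
    rw [hg0, lift, coords_toFun]
  have hV : HasFDerivAt (fun z => (K.coords (g z)).2) L z₀ :=
    (hasFDerivAt_snd.comp z₀ hYd).congr_of_eventuallyEq hcY
  obtain ⟨ε₁, hε₁, h₁⟩ := deg_dir_small_circle hV hV0 hL0
  obtain ⟨ε₂, hε₂, h₂⟩ := Metric.eventually_nhds_iff.1 (hrange.and hiso)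
  have hcc : ContinuousOn (fun z => K.coords (g z)) (ball z₀ ε₂) :=
    K.continuousOn_coords.comp hg.continuousOn fun z hz => (h₂ hz).1
  refine ⟨min ε₁ ε₂, lt_min hε₁ hε₂, fun r hr => ?_⟩
  have hr1 := hr.2.trans_le (min_le_left _ _)
  have hr2 := hr.2.trans_le (min_le_right _ _)
  have hmem : ∀ v : ℂ, ‖v‖ ≤ 1 → z₀ + r * v ∈ ball z₀ ε₂ := fun v hv => by
    rw [mem_ball, dist_eq_norm, add_sub_cancel_left, norm_mul, Complex.norm_real,
      Real.norm_of_nonneg hr.1.le]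
    nlinarith [hr.1]
  have hmem' : ∀ v : Circle, z₀ + r * v ∈ ball z₀ ε₂ := fun v => hmem v (by rw [Circle.norm_coe])
  have hne : ∀ v : Circle, (K.coords (g (z₀ + r * v))).2 ≠ 0 := fun v => by
    have h3 := h₂ (hmem' v)
    rw [← K.toFun_mem_complement, K.toFun_coords h3.1]
    refine h3.2 ?_
    have : (r : ℂ) ≠ 0 := by exact_mod_cast hr.1.ne'
    simp [this]
  have hU : ContinuousOn (fun v : ℂ => (K.coords (g (z₀ + r * v))).1) (closedBall 0 1) :=
    (hcc.comp (f := fun v : ℂ => z₀ + r * v) (by fun_prop) fun v hv => hmem v (by simpa using hv)).fst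
  have hUc : Continuous fun v : Circle => (K.coords (g (z₀ + r * v))).1 :=
    (hcc.comp_continuous (f := fun v : Circle => z₀ + r * (v : ℂ)) (by fun_prop) hmem').fst
  have hVc : Continuous fun v : Circle => (K.coords (g (z₀ + r * v))).2 :=
    (hcc.comp_continuous (f := fun v : Circle => z₀ + r * (v : ℂ)) (by fun_prop) hmem').snd
  have key := K.deg_comp_toFun hφ hUc hVc hne
  rw [deg_eq_zero_of_disc (g := fun v : ℂ => (K.coords (g (z₀ + r * v))).1) hU,
    h₁ r ⟨hr.1, hr1⟩ (hcc.snd.mono (sphere_subset_ball hr2)), h1, hsign, mul_zero, zero_add,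
    one_mul] at key
  rw [← key]
  congr 1
  funext v
  rw [Prod.mk.eta, K.toFun_coords (h₂ (hmem' v)).1]

/-- If the knot `K` lies in the interior of a tube, then its winding number in the tube is the
linking number of `K` with the meridian of the tube. -/
theorem deg_meridian_eq_deg_core {K K₀ : TubedKnot} {φ : E4 → Circle}
    (hφ : ContinuousOn φ K.complement) (h1 : deg (fun v => φ (K.meridian v)) = 1)
    (hK : ∀ u, K.core u ∈ K₀.toFun '' (univ ×ˢ ball 0 1)) :
    deg (fun v => φ (K₀.meridian v)) = deg (fun u => (K₀.coords (K.core u)).1) := by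
  have hcoe := continuous_circle_coe
  have hcr : ∀ u, K.core u ∈ range K₀.toFun := fun u => image_subset_range _ _ (hK u)
  have hcore : Continuous K.core := K.continuous_toFun.comp (by fun_prop)
  have hcinj : Function.Injective K.core := fun u v h => (Prod.mk.inj (K.inj h)).1
  have hc : Continuous fun u => K₀.coords (K.core u) :=
    K₀.continuousOn_coords.comp_continuous hcore hcr
  have hball : ∀ u, ‖(K₀.coords (K.core u)).2‖ < 1 := fun u => by
    obtain ⟨c, hc, hcu⟩ := hK u
    rw [← hcu, coords_toFun]
    simpa using hc
  set α : Circle → Circle := fun u => (K₀.coords (K.core u)).1 with hα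
  have hαc : Continuous α := hc.fst
  obtain ⟨x₀, hx₀⟩ := Circle.exp_surjective (α (Circle.exp 0))
  obtain ⟨a, hac, ha', -⟩ := exists_continuous_circle_lift (hαc.comp Circle.exp.continuous) 0 x₀ hx₀
  have ha : ∀ t, α (Circle.exp t) = Circle.exp (a t) := ha'
  let y : ℝ → ℝ × ℂ := fun t => (a t, (K₀.coords (K.core (Circle.exp t))).2)
  have hyc : Continuous y := hac.prodMk (hc.snd.comp Circle.exp.continuous)
  have hy : ∀ t, K₀.lift (y t) = K.lift (t, 0) := fun t => by
    rw [lift]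
    simp only [y]
    rw [← ha, hα]
    exact K₀.toFun_coords (hcr _)
  have hyd : Differentiable ℝ y := fun t => by
    refine K₀.differentiableAt_of_lift hyc.continuousAt ?_
    simp only [hy]
    exact (K.differentiable_lift _).comp t (by fun_prop)
  have had : Differentiable ℝ a := hyd.fst
  have hda : ∀ t, deriv a t = (deriv y t).1 := fun t =>
    (HasFDerivAt.comp_hasDerivAt (l := Prod.fst) (l' := ContinuousLinearMap.fst ℝ ℝ ℂ) t
      hasFDerivAt_fst (hyd t).hasDerivAt).deriv
  obtain ⟨s, hs⟩ := exists_regular_value had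
  -- the crossings of `K` with the meridian disc over `exp s`
  have hfin : {t ∈ Icc 0 (2 * Real.pi) | Circle.exp (a t) = Circle.exp s}.Finite := by
    refine finite_of_isolated ?_ ?_
    · refine isCompact_Icc.inter_right (isClosed_eq (Circle.exp.continuous.comp hac) continuous_const)
    · rintro t ⟨-, ht⟩
      have h2 : ∀ᶠ r in nhds t, r ≠ t → a r ≠ a t := by
        have := (had t).hasDerivAt.eventually_ne (c := a t) (hs t ht)
        rwa [eventually_nhdsWithin_iff] at this
      have h3 : ∀ᶠ r in nhds t, |a r - a t| < 2 * Real.pi := by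
        have : ContinuousAt (fun r => |a r - a t|) t := by fun_prop
        refine this.eventually (gt_mem_nhds ?_)
        simpa using Real.pi_pos
      filter_upwards [h2, h3] with r hr2 hr3
      rintro ⟨-, hr⟩
      by_contra hne
      refine hr2 hne ?_
      obtain ⟨m, hm⟩ := Circle.exp_eq_exp.1 (hr.trans ht.symm)
      have hm0 : m = 0 := by
        rw [hm, add_sub_cancel_left, abs_mul, abs_of_pos Real.two_pi_pos] at hr3
        have : |(m : ℝ)| < 1 := by
          by_contra hc
          nlinarith [Real.two_pi_pos, not_lt.1 hc]
        exact Int.abs_lt_one_iff.1 (by exact_mod_cast this)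
      simpa [hm0] using hm
  classical
  set T : Finset ℝ := hfin.toFinset.filter fun t => t < 2 * Real.pi with hT
  have hTm : ∀ t, t ∈ T ↔ (t ∈ Icc 0 (2 * Real.pi) ∧ Circle.exp (a t) = Circle.exp s) ∧
      t < 2 * Real.pi := fun t => by simp [hT]
  have hTinj : InjOn Circle.exp T := by
    intro t ht t' ht' h
    rw [Finset.mem_coe, hTm] at ht ht'
    have : InjOn (fun t => Circle.exp t) (Ico 0 (0 + 2 * Real.pi)) := by
      intro x hx x' hx' hxx
      obtain ⟨m, hm⟩ := Circle.exp_eq_exp.1 hxx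
      have hm0 : m = 0 := by
        have h1 : (m : ℝ) * (2 * Real.pi) < 1 * (2 * Real.pi) := by linarith [hx.2, hx'.1]
        have h2 : (-1 : ℝ) * (2 * Real.pi) < m * (2 * Real.pi) := by linarith [hx.1, hx'.2]
        have h1' := lt_of_mul_lt_mul_right h1 Real.two_pi_pos.le
        have h2' := lt_of_mul_lt_mul_right h2 Real.two_pi_pos.le
        have : m < 1 := by exact_mod_cast h1'
        have : -1 < m := by exact_mod_cast h2'
        omega
      simpa [hm0] using hm
    exact this ⟨ht.1.1.1, by simpa using ht.2⟩ ⟨ht'.1.1.1, by simpa using ht'.2⟩ h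
  have hTall : ∀ u, α u = Circle.exp s → ∃ t ∈ T, Circle.exp t = u := by
    intro u hu
    obtain ⟨t₀, rfl⟩ := Circle.exp_surjective u
    have hmod : ∃ m : ℤ, toIcoMod Real.two_pi_pos 0 t₀ = t₀ + m * (2 * Real.pi) := by
      refine ⟨-toIcoDiv Real.two_pi_pos 0 t₀, ?_⟩
      have := toIcoMod_add_toIcoDiv_zsmul Real.two_pi_pos 0 t₀
      rw [zsmul_eq_mul] at this
      push_cast
      linarith
    refine ⟨toIcoMod Real.two_pi_pos 0 t₀, ?_, ?_⟩
    · have h1 := toIcoMod_mem_Ico Real.two_pi_pos 0 t₀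
      rw [zero_add] at h1
      rw [hTm]
      refine ⟨⟨⟨h1.1, h1.2.le⟩, ?_⟩, h1.2⟩
      rw [← ha, ← hu]
      congr 1
      rw [Circle.exp_eq_exp]
      exact hmod
    · rw [Circle.exp_eq_exp]
      exact hmod
  have hreg : ∀ t ∈ T, deriv a t ≠ 0 := fun t ht => hs t ((hTm t).1 ht).1.2
  rw [deg_eq_sum_sign hαc ha had T hTinj (fun t ht => (ha t).trans ((hTm t).1 ht).1.2) hTall hreg]
  -- the map on the meridian disc over `exp s`, whose singularities are the crossings
  let c : ℝ → ℂ := fun t => (y t).2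
  have hyT : ∀ t ∈ T, K₀.toFun (Circle.exp s, c t) = K.core (Circle.exp t) := fun t ht => by
    have h2 := hy t
    rw [lift] at h2
    rw [← ((hTm t).1 ht).1.2]
    exact h2
  have hcT : InjOn c T := fun t ht t' ht' h => by
    refine hTinj ht ht' (hcinj ?_)
    rw [← hyT t ht, ← hyT t' ht', h]
  have hcompl : ∀ z, z ∉ c '' T → K₀.toFun (Circle.exp s, z) ∈ K.complement := by
    rintro z hz
    refine ⟨K₀.mem _, ?_⟩
    rintro ⟨u, hu⟩
    refine hz ?_
    have h2 : K₀.coords (K.core u) = (Circle.exp s, z) := by rw [hu, coords_toFun]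
    obtain ⟨t, ht, rfl⟩ := hTall u (by rw [hα]; simp only [h2])
    refine ⟨t, ht, ?_⟩
    have h3 := hyT t ht
    rw [hu] at h3
    exact (Prod.mk.inj (K₀.inj h3)).2
  have hslice : Continuous fun z : ℂ => K₀.toFun (Circle.exp s, z) :=
    K₀.continuous_toFun.comp (by fun_prop)
  have key := deg_eq_sum_index_of_injOn (R := 1) one_pos
    (fun t => (SignType.sign (deriv a t) : ℤ)) T (c := c) hcT
    (φ := fun z => φ (K₀.toFun (Circle.exp s, z))) (fun t _ => hball _)
    (hφ.comp hslice.continuousOn fun z hz => hcompl z hz.2)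
    (fun t ht => by
      obtain ⟨m, hm⟩ := Circle.exp_eq_exp.1 ((hTm t).1 ht).1.2
      have hiso : ∀ᶠ z in nhds (c t), z ≠ c t → K₀.lift (a t, z) ∈ K.complement := by
        have h2 : ((T.image c).erase (c t) : Set ℂ)ᶜ ∈ nhds (c t) :=
          ((T.image c).erase (c t)).finite_toSet.isClosed.isOpen_compl.mem_nhds (by simp)
        filter_upwards [h2] with z hz hzt
        rw [lift]
        simp only
        rw [((hTm t).1 ht).1.2]
        refine hcompl z fun h3 => hz ?_
        simpa [hzt] using h3
      obtain ⟨ε, hε, h⟩ := deg_small_circle_of_crossing hφ h1 (s₀ := a t) (z₀ := c t) hy rfl (hyd t)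
        (by rw [← hda]; exact hreg t ht) hiso
      refine ⟨ε, hε, fun r hr => ?_⟩
      have h2 := h r hr
      rw [← hda] at h2
      rw [← h2]
      simp only [lift, ((hTm t).1 ht).1.2])
  rw [← key]
  have hcomplS : ∀ x : Circle × Circle, K₀.toFun (x.1, (x.2 : ℂ)) ∈ K.complement := fun x => by
    refine ⟨K₀.mem _, ?_⟩
    rintro ⟨u, hu⟩
    have h2 := hball u
    rw [hu, coords_toFun, Circle.norm_coe] at h2
    exact lt_irrefl _ h2
  have hcont : Continuous fun x : Circle × Circle => φ (K₀.toFun (x.1, (x.2 : ℂ))) :=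
    hφ.comp_continuous (K₀.continuous_toFun.comp (by fun_prop)) hcomplS
  have := deg_eq_of_homotopy (S := (univ : Set Circle)) (H := fun u v => φ (K₀.toFun (u, (v : ℂ))))
    isPreconnected_univ hcont.continuousOn (mem_univ 1) (mem_univ (Circle.exp s))
  simp only [Complex.ofReal_one, one_mul]
  exact this

end TubedKnot

/-! ### Seifert fibres on the boundary of the neighbourhood of a torus knot -/

/-- `zc` as a continuous linear map. -/
def zcL : E4 →L[ℝ] ℂ := Complex.equivRealProdCLM.symm.toContinuousLinearMap.comp
  ((EuclideanSpace.proj 0 : E4 →L[ℝ] ℝ).prod (EuclideanSpace.proj 1))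

/-- `wc` as a continuous linear map. -/
def wcL : E4 →L[ℝ] ℂ := Complex.equivRealProdCLM.symm.toContinuousLinearMap.comp
  ((EuclideanSpace.proj 2 : E4 →L[ℝ] ℝ).prod (EuclideanSpace.proj 3))

theorem zcL_apply (x : E4) : zcL x = zc x := by
  apply Complex.ext <;> simp [zcL, zc, Complex.equivRealProdCLM_symm_apply]

theorem wcL_apply (x : E4) : wcL x = wc x := by
  apply Complex.ext <;> simp [wcL, wc, Complex.equivRealProdCLM_symm_apply]

@[simp] theorem zc_pt (z w : ℂ) : zc (pt z w) = z := by apply Complex.ext <;> simp [zc, pt]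

@[simp] theorem wc_pt (z w : ℂ) : wc (pt z w) = w := by apply Complex.ext <;> simp [wc, pt]

theorem ext_zc_wc {x y : E4} (hz : zc x = zc y) (hw : wc x = wc y) : x = y := by
  have h0 := congrArg Complex.re hz
  have h1 := congrArg Complex.im hz
  have h2 := congrArg Complex.re hw
  have h3 := congrArg Complex.im hw
  simp only [zc, wc] at h0 h1 h2 h3
  ext i
  fin_cases i <;> assumption

theorem continuous_zc : Continuous zc := zcL.continuous.congr zcL_apply

theorem continuous_wc : Continuous wc := wcL.continuous.congr wcL_apply

theorem continuous_pt : Continuous fun x : ℂ × ℂ => pt x.1 x.2 := by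
  unfold pt
  refine (PiLp.continuous_toLp 2 _).comp (continuous_pi fun i => ?_)
  fin_cases i <;> simp <;> fun_prop

theorem norm_sq_zc_add_wc {x : E4} (hx : x ∈ S3) : ‖zc x‖ ^ 2 + ‖wc x‖ ^ 2 = 1 := by
  have h : ‖x‖ ^ 2 = 1 := by rw [show ‖x‖ = 1 by simpa using hx]; norm_num
  rw [EuclideanSpace.norm_sq_eq] at h
  rw [← Complex.normSq_eq_norm_sq, ← Complex.normSq_eq_norm_sq, Complex.normSq_apply,
    Complex.normSq_apply, ← h]
  simp [Fin.sum_univ_four, zc, wc]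
  ring

theorem zc_seifertFiber (p q : ℤ) (x : E4) (u : Circle) :
    zc (seifertFiber p q x u) = (u : ℂ) ^ p * zc x := zc_pt _ _

theorem wc_seifertFiber (p q : ℤ) (x : E4) (u : Circle) :
    wc (seifertFiber p q x u) = (u : ℂ) ^ q * wc x := wc_pt _ _

theorem continuous_seifertFiber (p q : ℤ) :
    Continuous fun x : E4 × Circle => seifertFiber p q x.1 x.2 := by
  have h : ∀ n : ℤ, Continuous fun x : E4 × Circle => ((x.2 : ℂ)) ^ n := fun n =>
    (continuous_circle_coe.comp continuous_snd).zpow₀ n fun x => Or.inl (Circle.coe_ne_zero _)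
  exact continuous_pt.comp (((h p).mul (continuous_zc.comp continuous_fst)).prodMk
    ((h q).mul (continuous_wc.comp continuous_fst)))

theorem seifertFiber_seifertFiber (p q : ℤ) (x : E4) (u v : Circle) :
    seifertFiber p q (seifertFiber p q x u) v = seifertFiber p q x (u * v) := by
  refine ext_zc_wc ?_ ?_
  · simp only [zc_seifertFiber, Circle.coe_mul, mul_zpow]; ring
  · simp only [wc_seifertFiber, Circle.coe_mul, mul_zpow]; ring

/-- The identity or complex conjugation, according to the sign of `p`. -/
def twist (p : ℤ) : ℂ →L[ℝ] ℂ := if 0 ≤ p then ContinuousLinearMap.id ℝ ℂ else Complex.conjCLE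

theorem norm_twist (p : ℤ) (z : ℂ) : ‖twist p z‖ = ‖z‖ := by
  unfold twist; split_ifs <;> simp

theorem twist_zpow_mul (p : ℤ) (u : Circle) (z : ℂ) :
    twist p ((u : ℂ) ^ p * z) = (u : ℂ) ^ p.natAbs * twist p z := by
  unfold twist
  split_ifs with h
  · obtain ⟨n, rfl⟩ := Int.eq_ofNat_of_zero_le h
    simp
  · obtain ⟨n, hn⟩ := Int.exists_eq_neg_ofNat (not_le.1 h).le
    subst hn
    have : (starRingEnd ℂ) (u : ℂ) = ((u : ℂ))⁻¹ := by
      rw [← Circle.coe_inv_eq_conj, Circle.coe_inv]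
    simp [this]

theorem twist_re (p : ℤ) (z : ℂ) : (twist p z).re = z.re := by
  unfold twist; split_ifs <;> simp

theorem twist_im {p : ℤ} (hp : p ≠ 0) (z : ℂ) : (twist p z).im = (SignType.sign p : ℤ) * z.im := by
  unfold twist
  split_ifs with h
  · rw [sign_pos (lt_of_le_of_ne h hp.symm)]; simp
  · rw [sign_neg (not_le.1 h)]; simp

theorem twist_circle (p : ℤ) (u : Circle) :
    ((u ^ (if 0 ≤ p then 1 else -1 : ℤ) : Circle) : ℂ) = twist p u := by
  unfold twist
  split_ifs with h
  · simp
  · simp [← Circle.coe_inv_eq_conj]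

/-- A function on `ℂ²` whose zeros on the sphere form the `(p, q)`-torus knot. Coordinates on which
the circle acts with a negative weight are conjugated, so that all exponents are positive. -/
def torusEq (p q : ℤ) (x : E4) : ℂ :=
  (√2 * twist p (zc x)) ^ q.natAbs - (√2 * twist q (wc x)) ^ p.natAbs

theorem continuous_torusEq (p q : ℤ) : Continuous (torusEq p q) := by
  have h1 := continuous_zc
  have h2 := continuous_wc
  unfold torusEq
  fun_prop

theorem torusEq_seifertFiber (p q : ℤ) (x : E4) (u : Circle) :
    torusEq p q (seifertFiber p q x u) = (u : ℂ) ^ (p * q).natAbs * torusEq p q x := by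
  simp only [torusEq, zc_seifertFiber, wc_seifertFiber, twist_zpow_mul, Int.natAbs_mul]
  rw [mul_left_comm, mul_pow, mul_left_comm, mul_pow ((u : ℂ) ^ q.natAbs), ← pow_mul, ← pow_mul,
    mul_comm q.natAbs, mul_sub]

theorem exists_torusKnot_eq {p q : ℤ} (hp : p ≠ 0) (hq : q ≠ 0) (hpq : IsCoprime p q) {x : E4}
    (hx : x ∈ S3) (h : torusEq p q x = 0) : ∃ u, torusKnot p q u = x := by
  have h2 : (0 : ℝ) < √2 := by positivity
  have hsq : √2 * √2 = 2 := Real.mul_self_sqrt zero_le_two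
  have hpn : p.natAbs ≠ 0 := Int.natAbs_ne_zero.2 hp
  have hqn : q.natAbs ≠ 0 := Int.natAbs_ne_zero.2 hq
  have he := sub_eq_zero.1 h
  have hn := norm_sq_zc_add_wc hx
  have hnorm : (√2 * ‖zc x‖) ^ q.natAbs = (√2 * ‖wc x‖) ^ p.natAbs := by
    have := congrArg norm he
    simpa only [norm_pow, norm_mul, norm_twist, Complex.norm_real, Real.norm_of_nonneg h2.le] using this
  have hs : (√2 * ‖zc x‖) ^ 2 + (√2 * ‖wc x‖) ^ 2 = 2 := by
    rw [mul_pow, mul_pow, Real.sq_sqrt zero_le_two]; linarith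
  set A := √2 * ‖zc x‖ with hA
  set B := √2 * ‖wc x‖ with hB
  have hA0 : 0 ≤ A := by positivity
  have hB0 : 0 ≤ B := by positivity
  have hA1 : A = 1 := by
    rcases lt_trichotomy A 1 with h1 | h1 | h1
    · have hB1 : 1 < B := by nlinarith
      have := pow_lt_one₀ hA0 h1 hqn
      have := one_lt_pow₀ hB1 hpn
      linarith
    · exact h1
    · have hB1 : B < 1 := by nlinarith
      have := pow_lt_one₀ hB0 hB1 hpn
      have := one_lt_pow₀ h1 hqn
      linarith
  have hB1 : B = 1 := by
    rw [hA1] at hs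
    nlinarith
  have hz1 : ‖(√2 * zc x : ℂ)‖ = 1 := by
    rw [norm_mul, Complex.norm_real, Real.norm_of_nonneg h2.le]; exact hA1
  have hw1 : ‖(√2 * wc x : ℂ)‖ = 1 := by
    rw [norm_mul, Complex.norm_real, Real.norm_of_nonneg h2.le]; exact hB1
  let ζ : Circle := ⟨√2 * zc x, mem_sphere_zero_iff_norm.2 hz1⟩
  let η : Circle := ⟨√2 * wc x, mem_sphere_zero_iff_norm.2 hw1⟩
  have htw : ∀ (r : ℤ) (z : ℂ), (√2 * twist r z : ℂ) = twist r (√2 * z) := fun r z => by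
    have := (twist r).map_smul (√2) z
    simpa using this.symm
  have hrel : ζ ^ q = η ^ p := by
    rw [htw, htw, show (√2 * zc x : ℂ) = ζ from rfl, show (√2 * wc x : ℂ) = η from rfl,
      ← twist_circle, ← twist_circle, ← Circle.coe_pow, ← Circle.coe_pow] at he
    have he' := Circle.ext he
    rw [← zpow_natCast, ← zpow_natCast, ← zpow_mul, ← zpow_mul] at he'
    rcases le_or_gt 0 p with hp0 | hp0 <;> rcases le_or_gt 0 q with hq0 | hq0
    · simpa [hp0, hq0, abs_of_nonneg] using he'
    · simp only [hp0, not_le.2 hq0, if_true, if_false, Int.natCast_natAbs, abs_of_nonneg hp0,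
        abs_of_neg hq0, one_mul, neg_mul, zpow_neg, inv_inj] at he'
      exact he'
    · simp only [hq0, not_le.2 hp0, if_true, if_false, Int.natCast_natAbs, abs_of_nonneg hq0,
        abs_of_neg hp0, one_mul, neg_mul, zpow_neg, inv_inj] at he'
      exact he'
    · simp only [not_le.2 hq0, not_le.2 hp0, if_false, Int.natCast_natAbs, abs_of_neg hq0,
        abs_of_neg hp0, neg_mul, mul_neg, neg_neg, one_mul] at he'
      exact he'
  obtain ⟨a, b, hab⟩ := hpq
  have h3 : ∀ z : ℂ, ((1 / √2 : ℝ) : ℂ) * (√2 * z) = z := fun z => by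
    rw [← mul_assoc, ← Complex.ofReal_mul, one_div_mul_cancel h2.ne', Complex.ofReal_one, one_mul]
  refine ⟨ζ ^ a * η ^ b, ext_zc_wc ?_ ?_⟩
  · rw [torusKnot, zc_seifertFiber, zc_pt, ← Circle.coe_zpow]
    have : (ζ ^ a * η ^ b) ^ p = ζ := by
      rw [mul_zpow, ← zpow_mul, ← zpow_mul, mul_comm b p, zpow_mul η, ← hrel, ← zpow_mul,
        ← zpow_add, mul_comm q b, hab, zpow_one]
    rw [this, mul_comm]
    exact h3 _
  · rw [torusKnot, wc_seifertFiber, wc_pt, ← Circle.coe_zpow]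
    have : (ζ ^ a * η ^ b) ^ q = η := by
      rw [mul_zpow, ← zpow_mul, ← zpow_mul, mul_comm a q, zpow_mul ζ, hrel, ← zpow_mul,
        ← zpow_add, mul_comm p a, hab, zpow_one]
    rw [this, mul_comm]
    exact h3 _

theorem torusEq_torusKnot (p q : ℤ) (u : Circle) : torusEq p q (torusKnot p q u) = 0 := by
  have h2 : (√2 : ℝ) ≠ 0 := by positivity
  have h3 : ∀ r : ℤ, (√2 * twist r ((1 / √2 : ℝ) : ℂ) : ℂ) = 1 := fun r => by
    have h4 : twist r ((1 / √2 : ℝ) : ℂ) = ((1 / √2 : ℝ) : ℂ) := by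
      unfold twist; split_ifs <;> simp
    rw [h4, ← Complex.ofReal_mul, mul_one_div_cancel h2, Complex.ofReal_one]
  rw [torusKnot, torusEq_seifertFiber, torusEq, zc_pt, wc_pt, h3, h3]
  simp

theorem hasFDerivAt_torusEq {p q : ℤ} (u : E4) (hz : √2 * zc u = 1) (hw : √2 * wc u = 1) :
    HasFDerivAt (torusEq p q) (√2 • ((q.natAbs : ℝ) • (twist p).comp zcL -
      (p.natAbs : ℝ) • (twist q).comp wcL)) u := by
  have htw : ∀ r (z : ℂ), √2 * z = 1 → (√2 * twist r z : ℂ) = 1 := fun r z h => by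
    have := (twist r).map_smul (√2) z
    rw [← Complex.real_smul, ← this, Complex.real_smul, h]
    apply Complex.ext
    · simp [twist_re]
    · unfold twist; split_ifs <;> simp
  have h1 : HasFDerivAt (fun x => (√2 * twist p (zc x) : ℂ)) (√2 • (twist p).comp zcL) u := by
    have := (((twist p).comp zcL).hasFDerivAt (x := u)).const_smul (√2)
    exact this.congr_of_eventuallyEq (Filter.Eventually.of_forall fun x => by simp [zcL_apply])
  have h2 : HasFDerivAt (fun x => (√2 * twist q (wc x) : ℂ)) (√2 • (twist q).comp wcL) u := by
    have := (((twist q).comp wcL).hasFDerivAt (x := u)).const_smul (√2)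
    exact this.congr_of_eventuallyEq (Filter.Eventually.of_forall fun x => by simp [wcL_apply])
  refine ((h1.pow q.natAbs).sub (h2.pow p.natAbs)).congr_fderiv ?_
  rw [htw p _ hz, htw q _ hw]
  ext v
  simp [-Nat.cast_natAbs]
  ring

/-- Derivatives of maps into the sphere are tangent to it. -/
theorem inner_fderiv_eq_zero {E : Type*} [NormedAddCommGroup E] [NormedSpace ℝ E] {g : E → E4}
    {g' : E →L[ℝ] E4} {x₀ : E} (hg : ∀ᶠ x in nhds x₀, g x ∈ S3) (h : HasFDerivAt g g' x₀) (v : E) :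
    inner ℝ (g x₀) (g' v) = 0 := by
  have h1 := h.norm_sq
  have h2 : HasFDerivAt (fun x => ‖g x‖ ^ 2) (0 : E →L[ℝ] ℝ) x₀ := by
    refine (hasFDerivAt_const (1 : ℝ) x₀).congr_of_eventuallyEq ?_
    filter_upwards [hg] with x hx
    rw [show ‖g x‖ = 1 by simpa using hx, one_pow]
  have h3 := DFunLike.congr_fun (h1.unique h2) v
  simpa using h3

namespace IsFiberedTorusKnot

variable {p q : ℤ} {K₀ : TubedKnot}

theorem mem_complement_iff (h : IsFiberedTorusKnot p q K₀) (hp : p ≠ 0) (hq : q ≠ 0)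
    (hpq : IsCoprime p q) {x : E4} (hx : x ∈ S3) : x ∈ K₀.complement ↔ torusEq p q x ≠ 0 := by
  have : x ∈ range K₀.core ↔ torusEq p q x = 0 := by
    constructor
    · rintro ⟨u, rfl⟩
      rw [h.1, torusEq_torusKnot]
    · intro h0
      obtain ⟨u, hu⟩ := exists_torusKnot_eq hp hq hpq hx h0
      exact ⟨u, by rw [h.1, hu]⟩
  rw [TubedKnot.complement, mem_sdiff, this, and_iff_right hx]

theorem continuousOn_dir_torusEq (h : IsFiberedTorusKnot p q K₀) (hp : p ≠ 0) (hq : q ≠ 0)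
    (hpq : IsCoprime p q) : ContinuousOn (fun x => dir (torusEq p q x)) K₀.complement :=
  continuousOn_dir_comp (continuous_torusEq p q).continuousOn fun _ hx =>
    (h.mem_complement_iff hp hq hpq hx.1).1 hx

/-- The equation of the torus knot winds once around its meridian: it vanishes to first order
along the knot, and the sign is that of a `2 × 2` determinant. -/
theorem deg_torusEq_meridian (h : IsFiberedTorusKnot p q K₀) (hp : p ≠ 0) (hq : q ≠ 0)
    (hpq : IsCoprime p q) :
    deg (fun v => dir (torusEq p q (K₀.meridian v))) = (SignType.sign (p * q) : ℤ) := by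
  have hcoe := continuous_circle_coe
  set x₀ := K₀.lift (0, 0) with hx₀
  have h2 : (√2 : ℝ) ≠ 0 := by positivity
  have hsq : √2 * √2 = 2 := Real.mul_self_sqrt zero_le_two
  have hcore : ∀ t : ℝ, K₀.lift (t, 0) = torusKnot p q (Circle.exp t) := fun t => h.1 _
  have hz : zc x₀ = ((1 / √2 : ℝ) : ℂ) := by
    rw [hx₀, hcore, torusKnot, zc_seifertFiber, zc_pt]; simp
  have hw : wc x₀ = ((1 / √2 : ℝ) : ℂ) := by
    rw [hx₀, hcore, torusKnot, wc_seifertFiber, wc_pt]; simp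
  have hi : HasFDerivAt (fun z : ℂ => ((0 : ℝ), z)) (ContinuousLinearMap.inr ℝ ℝ ℂ) 0 :=
    (hasFDerivAt_const (0 : ℝ) (0 : ℂ)).prodMk (hasFDerivAt_id 0)
  set D := fderiv ℝ K₀.lift (0, 0) with hD
  have hDl : HasFDerivAt K₀.lift D (0, 0) := (K₀.differentiable_lift (0, 0)).hasFDerivAt
  have hdisc : HasFDerivAt (fun z : ℂ => K₀.lift (0, z)) (D.comp (ContinuousLinearMap.inr ℝ ℝ ℂ)) 0 :=
    HasFDerivAt.comp (g := K₀.lift) (0 : ℂ) hDl hi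
  have hcancel : ((√2 : ℝ) : ℂ) * ((1 / √2 : ℝ) : ℂ) = 1 := by
    rw [← Complex.ofReal_mul, mul_one_div_cancel h2, Complex.ofReal_one]
  have hF := HasFDerivAt.comp (g := torusEq p q) (0 : ℂ)
    (hasFDerivAt_torusEq x₀ (by rw [hz, hcancel]) (by rw [hw, hcancel])) hdisc
  set L : ℂ →L[ℝ] ℂ := (√2 • ((q.natAbs : ℝ) • (twist p).comp zcL -
      (p.natAbs : ℝ) • (twist q).comp wcL)).comp (D.comp (ContinuousLinearMap.inr ℝ ℝ ℂ)) with hL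
  -- the tangent vectors of the meridian disc and of the knot at `x₀`
  set X := D (0, 1) with hX
  set Y := D (0, Complex.I) with hY
  have hT : D (1, 0) = pt (Complex.I * p * ((1 / √2 : ℝ) : ℂ)) (Complex.I * q * ((1 / √2 : ℝ) : ℂ)) := by
    have h3 : HasDerivAt (fun t : ℝ => ((t, 0) : ℝ × ℂ)) (1, 0) 0 :=
      (hasDerivAt_id (0 : ℝ)).prodMk (hasDerivAt_const (0 : ℝ) (0 : ℂ))
    have h4 : HasDerivAt (fun t : ℝ => K₀.lift (t, 0)) (D (1, 0)) 0 :=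
      HasFDerivAt.comp_hasDerivAt (l := K₀.lift) (0 : ℝ) hDl h3
    have hexp : ∀ n : ℤ, HasDerivAt (fun t : ℝ => ((Circle.exp t : ℂ) ^ n * ((1 / √2 : ℝ) : ℂ)))
        (Complex.I * n * ((1 / √2 : ℝ) : ℂ)) 0 := fun n => by
      have h5 : HasDerivAt (fun t : ℝ => Complex.exp (n * (t * Complex.I)))
          (Complex.exp (n * ((0 : ℝ) * Complex.I)) * (n * (1 * Complex.I))) 0 :=
        (((Complex.ofRealCLM.hasDerivAt (x := (0 : ℝ))).mul_const Complex.I).const_mul (n : ℂ)).cexp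
      have h6 := h5.mul_const (((1 / √2 : ℝ) : ℂ))
      have e : (fun t : ℝ => ((Circle.exp t : ℂ) ^ n * ((1 / √2 : ℝ) : ℂ))) =
          fun t : ℝ => Complex.exp (n * (t * Complex.I)) * ((1 / √2 : ℝ) : ℂ) := by
        funext t
        rw [Circle.coe_exp, ← Complex.exp_int_mul]
      rw [e]
      refine h6.congr_deriv ?_
      simp
      ring
    refine ext_zc_wc ?_ ?_
    · rw [zc_pt]
      have h5 : HasDerivAt (fun t : ℝ => zc (K₀.lift (t, 0))) (zcL (D (1, 0))) 0 :=
        ((zcL.hasFDerivAt.comp_hasDerivAt (0 : ℝ) h4).congr_of_eventuallyEq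
          (Filter.Eventually.of_forall fun t => (zcL_apply _).symm))
      rw [← zcL_apply]
      refine h5.unique ((hexp p).congr_of_eventuallyEq (Filter.Eventually.of_forall fun t => ?_))
      simp only [hcore, torusKnot, zc_seifertFiber, zc_pt]
    · rw [wc_pt]
      have h5 : HasDerivAt (fun t : ℝ => wc (K₀.lift (t, 0))) (wcL (D (1, 0))) 0 :=
        ((wcL.hasFDerivAt.comp_hasDerivAt (0 : ℝ) h4).congr_of_eventuallyEq
          (Filter.Eventually.of_forall fun t => (wcL_apply _).symm))
      rw [← wcL_apply]
      refine h5.unique ((hexp q).congr_of_eventuallyEq (Filter.Eventually.of_forall fun t => ?_))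
      simp only [hcore, torusKnot, wc_seifertFiber, wc_pt]
  have hz' := hz
  have hw' := hw
  rw [zc, Complex.ext_iff] at hz'
  rw [wc, Complex.ext_iff] at hw'
  simp only [Complex.ofReal_re, Complex.ofReal_im] at hz' hw'
  have hs2 : (1 / √2) * (1 / √2) = 1 / 2 := by
    rw [div_mul_div_comm, hsq, one_mul]
  have hs0 : 1 / √2 ≠ 0 := by positivity
  set s := 1 / √2 with hs
  have hperp : ∀ v : ℂ, (D (0, v)) 0 + (D (0, v)) 2 = 0 := fun v => by
    have := inner_fderiv_eq_zero (Filter.Eventually.of_forall fun y => K₀.lift_mem y) hDl (0, v)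
    simp only [PiLp.inner_apply, Fin.sum_univ_four, ← hx₀, hz'.1, hz'.2, hw'.1, hw'.2] at this
    simp at this
    have h3 : s * ((D (0, v)) 0 + (D (0, v)) 2) = 0 := by linarith
    exact (mul_eq_zero.1 h3).resolve_left hs0
  have hpos := K₀.lift_pos (0, 0)
  have hq' : (q.natAbs : ℝ) = (SignType.sign q : ℤ) * q := by
    rw [Nat.cast_natAbs]; exact_mod_cast (sign_mul_self q).symm
  have hp' : (p.natAbs : ℝ) = (SignType.sign p : ℤ) * p := by
    rw [Nat.cast_natAbs]; exact_mod_cast (sign_mul_self p).symm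
  have hLre : ∀ v : ℂ, (L v).re = √2 * (q.natAbs + p.natAbs) * (D (0, v)) 0 := fun v => by
    simp [hL, zcL_apply, wcL_apply, twist_re, zc, wc, -Nat.cast_natAbs]
    linear_combination (-√2 * p.natAbs) * hperp v
  have hLim : ∀ v : ℂ, (L v).im = √2 * ((SignType.sign p : ℤ) * (SignType.sign q : ℤ)) *
      (q * (D (0, v)) 1 - p * (D (0, v)) 3) := fun v => by
    simp [hL, zcL_apply, wcL_apply, twist_im hp, twist_im hq, zc, wc, -Nat.cast_natAbs]
    rw [hq', hp']
    simp only [SignType.intCast_cast]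
    ring
  have hdet : detC L = ((SignType.sign p : ℤ) * (SignType.sign q : ℤ)) *
      (2 * (q.natAbs + p.natAbs)) * det4 x₀ (D (1, 0)) X Y := by
    rw [detC, hLre, hLre, hLim, hLim, det4_eq, hT, hz'.1, hz'.2, hw'.1, hw'.2]
    simp only [pt, ← hX, ← hY]
    have e1 := hperp 1
    have e2 := hperp Complex.I
    rw [← hX] at e1
    rw [← hY] at e2
    have e1' : X 2 = - X 0 := by linarith
    have e2' : Y 2 = - Y 0 := by linarith
    simp [e1', e2', -Nat.cast_natAbs]
    set W := q * (X 0 * Y 1 - X 1 * Y 0) - p * (X 0 * Y 3 - X 3 * Y 0) with hW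
    set σ := ((SignType.sign p : SignType) : ℝ) * ((SignType.sign q : SignType) : ℝ) with hσ
    linear_combination (σ * (q.natAbs + p.natAbs) * W) * hsq -
      (4 * σ * (q.natAbs + p.natAbs) * W) * hs2
  have hnat : (0 : ℝ) < 2 * (q.natAbs + p.natAbs) := by
    have := Int.natAbs_pos.2 hp
    positivity
  have hsgn : SignType.sign (detC L) = SignType.sign (p * q) := by
    rw [hdet, sign_mul, sign_mul, sign_pos hnat, sign_pos hpos, mul_one, mul_one, sign_mul, sign_mul]
    congr 1
    · rcases hp.lt_or_gt with h | h <;> simp [h]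
    · rcases hq.lt_or_gt with h | h <;> simp [h]
  have hL0 : detC L ≠ 0 := by
    rw [← sign_ne_zero, hsgn, sign_ne_zero]
    exact mul_ne_zero hp hq
  have hFc : Continuous fun z : ℂ => torusEq p q (K₀.lift (0, z)) :=
    (continuous_torusEq p q).comp (K₀.continuous_lift.comp (by fun_prop))
  obtain ⟨ε, hε, h3⟩ := deg_dir_small_circle hF (by
    change torusEq p q (K₀.lift (0, 0)) = 0
    rw [hcore, torusEq_torusKnot]) hL0
  have h4 := h3 (ε / 2) ⟨by positivity, by linarith⟩ hFc.continuousOn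
  have h5 := K₀.deg_comp_toFun (h.continuousOn_dir_torusEq hp hq hpq) (U := fun _ => 1)
    continuous_const (V := fun v => ((ε / 2 : ℝ) : ℂ) * v) (by fun_prop)
    fun v => mul_ne_zero (by exact_mod_cast (half_pos hε).ne') (Circle.coe_ne_zero v)
  rw [deg_const, deg_dir_const_mul (by exact_mod_cast (half_pos hε).ne'), mul_zero, zero_add,
    mul_one] at h5
  rw [← h5, ← hsgn, ← h4]
  congr 1
  funext v
  simp [TubedKnot.lift]

/-- A Seifert fibre on the boundary of the neighbourhood of the `(p, q)`-torus knot is homologous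
to `l + pq m`. -/
theorem deg_fiber (h : IsFiberedTorusKnot p q K₀) (hp : p ≠ 0) (hq : q ≠ 0) (hpq : IsCoprime p q)
    (hpref : K₀.Preferred) {x : E4} (hx : ∀ u, seifertFiber p q x u ∈ K₀.boundary) :
    deg (fun u => (K₀.coords (seifertFiber p q x u)).1) = 1 ∧
      deg (fun u => dir (K₀.coords (seifertFiber p q x u)).2) = p * q := by
  have hbn : K₀.boundary ⊆ K₀.nbhd := image_mono (prod_mono Subset.rfl sphere_subset_closedBall)
  have hxr : ∀ u, seifertFiber p q x u ∈ range K₀.toFun := fun u =>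
    K₀.nbhd_subset_range (hbn (hx u))
  have hfc : Continuous fun u => seifertFiber p q x u :=
    (continuous_seifertFiber p q).comp (f := fun u => (x, u)) (by fun_prop)
  have hcc : Continuous fun u => K₀.coords (seifertFiber p q x u) :=
    K₀.continuousOn_coords.comp_continuous hfc hxr
  have hnorm : ∀ u, ‖(K₀.coords (seifertFiber p q x u)).2‖ = 1 := fun u => by
    rw [← K₀.toFun_mem_boundary, K₀.toFun_coords (hxr u)]; exact hx u
  have h0 : ∀ u, (K₀.coords (seifertFiber p q x u)).2 ≠ 0 := fun u =>
    norm_pos_iff.1 (by rw [hnorm]; exact one_pos)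
  refine ⟨?_, ?_⟩
  · -- contract the fibre to the core of the neighbourhood
    have hone : seifertFiber p q x 1 = x := ext_zc_wc (by simp [zc_seifertFiber])
      (by simp [wc_seifertFiber])
    have hxr' : x ∈ range K₀.toFun := by rw [← hone]; exact hxr 1
    obtain ⟨⟨c, w⟩, rfl⟩ := hxr'
    have hw : ‖w‖ = 1 := by
      rw [show w = (c, w).2 from rfl, ← K₀.toFun_mem_boundary, ← hone]; exact hx 1
    have hcont : Continuous fun y : ℝ × Circle => seifertFiber p q (K₀.toFun (c, y.1 * w)) y.2 :=
      (continuous_seifertFiber p q).comp ((K₀.continuous_toFun.comp (by fun_prop)).prodMk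
        continuous_snd)
    have := deg_eq_of_homotopy (S := Icc (0 : ℝ) 1)
      (H := fun t u => (K₀.coords (seifertFiber p q (K₀.toFun (c, t * w)) u)).1) isPreconnected_Icc
      (by
        refine (K₀.continuousOn_coords.comp hcont.continuousOn ?_).fst
        rintro ⟨t, u⟩ ⟨ht, -⟩
        refine K₀.nbhd_subset_range (h.2 _ (K₀.toFun_mem_nbhd.2 ?_) u)
        simp [hw, abs_of_nonneg ht.1, ht.2])
      (y := 1) (y' := 0) (by simp) (by simp)
    simp only [Complex.ofReal_one, one_mul, Complex.ofReal_zero, zero_mul] at this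
    rw [this]
    have e : (fun u => (K₀.coords (seifertFiber p q (K₀.toFun (c, 0)) u)).1) = fun u => c * u := by
      funext u
      have h1 : K₀.toFun (c, 0) = torusKnot p q c := h.1 c
      rw [h1, torusKnot, seifertFiber_seifertFiber]
      have h2 := h.1 (c * u)
      rw [torusKnot] at h2
      rw [← h2, TubedKnot.core, K₀.coords_toFun]
    rw [e, deg_mul continuous_const continuous_id', deg_const, deg_id, zero_add]
  · have hφ := h.continuousOn_dir_torusEq hp hq hpq
    have h1 := K₀.deg_comp_toFun hφ hcc.fst hcc.snd h0
    rw [hpref.deg_eq_zero hφ, h.deg_torusEq_meridian hp hq hpq, zero_mul, zero_add] at h1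
    simp only [Prod.mk.eta, fun u => K₀.toFun_coords (hxr u)] at h1
    have hx0 : torusEq p q x ≠ 0 := by
      have h2 := (h.mem_complement_iff hp hq hpq (K₀.mem (K₀.coords (seifertFiber p q x 1)))).1
        (K₀.toFun_mem_complement.2 (h0 1))
      rw [K₀.toFun_coords (hxr 1), torusEq_seifertFiber] at h2
      exact right_ne_zero_of_mul h2
    have e : (fun u => dir (torusEq p q (seifertFiber p q x u))) =
        fun u => u ^ ((p * q).natAbs : ℤ) * dir (torusEq p q x) := by
      funext u
      rw [torusEq_seifertFiber, dir_mul (pow_ne_zero _ (Circle.coe_ne_zero u)) hx0, ← Circle.coe_pow,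
        dir_coe, zpow_natCast]
    have hc : Continuous fun u : Circle => u ^ ((p * q).natAbs : ℤ) := continuous_id.zpow _
    rw [e, deg_mul hc continuous_const, deg_const, deg_zpow continuous_id', deg_id, mul_one,
      add_zero, Int.natCast_natAbs] at h1
    have h3 : p * q ≠ 0 := mul_ne_zero hp hq
    rcases h3.lt_or_gt with h4 | h4
    · rw [sign_neg h4, abs_of_neg h4] at h1
      simp at h1
      linarith
    · rw [sign_pos h4, abs_of_pos h4] at h1
      simp at h1
      linarith

end IsFiberedTorusKnot

/-! ### The boundary of a compact orientable surface -/

theorem continuousOn_invFunOn {X Y : Type*} [Nonempty X] [TopologicalSpace X] [TopologicalSpace Y]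
    [T2Space Y] {f : X → Y} {S : Set X} (hS : IsCompact S) (hf : ContinuousOn f S)
    (hinj : InjOn f S) : ContinuousOn (Function.invFunOn f S) (f '' S) := by
  rw [continuousOn_iff_isClosed]
  intro C hC
  refine ⟨f '' (S ∩ C), ((hS.inter_right hC).image_of_continuousOn
    (hf.mono inter_subset_left)).isClosed, ?_⟩
  ext y
  constructor
  · rintro ⟨hy, x, hx, rfl⟩
    refine ⟨⟨x, ⟨hx, ?_⟩, rfl⟩, mem_image_of_mem f hx⟩
    rw [mem_preimage, hinj.leftInvOn_invFunOn hx] at hy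
    exact hy
  · rintro ⟨⟨x, ⟨hx, hxC⟩, rfl⟩, hy⟩
    refine ⟨?_, hy⟩
    rw [mem_preimage, hinj.leftInvOn_invFunOn hx]
    exact hxC

theorem exists_lift_of_convex {E : Type*} [NormedAddCommGroup E] [NormedSpace ℝ E] {S : Set E}
    (hS : Convex ℝ S) (hne : S.Nonempty) {Φ : E → Circle} (hΦ : ContinuousOn Φ S) :
    ∃ θ : E → ℝ, ContinuousOn θ S ∧ ∀ x ∈ S, Φ x = Circle.exp (θ x) := by
  classical
  have := hS.contractibleSpace hne
  obtain ⟨θ, hθ, h⟩ := exists_circle_lift_of_contractible (g := S.domRestrict Φ)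
    (continuousOn_iff_continuous_domRestrict.1 hΦ)
  refine ⟨fun x => if hx : x ∈ S then θ ⟨x, hx⟩ else 0, ?_, fun x hx => ?_⟩
  · rw [continuousOn_iff_continuous_domRestrict]
    convert hθ using 1
    ext x
    simp
  · simp only [dif_pos hx, ← h]; rfl

variable {n : ℕ}

/-- The point of the edge `(e.1, e.2)` with parameter `t`. -/
def edgePt (e : Fin n × Fin n) (t : unitInterval) : Fin n → ℝ :=
  (1 - t : ℝ) • Pi.single e.1 1 + (t : ℝ) • Pi.single e.2 1

theorem continuous_edgePt (e : Fin n × Fin n) : Continuous (edgePt e) := by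
  unfold edgePt; fun_prop

theorem edgePt_zero (e : Fin n × Fin n) : edgePt e 0 = Pi.single e.1 1 := by simp [edgePt]

theorem edgePt_one (e : Fin n × Fin n) : edgePt e 1 = Pi.single e.2 1 := by simp [edgePt]

theorem edgePt_swap (e : Fin n × Fin n) (t : unitInterval) :
    edgePt e.swap t = edgePt e (unitInterval.symm t) := by
  simp [edgePt, add_comm]

theorem edgePt_mem_stdSimplex (e : Fin n × Fin n) (t : unitInterval) :
    edgePt e t ∈ stdSimplex ℝ (Fin n) :=
  convex_stdSimplex ℝ (Fin n) (single_mem_stdSimplex ℝ _) (single_mem_stdSimplex ℝ _)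
    (by linarith [t.2.2]) t.2.1 (by ring)

theorem edgePt_support {e : Fin n × Fin n} {t : unitInterval} {i : Fin n} (h : edgePt e t i ≠ 0) :
    i = e.1 ∨ i = e.2 := by
  by_contra hc
  push Not at hc
  exact h (by simp [edgePt, hc.1, hc.2])

theorem eq_edgePt {e : Fin n × Fin n} (he : e.1 ≠ e.2) {x : Fin n → ℝ}
    (hx : x ∈ stdSimplex ℝ (Fin n)) (hs : ∀ i, x i ≠ 0 → i = e.1 ∨ i = e.2) :
    ∃ t : unitInterval, x = edgePt e t ∧ (t : ℝ) = x e.2 := by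
  have hsum : x e.1 + x e.2 = 1 := by
    rw [← hx.2, ← Finset.sum_pair he]
    refine Finset.sum_subset (Finset.subset_univ _) fun i _ hi => ?_
    by_contra h0
    exact hi (by simpa using hs i h0)
  refine ⟨⟨x e.2, hx.1 _, by linarith [hx.1 e.1]⟩, ?_, rfl⟩
  ext i
  by_cases h1 : i = e.1
  · subst h1
    simp [edgePt, he]
    linarith
  · by_cases h2 : i = e.2
    · subst h2
      simp [edgePt, h1]
    · have : x i = 0 := by
        by_contra h0
        rcases hs i h0 with h | h
        · exact h1 h
        · exact h2 h
      simp [edgePt, h1, h2, this]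

open Classical in
/-- The variation of the argument along a path in the circle; `0` if the path is not continuous. -/
def pathVar (p : unitInterval → Circle) : ℝ := if h : Continuous p then variation ⟨p, h⟩ else 0

/-- The variation of the argument of `Φ` along an edge. -/
def edgeVar (Φ : (Fin n → ℝ) → Circle) (e : Fin n × Fin n) : ℝ := pathVar fun t => Φ (edgePt e t)

theorem edgeVar_congr {Φ Ψ : (Fin n → ℝ) → Circle} {e : Fin n × Fin n}
    (h : ∀ t, Φ (edgePt e t) = Ψ (edgePt e t)) : edgeVar Φ e = edgeVar Ψ e :=
  congrArg pathVar (funext h)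

theorem edgeVar_eq {Φ : (Fin n → ℝ) → Circle} {e : Fin n × Fin n} {θ : unitInterval → ℝ}
    (hθ : Continuous θ) (h : ∀ t, Φ (edgePt e t) = Circle.exp (θ t)) :
    edgeVar Φ e = θ 1 - θ 0 := by
  have hc : Continuous fun t => Φ (edgePt e t) := by
    simp only [h]
    exact Circle.exp.continuous.comp hθ
  rw [edgeVar, pathVar, dif_pos hc]
  exact variation_eq hθ h

theorem edgeVar_swap {Φ : (Fin n → ℝ) → Circle} {e : Fin n × Fin n}
    (h : Continuous fun t => Φ (edgePt e t)) : edgeVar Φ e.swap = - edgeVar Φ e := by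
  obtain ⟨θ, hθ, hl⟩ := exists_circle_lift_unitInterval ⟨_, h⟩
  rw [edgeVar_eq hθ hl, edgeVar_eq (θ := fun t => θ (unitInterval.symm t)) (by fun_prop)
    fun t => by rw [edgePt_swap]; exact hl _]
  simp

theorem edgeVar_comp {j : (Fin n → ℝ) → Circle} {e : Fin n × Fin n}
    (h : Continuous fun t => j (edgePt e t)) {g : Circle → Circle} {k : Circle → ℝ} {d : ℤ}
    (hk : Continuous k) (hg : ∀ u, g u = u ^ d * Circle.exp (k u)) :
    edgeVar (fun x => g (j x)) e =
      d * edgeVar j e + (k (j (Pi.single e.2 1)) - k (j (Pi.single e.1 1))) := by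
  obtain ⟨θ, hθ, hl⟩ := exists_circle_lift_unitInterval ⟨_, h⟩
  have hkj : Continuous fun t => k (j (edgePt e t)) := hk.comp h
  rw [edgeVar_eq hθ hl, edgeVar_eq (θ := fun t => d * θ t + k (j (edgePt e t))) ((hθ.const_mul _).add hkj)
    fun t => by
      have : j (edgePt e t) = Circle.exp (θ t) := hl t
      simp only [hg, Circle.exp_add, Circle.exp_intCast_mul, this]]
  rw [edgePt_zero, edgePt_one]
  ring

theorem sum_triEdges {t : Fin n × Fin n × Fin n} (ht : (triVerts t).card = 3) (k : Fin n → ℝ) :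
    ∑ e ∈ triEdges t, (k e.2 - k e.1) = 0 := by
  obtain ⟨a, b, c⟩ := t
  have hab : a ≠ b := by
    rintro rfl
    have := Finset.card_le_two (a := a) (b := c)
    simp [triVerts] at ht
    omega
  have hbc : b ≠ c := by
    rintro rfl
    have := Finset.card_le_two (a := a) (b := b)
    simp [triVerts] at ht
    omega
  have hac : a ≠ c := by
    rintro rfl
    have := Finset.card_le_two (a := b) (b := a)
    simp [triVerts] at ht
    omega
  rw [triEdges, Finset.sum_insert, Finset.sum_insert, Finset.sum_singleton]
  · ring
  · simp [hbc]
  · simp [hab, hac]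

theorem ne_of_mem_triEdges {t : Fin n × Fin n × Fin n} (ht : (triVerts t).card = 3)
    {e : Fin n × Fin n} (he : e ∈ triEdges t) : e.1 ≠ e.2 := by
  intro h
  have h2 : ∀ a b : Fin n, ({a, b} : Finset (Fin n)).card ≤ 2 := fun a b => Finset.card_le_two
  obtain ⟨a, b, c⟩ := t
  simp only [triEdges, Finset.mem_insert, Finset.mem_singleton] at he
  simp only [triVerts] at ht
  rcases he with rfl | rfl | rfl
  · simp only at h
    subst h
    have := h2 a c
    simp at ht
    omega
  · simp only at h
    subst h
    have := h2 a b
    simp at ht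
    omega
  · simp only at h
    subst h
    have := h2 b c
    simp at ht
    omega

theorem mem_triVerts_of_mem_triEdges {t : Fin n × Fin n × Fin n}
    {e : Fin n × Fin n} (he : e ∈ triEdges t) : e.1 ∈ triVerts t ∧ e.2 ∈ triVerts t := by
  simp only [triEdges, Finset.mem_insert, Finset.mem_singleton] at he
  rcases he with rfl | rfl | rfl <;> simp [triVerts]

namespace OrientedTriangulation

variable (T : OrientedTriangulation)

/-- The directed edges in the boundary of a triangulated surface. -/
def boundaryEdges : Finset (Fin T.n × Fin T.n) :=
  (T.tri.biUnion triEdges).filter fun e => e.swap ∉ T.tri.biUnion triEdges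

/-- A cocycle on the triangulation sums to zero over the boundary. -/
theorem sum_boundaryEdges_eq_zero {c : Fin T.n × Fin T.n → ℝ}
    (hanti : ∀ e ∈ T.tri.biUnion triEdges, c e.swap = - c e)
    (htri : ∀ t ∈ T.tri, ∑ e ∈ triEdges t, c e = 0) : ∑ e ∈ T.boundaryEdges, c e = 0 := by
  have h1 : ∑ e ∈ T.tri.biUnion triEdges, c e = 0 := by
    rw [Finset.sum_biUnion]
    · exact Finset.sum_eq_zero htri
    · intro s hs t ht hst
      rw [Function.onFun, Finset.disjoint_left]
      exact fun e hes het => hst (T.edge_unique s hs t ht e hes het)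
  rw [← Finset.sum_filter_add_sum_filter_not _ (fun e => e.swap ∉ T.tri.biUnion triEdges)] at h1
  have h2 : ∑ e ∈ T.tri.biUnion triEdges with ¬ e.swap ∉ T.tri.biUnion triEdges, c e = 0 := by
    refine Finset.sum_involution (fun e _ => e.swap) ?_ ?_ ?_ ?_
    · intro e he
      rw [hanti e (Finset.mem_filter.1 he).1]
      ring
    · intro e he h0 hsw
      have := hanti e (Finset.mem_filter.1 he).1
      rw [hsw] at this
      exact h0 (by linarith)
    · intro e he
      rw [Finset.mem_filter, not_not] at he ⊢
      exact ⟨he.2, by simpa using he.1⟩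
    · intro e _
      simp
  rw [boundaryEdges]
  linarith

theorem isCompact_setOf_support (s : Finset (Fin T.n)) :
    IsCompact {x | x ∈ stdSimplex ℝ (Fin T.n) ∧ ∀ i, x i ≠ 0 → i ∈ s} := by
  have : {x : Fin T.n → ℝ | ∀ i, x i ≠ 0 → i ∈ s} = ⋂ i ∈ sᶜ, {x | x i = 0} := by
    ext x
    simp only [mem_ofPred_eq, mem_iInter, Finset.mem_compl]
    exact forall_congr' fun i => by tauto
  have hc : IsClosed {x : Fin T.n → ℝ | ∀ i, x i ≠ 0 → i ∈ s} := by
    rw [this]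
    exact isClosed_biInter fun i _ => isClosed_eq (continuous_apply i) continuous_const
  exact (isCompact_stdSimplex ℝ (Fin T.n)).inter_right hc

theorem isCompact_space : IsCompact T.space := by
  have : T.space = ⋃ t ∈ T.tri, {x | x ∈ stdSimplex ℝ (Fin T.n) ∧ ∀ i, x i ≠ 0 → i ∈ triVerts t} := by
    ext x
    simp only [space, mem_ofPred_eq, mem_iUnion]
    constructor
    · rintro ⟨hx, t, ht, h⟩; exact ⟨t, ht, hx, h⟩
    · rintro ⟨t, ht, hx, h⟩; exact ⟨hx, t, ht, h⟩
  rw [this]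
  exact T.tri.finite_toSet.isCompact_biUnion fun t _ => T.isCompact_setOf_support _

theorem edgePt_mem_space {e : Fin T.n × Fin T.n} (he : e ∈ T.tri.biUnion triEdges)
    (s : unitInterval) : edgePt e s ∈ T.space := by
  obtain ⟨t, ht, he⟩ := Finset.mem_biUnion.1 he
  refine ⟨edgePt_mem_stdSimplex e s, t, ht, fun i hi => ?_⟩
  have := mem_triVerts_of_mem_triEdges he
  rcases edgePt_support hi with rfl | rfl
  · exact this.1
  · exact this.2

theorem mem_boundarySpace {x : Fin T.n → ℝ} : x ∈ T.boundarySpace ↔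
    ∃ e ∈ T.boundaryEdges, ∃ t, x = edgePt e t := by
  constructor
  · rintro ⟨hx, e, ⟨t, ht, he⟩, hsw, hs⟩
    refine ⟨e, ?_, ?_⟩
    · rw [boundaryEdges, Finset.mem_filter, Finset.mem_biUnion, Finset.mem_biUnion]
      refine ⟨⟨t, ht, he⟩, ?_⟩
      rintro ⟨t', ht', he'⟩
      exact hsw t' ht' he'
    · obtain ⟨s, hs, -⟩ := eq_edgePt (ne_of_mem_triEdges (T.nondegenerate t ht) he) hx hs
      exact ⟨s, hs⟩
  · rintro ⟨e, he, s, rfl⟩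
    rw [boundaryEdges, Finset.mem_filter, Finset.mem_biUnion, Finset.mem_biUnion] at he
    refine ⟨edgePt_mem_stdSimplex e s, e, he.1, fun t ht h => he.2 ⟨t, ht, h⟩,
      fun i hi => edgePt_support hi⟩

theorem ne_of_mem_boundaryEdges {e : Fin T.n × Fin T.n} (he : e ∈ T.boundaryEdges) : e.1 ≠ e.2 := by
  obtain ⟨t, ht, he⟩ := Finset.mem_biUnion.1 (Finset.mem_filter.1 he).1
  exact ne_of_mem_triEdges (T.nondegenerate t ht) he

theorem boundarySpace_subset_space : T.boundarySpace ⊆ T.space := by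
  intro x hx
  obtain ⟨e, he, t, rfl⟩ := T.mem_boundarySpace.1 hx
  exact T.edgePt_mem_space (Finset.mem_filter.1 he).1 t

/-- The argument of a circle-valued map on a surface has no total variation along the boundary. -/
theorem sum_edgeVar_eq_zero {Φ : (Fin T.n → ℝ) → Circle} (hΦ : ContinuousOn Φ T.space) :
    ∑ e ∈ T.boundaryEdges, edgeVar Φ e = 0 := by
  refine T.sum_boundaryEdges_eq_zero (fun e he => ?_) fun t ht => ?_
  · exact edgeVar_swap (hΦ.comp_continuous (continuous_edgePt e) fun s => T.edgePt_mem_space he s)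
  · set S := {x | x ∈ stdSimplex ℝ (Fin T.n) ∧ ∀ i, x i ≠ 0 → i ∈ triVerts t} with hS
    have hconv : Convex ℝ S := by
      intro x hx y hy a b ha hb hab
      refine ⟨convex_stdSimplex ℝ _ hx.1 hy.1 ha hb hab, fun i hi => ?_⟩
      by_contra hc
      have h1 : x i = 0 := by
        by_contra h
        exact hc (hx.2 i h)
      have h2 : y i = 0 := by
        by_contra h
        exact hc (hy.2 i h)
      exact hi (by simp [h1, h2])
    have hedge : ∀ e ∈ triEdges t, ∀ s, edgePt e s ∈ S := fun e he s => by
      have := mem_triVerts_of_mem_triEdges he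
      refine ⟨edgePt_mem_stdSimplex e s, fun i hi => ?_⟩
      rcases edgePt_support hi with rfl | rfl
      · exact this.1
      · exact this.2
    have hne : S.Nonempty := ⟨edgePt (t.1, t.2.1) 0, hedge _ (by simp [triEdges]) 0⟩
    have hSs : S ⊆ T.space := fun x hx => ⟨hx.1, t, ht, hx.2⟩
    obtain ⟨θ, hθ, h⟩ := exists_lift_of_convex hconv hne (hΦ.mono hSs)
    rw [Finset.sum_congr rfl fun e he => edgeVar_eq (θ := fun s => θ (edgePt e s))
      (hθ.comp_continuous (continuous_edgePt e) (hedge e he)) fun s => h _ (hedge e he s)]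
    simp only [edgePt_zero, edgePt_one]
    exact sum_triEdges (T.nondegenerate t ht) fun i => θ (Pi.single i 1)

/-- The total variation along the boundary is proportional to the degree. -/
theorem sum_edgeVar_comp {j : (Fin T.n → ℝ) → Circle} (hj : ContinuousOn j T.boundarySpace)
    {g : Circle → Circle} (hg : Continuous g) :
    ∑ e ∈ T.boundaryEdges, edgeVar (fun x => g (j x)) e =
      deg g * ∑ e ∈ T.boundaryEdges, edgeVar j e := by
  obtain ⟨k, hk, he⟩ := exists_eq_zpow_mul_exp hg
  have h0 : ∑ e ∈ T.boundaryEdges, (k (j (Pi.single e.2 1)) - k (j (Pi.single e.1 1))) = 0 :=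
    T.sum_boundaryEdges_eq_zero (fun e _ => by simp) fun t ht =>
      sum_triEdges (T.nondegenerate t ht) fun i => k (j (Pi.single i 1))
  rw [Finset.sum_congr rfl fun e he' => edgeVar_comp (hj.comp_continuous (continuous_edgePt e)
    fun s => T.mem_boundarySpace.2 ⟨e, he', s, rfl⟩) hk he, Finset.sum_add_distrib, h0, add_zero,
    Finset.mul_sum]

/-- There is a map on the boundary whose argument varies by `2π` along one edge and is constant
on the others. -/
theorem exists_edgeVar_ne_zero (hne : T.boundarySpace.Nonempty) : ∃ Ψ : (Fin T.n → ℝ) → Circle,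
    ContinuousOn Ψ T.boundarySpace ∧ ∑ e ∈ T.boundaryEdges, edgeVar Ψ e ≠ 0 := by
  classical
  obtain ⟨x, hx⟩ := hne
  obtain ⟨e₀, he₀, -⟩ := T.mem_boundarySpace.1 hx
  let A : Set (Fin T.n → ℝ) := edgePt e₀ '' univ
  let Ψ : (Fin T.n → ℝ) → Circle := fun x =>
    if x ∈ A then Circle.exp (2 * Real.pi * x e₀.2) else 1
  have hA : IsClosed A := (isCompact_univ.image (continuous_edgePt e₀)).isClosed
  have hother : ∀ e ∈ T.boundaryEdges, e ≠ e₀ → ∀ s, Ψ (edgePt e s) = 1 := by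
    intro e he hee s
    simp only [Ψ]
    split_ifs with hmem
    · -- two boundary edges have at most a vertex in common
      obtain ⟨r, -, hr⟩ := hmem
      have hv : edgePt e s e₀.2 = 0 ∨ edgePt e s e₀.2 = 1 := by
        have hne := T.ne_of_mem_boundaryEdges he₀
        have h2 : edgePt e₀ r e₀.2 = r := by simp [edgePt, hne.symm]
        have h1 : edgePt e₀ r e₀.1 = 1 - r := by simp [edgePt, hne]
        by_contra hc
        push Not at hc
        rw [hr] at h1 h2
        have h3 := edgePt_support (e := e) (t := s) (i := e₀.2) hc.1
        have h4 := edgePt_support (e := e) (t := s) (i := e₀.1) (by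
          rw [h1]
          rw [h2] at hc
          exact sub_ne_zero.2 hc.2.symm)
        rcases h3 with h3 | h3 <;> rcases h4 with h4 | h4
        · exact hne (h4.trans h3.symm)
        · refine (Finset.mem_filter.1 he₀).2 ?_
          rw [show e₀.swap = e from Prod.ext h3 h4]
          exact (Finset.mem_filter.1 he).1
        · exact hee (Prod.ext h4.symm h3.symm)
        · exact hne (h4.trans h3.symm)
      rcases hv with hv | hv <;> rw [hv] <;> simp
    · rfl
  have hmain : ∀ s, Ψ (edgePt e₀ s) = Circle.exp (2 * Real.pi * s) := fun s => by
    simp only [Ψ]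
    rw [if_pos ⟨s, mem_univ _, rfl⟩]
    have := T.ne_of_mem_boundaryEdges he₀
    simp [edgePt, this.symm]
  refine ⟨Ψ, ?_, ?_⟩
  · have hB : IsClosed (⋃ e ∈ T.boundaryEdges.erase e₀, edgePt e '' univ) :=
      (T.boundaryEdges.erase e₀).finite_toSet.isClosed_biUnion fun e _ =>
        (isCompact_univ.image (continuous_edgePt e)).isClosed
    have hsub : T.boundarySpace ⊆ A ∪ ⋃ e ∈ T.boundaryEdges.erase e₀, edgePt e '' univ := by
      intro x hx
      obtain ⟨e, he, s, rfl⟩ := T.mem_boundarySpace.1 hx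
      by_cases h : e = e₀
      · subst h; exact Or.inl ⟨s, mem_univ _, rfl⟩
      · exact Or.inr (mem_biUnion (Finset.mem_erase.2 ⟨h, he⟩) ⟨s, mem_univ _, rfl⟩)
    refine ContinuousOn.mono (ContinuousOn.union_of_isClosed ?_ ?_ hA hB) hsub
    · refine ContinuousOn.congr (f := fun x => Circle.exp (2 * Real.pi * x e₀.2))
        (Circle.exp.continuous.comp (by fun_prop)).continuousOn fun x hx => ?_
      simp only [Ψ]
      rw [if_pos hx]
    · refine continuousOn_const (c := (1 : Circle)) |>.congr ?_
      intro x hx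
      obtain ⟨e, he, s, -, rfl⟩ := mem_iUnion₂.1 hx
      exact hother e (Finset.mem_of_mem_erase he) (Finset.ne_of_mem_erase he) s
  · rw [Finset.sum_eq_single_of_mem e₀ he₀ fun e he hee => by
      rw [edgeVar_eq (θ := fun _ => 0) continuous_const fun s => by
        rw [hother e he hee]; simp]
      ring,
      edgeVar_eq (θ := fun s => 2 * Real.pi * (s : ℝ)) (by fun_prop) hmain]
    simp

end OrientedTriangulation

/-- A loop which bounds a compact orientable surface has degree zero under all maps from the
surface to the circle. -/
theorem IsOrientableSurface.deg_eq_zero {F B : Set E4} (h : IsOrientableSurface F B)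
    {γ : Circle → E4} (hγ : Continuous γ) (hinj : Function.Injective γ) (hB : range γ = B)
    {φ : E4 → Circle} (hφ : ContinuousOn φ F) : deg (fun u => φ (γ u)) = 0 := by
  obtain ⟨T, ι, hι, hιinj, hF, hιB⟩ := h
  have hsub := T.boundarySpace_subset_space
  have hγB : ∀ u, γ u ∈ ι '' T.boundarySpace := fun u => by rw [hιB, ← hB]; exact mem_range_self u
  have hne : T.boundarySpace.Nonempty := by
    obtain ⟨x, hx, -⟩ := hγB 1
    exact ⟨x, hx⟩
  -- the inverses of `γ` and `ι`
  let j : (Fin T.n → ℝ) → Circle := fun x => Function.invFunOn γ univ (ι x)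
  have hjγ : ∀ x ∈ T.boundarySpace, γ (j x) = ι x := fun x hx => by
    have : ι x ∈ γ '' univ := by
      rw [image_univ, hB, ← hιB]; exact mem_image_of_mem _ hx
    exact Function.invFunOn_eq this
  have hj : ContinuousOn j T.boundarySpace :=
    (continuousOn_invFunOn isCompact_univ hγ.continuousOn hinj.injOn).comp (hι.mono hsub)
      fun x hx => by rw [image_univ, hB, ← hιB]; exact mem_image_of_mem _ hx
  let γ' : Circle → Fin T.n → ℝ := fun u => Function.invFunOn ι T.space (γ u)
  have hγ' : Continuous γ' :=
    (continuousOn_invFunOn T.isCompact_space hι hιinj).comp_continuous hγ fun u =>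
      image_mono hsub (hγB u)
  have hγ'B : ∀ u, γ' u ∈ T.boundarySpace := fun u => by
    obtain ⟨x, hx, hxu⟩ := hγB u
    simp only [γ', ← hxu]
    rwa [hιinj.leftInvOn_invFunOn (hsub hx)]
  have hιγ' : ∀ u, ι (γ' u) = γ u := fun u => Function.invFunOn_eq (image_mono hsub (hγB u))
  have hcomp : ∀ (Φ : (Fin T.n → ℝ) → Circle) (g : Circle → Circle),
      (∀ x ∈ T.boundarySpace, Φ x = g (j x)) → Continuous g →
      ∑ e ∈ T.boundaryEdges, edgeVar Φ e = deg g * ∑ e ∈ T.boundaryEdges, edgeVar j e := by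
    intro Φ g hΦ hg
    rw [← T.sum_edgeVar_comp hj hg]
    exact Finset.sum_congr rfl fun e he =>
      edgeVar_congr fun t => hΦ _ (T.mem_boundarySpace.2 ⟨e, he, t, rfl⟩)
  have hFsub : ∀ x ∈ T.space, ι x ∈ F := fun x hx => hF ▸ mem_image_of_mem _ hx
  have hφγ : Continuous fun u => φ (γ u) := hφ.comp_continuous hγ fun u => by
    rw [← hιγ']; exact hFsub _ (hsub (hγ'B u))
  have h1 := hcomp (fun x => φ (ι x)) (fun u => φ (γ u)) (fun x hx => by rw [hjγ x hx]) hφγ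
  rw [T.sum_edgeVar_eq_zero (Φ := fun x => φ (ι x)) (hφ.comp hι hFsub)] at h1
  obtain ⟨Ψ, hΨ, hΨ0⟩ := T.exists_edgeVar_ne_zero hne
  have h2 := hcomp Ψ (fun u => Ψ (γ' u)) (fun x hx => by
    have : γ' (j x) = x := by
      simp only [γ']
      rw [hjγ x hx, hιinj.leftInvOn_invFunOn (hsub hx)]
    rw [this]) (hΨ.comp_continuous hγ' hγ'B)
  -- some map has non-zero total variation, so the factor of proportionality does not vanish
  have h3 : ∑ e ∈ T.boundaryEdges, edgeVar j e ≠ 0 := fun h => hΨ0 (by rw [h2, h, mul_zero])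
  exact_mod_cast (mul_eq_zero.1 h1.symm).resolve_right h3

/-! ### Maps between boundary tori -/

namespace TubedKnot

variable (K : TubedKnot)

theorem boundary_subset_nbhd : K.boundary ⊆ K.nbhd :=
  image_mono (prod_mono Subset.rfl sphere_subset_closedBall)

theorem boundary_subset_range : K.boundary ⊆ range K.toFun := image_subset_range _ _

theorem boundary_subset_exterior : K.boundary ⊆ K.exterior := by
  rintro _ ⟨⟨u, v⟩, ⟨-, hv⟩, rfl⟩
  rw [toFun_mem_exterior]
  simp at hv
  exact hv.ge

theorem notMem_nbhd_of_mem_exterior {x : E4} (hx : x ∈ K.exterior) (hb : x ∉ K.boundary) :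
    x ∉ K.nbhd := by
  rintro ⟨⟨u, v⟩, ⟨-, hv⟩, rfl⟩
  rw [toFun_mem_exterior] at hx
  rw [toFun_mem_boundary] at hb
  simp at hv
  exact hb (le_antisymm hv hx)

/-- Every neighbourhood of a point of the boundary torus contains points on the same ray. -/
theorem eventually_ray {c : Circle} {v : ℂ} {U : Set E4}
    (hU : U ∈ nhdsWithin (K.toFun (c, v)) S3) : ∀ᶠ s : ℝ in nhds 1, K.toFun (c, s * v) ∈ U := by
  have h1 : Filter.Tendsto (fun s : ℝ => K.toFun (c, s * v)) (nhds 1)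
      (nhdsWithin (K.toFun (c, v)) S3) := by
    refine tendsto_nhdsWithin_iff.2 ⟨?_, Filter.Eventually.of_forall fun s => K.mem _⟩
    have : Continuous fun s : ℝ => K.toFun (c, s * v) := K.continuous_toFun.comp (by fun_prop)
    simpa using this.tendsto 1
  exact h1 hU

theorem exists_notMem_nbhd {x : E4} (hx : x ∈ K.boundary) {U : Set E4}
    (hU : U ∈ nhdsWithin x S3) : ∃ y ∈ U, y ∈ S3 ∧ y ∉ K.nbhd := by
  obtain ⟨⟨c, v⟩, ⟨-, hv⟩, rfl⟩ := hx
  simp at hv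
  have h1 := (K.eventually_ray hU).filter_mono (nhdsWithin_le_nhds (s := Ioi 1))
  obtain ⟨s, hs, hs1⟩ := (h1.and self_mem_nhdsWithin).exists
  refine ⟨_, hs, K.mem _, ?_⟩
  rw [toFun_mem_nbhd]
  have hs1' : (1 : ℝ) < s := hs1
  simp [hv, abs_of_pos (one_pos.trans hs1'), hs1']

theorem exists_notMem_exterior {x : E4} (hx : x ∈ K.boundary) {U : Set E4}
    (hU : U ∈ nhdsWithin x S3) : ∃ y ∈ U, y ∈ S3 ∧ y ∉ K.exterior := by
  obtain ⟨⟨c, v⟩, ⟨-, hv⟩, rfl⟩ := hx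
  simp at hv
  have h0 : ∀ᶠ s : ℝ in nhds 1, 0 < s := lt_mem_nhds one_pos
  have h1 := ((K.eventually_ray hU).and h0).filter_mono (nhdsWithin_le_nhds (s := Iio 1))
  obtain ⟨s, ⟨hs, hs0⟩, hs1⟩ := (h1.and self_mem_nhdsWithin).exists
  refine ⟨_, hs, K.mem _, ?_⟩
  rw [toFun_mem_exterior]
  have hs1' : s < (1 : ℝ) := hs1
  simp [hv, abs_of_pos hs0, hs1']

end TubedKnot

namespace IsOrientedDiffeo

variable {K₁ K₀ : TubedKnot} {f : OpenPartialHomeomorph E4 E4}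

theorem eventually_symm (hf : IsOrientedDiffeo f K₁.exterior K₀.nbhd) {x : E4}
    (hx : x ∈ K₁.exterior) {U : Set E4} (hU : U ∈ nhdsWithin x S3) :
    {y | y ∈ f.target ∧ f.symm y ∈ U} ∈ nhdsWithin (f x) S3 := by
  have hxs := hf.subset_source hx
  have ht : f.target ∈ nhdsWithin (f x) S3 :=
    mem_nhdsWithin_of_mem_nhds (f.open_target.mem_nhds (f.map_source hxs))
  have hc : ContinuousAt f.symm (f x) := f.continuousAt_symm (f.map_source hxs)
  have h1 : Filter.Tendsto f.symm (nhdsWithin (f x) S3) (nhdsWithin x S3) := by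
    refine tendsto_nhdsWithin_iff.2 ⟨?_, ?_⟩
    · have := hc.tendsto.mono_left (nhdsWithin_le_nhds (s := S3))
      rwa [f.left_inv hxs] at this
    · filter_upwards [ht, self_mem_nhdsWithin] with y hy hyS
      exact hf.symm_mapsTo_sphere ⟨hy, hyS⟩
  exact Filter.inter_mem ht (h1 hU)

theorem eventually_apply (hf : IsOrientedDiffeo f K₁.exterior K₀.nbhd) {x : E4}
    (hx : x ∈ K₁.exterior) {U : Set E4} (hU : U ∈ nhdsWithin (f x) S3) :
    {y | y ∈ f.source ∧ f y ∈ U} ∈ nhdsWithin x S3 := by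
  have hxs := hf.subset_source hx
  have ht : f.source ∈ nhdsWithin x S3 :=
    mem_nhdsWithin_of_mem_nhds (f.open_source.mem_nhds hxs)
  have h1 : Filter.Tendsto f (nhdsWithin x S3) (nhdsWithin (f x) S3) := by
    refine tendsto_nhdsWithin_iff.2
      ⟨(f.continuousAt hxs).tendsto.mono_left nhdsWithin_le_nhds, ?_⟩
    filter_upwards [ht, self_mem_nhdsWithin] with y hy hyS
    exact hf.mapsTo_sphere ⟨hy, hyS⟩
  exact Filter.inter_mem ht (h1 hU)

theorem apply_mem_nbhd (hf : IsOrientedDiffeo f K₁.exterior K₀.nbhd) {x : E4}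
    (hx : x ∈ K₁.exterior) : f x ∈ K₀.nbhd := hf.image_eq ▸ mem_image_of_mem f hx

theorem symm_mem_exterior (hf : IsOrientedDiffeo f K₁.exterior K₀.nbhd) {y : E4}
    (hy : y ∈ K₀.nbhd) : f.symm y ∈ K₁.exterior ∧ f (f.symm y) = y := by
  rw [← hf.image_eq] at hy
  obtain ⟨x, hx, rfl⟩ := hy
  rw [f.left_inv (hf.subset_source hx)]
  exact ⟨hx, rfl⟩

/-- Interior points of the exterior are mapped to interior points of the neighbourhood. -/
theorem apply_mem_interior (hf : IsOrientedDiffeo f K₁.exterior K₀.nbhd) {x : E4}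
    (hx : x ∈ K₁.exterior) (hb : x ∉ K₁.boundary) : f x ∈ K₀.toFun '' (univ ×ˢ ball 0 1) := by
  by_contra hc
  have hbd : f x ∈ K₀.boundary := by
    obtain ⟨c, ⟨-, hc1⟩, hcx⟩ := hf.apply_mem_nbhd hx
    rw [← hcx, TubedKnot.toFun_mem_boundary]
    refine le_antisymm (by simpa using hc1) (not_lt.1 fun h => hc ⟨c, ?_, hcx⟩)
    simpa using h
  have hU : K₁.nbhdᶜ ∈ nhdsWithin x S3 := mem_nhdsWithin_of_mem_nhds
    (K₁.isCompact_nbhd.isClosed.isOpen_compl.mem_nhds (K₁.notMem_nbhd_of_mem_exterior hx hb))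
  obtain ⟨y, ⟨hyt, hyU⟩, hyS, hyn⟩ := K₀.exists_notMem_nbhd hbd (hf.eventually_symm hx hU)
  have h1 : f.symm y ∈ K₁.exterior :=
    K₁.mem_exterior_of_notMem_nbhd (hf.symm_mapsTo_sphere ⟨hyt, hyS⟩) hyU
  have h2 := hf.apply_mem_nbhd h1
  rw [f.right_inv hyt] at h2
  exact hyn h2

/-- Boundary points are mapped to boundary points: near them there are points of the sphere outside
the exterior, while all points near an interior point of the neighbourhood come from it. -/
theorem apply_mem_boundary (hf : IsOrientedDiffeo f K₁.exterior K₀.nbhd) {x : E4}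
    (hx : x ∈ K₁.boundary) : f x ∈ K₀.boundary := by
  have hxe := K₁.boundary_subset_exterior hx
  obtain ⟨c, ⟨-, hc1⟩, hcx⟩ := hf.apply_mem_nbhd hxe
  rw [← hcx, TubedKnot.toFun_mem_boundary]
  refine le_antisymm (by simpa using hc1) (not_lt.1 fun h => ?_)
  have hU : K₀.toFun '' (univ ×ˢ ball 0 1) ∈ nhdsWithin (f x) S3 := by
    rw [← hcx]
    exact K₀.image_mem_nhdsWithin ((isOpen_univ.prod isOpen_ball).mem_nhds (by simpa using h))
  obtain ⟨y, ⟨hys, hyU⟩, hyS, hye⟩ := K₁.exists_notMem_exterior hx (hf.eventually_apply hxe hU)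
  have h1 : f y ∈ K₀.nbhd := image_mono (prod_mono Subset.rfl ball_subset_closedBall) hyU
  have h2 := (hf.symm_mem_exterior h1).1
  rw [f.left_inv hys] at h2
  exact hye h2

theorem symm_mem_boundary (hf : IsOrientedDiffeo f K₁.exterior K₀.nbhd) {y : E4}
    (hy : y ∈ K₀.boundary) : f.symm y ∈ K₁.boundary := by
  obtain ⟨h1, h2⟩ := hf.symm_mem_exterior (K₀.boundary_subset_nbhd hy)
  by_contra hc
  obtain ⟨c, ⟨-, hc1⟩, hcx⟩ := hf.apply_mem_interior h1 hc
  rw [h2] at hcx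
  rw [← hcx, TubedKnot.toFun_mem_boundary] at hy
  simp at hc1
  linarith

theorem continuousOn (hf : IsOrientedDiffeo f K₁.exterior K₀.nbhd) : ContinuousOn f K₁.exterior :=
  f.continuousOn.mono hf.subset_source

theorem continuousOn_symm (hf : IsOrientedDiffeo f K₁.exterior K₀.nbhd) :
    ContinuousOn f.symm K₀.nbhd := by
  refine f.continuousOn_symm.mono ?_
  rw [← hf.image_eq]
  rintro _ ⟨x, hx, rfl⟩
  exact f.map_source (hf.subset_source hx)

end IsOrientedDiffeo

/-- A map between the boundaries of two tubes, in the coordinates of the tubes. -/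
def torusMap (K K' : TubedKnot) (g : E4 → E4) (x : Circle × Circle) : Circle × Circle :=
  ((K'.coords (g (K.toFun (x.1, x.2)))).1, dir (K'.coords (g (K.toFun (x.1, x.2)))).2)

section torusMap

variable {K K' : TubedKnot} {g g' : E4 → E4}

theorem toFun_circle_mem_boundary (K : TubedKnot) (x : Circle × Circle) :
    K.toFun (x.1, (x.2 : ℂ)) ∈ K.boundary := K.toFun_mem_boundary.2 (Circle.norm_coe _)

theorem exists_toFun_circle_eq {x : E4} (hx : x ∈ K.boundary) :
    ∃ c : Circle × Circle, K.toFun (c.1, (c.2 : ℂ)) = x := by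
  obtain ⟨⟨u, v⟩, ⟨-, hv⟩, rfl⟩ := hx
  exact ⟨(u, ⟨v, hv⟩), rfl⟩

theorem toFun_coords_dir {x : E4} (hx : x ∈ K.boundary) :
    K.toFun ((K.coords x).1, (dir (K.coords x).2 : ℂ)) = x := by
  obtain ⟨c, rfl⟩ := exists_toFun_circle_eq hx
  rw [TubedKnot.coords_toFun, dir_coe]

theorem toFun_torusMap (hm : MapsTo g K.boundary K'.boundary) (x : Circle × Circle) :
    K'.toFun ((torusMap K K' g x).1, ((torusMap K K' g x).2 : ℂ)) = g (K.toFun (x.1, x.2)) :=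
  toFun_coords_dir (hm (toFun_circle_mem_boundary K x))

theorem continuous_torusMap (hm : MapsTo g K.boundary K'.boundary) (hg : ContinuousOn g K.boundary) :
    Continuous (torusMap K K' g) := by
  have hcoe := continuous_circle_coe
  have h1 : Continuous fun x : Circle × Circle => g (K.toFun (x.1, (x.2 : ℂ))) :=
    hg.comp_continuous (K.continuous_toFun.comp (by fun_prop)) (toFun_circle_mem_boundary K)
  have h2 : Continuous fun x : Circle × Circle => K'.coords (g (K.toFun (x.1, (x.2 : ℂ)))) :=
    K'.continuousOn_coords.comp_continuous h1 fun x =>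
      K'.boundary_subset_range (hm (toFun_circle_mem_boundary K x))
  refine h2.fst.prodMk (continuous_dir h2.snd fun x h0 => ?_)
  have h3 := hm (toFun_circle_mem_boundary K x)
  rw [← K'.toFun_coords (K'.boundary_subset_range h3), TubedKnot.toFun_mem_boundary, h0] at h3
  simp at h3

theorem torusMap_torusMap (hm : MapsTo g K.boundary K'.boundary)
    (h : ∀ x ∈ K.boundary, g' (g x) = x) (x : Circle × Circle) :
    torusMap K' K g' (torusMap K K' g x) = x := by
  conv_lhs => rw [torusMap]
  rw [toFun_torusMap hm, h _ (toFun_circle_mem_boundary K x), TubedKnot.coords_toFun, dir_coe]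

/-- A curve on the boundary is a pair of maps to the circle. -/
theorem deg_torusMap_comp (hm : MapsTo g K.boundary K'.boundary) (hg : ContinuousOn g K.boundary)
    {a b : Circle → Circle} (ha : Continuous a) (hb : Continuous b) :
    deg (fun u => (torusMap K K' g (a u, b u)).1) = deg (fun u => (torusMap K K' g (u, 1)).1) * deg a
      + deg (fun u => (torusMap K K' g (1, u)).1) * deg b ∧
    deg (fun u => (torusMap K K' g (a u, b u)).2) = deg (fun u => (torusMap K K' g (u, 1)).2) * deg a
      + deg (fun u => (torusMap K K' g (1, u)).2) * deg b :=
  ⟨deg_torus_comp (continuous_torusMap hm hg).fst ha hb,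
    deg_torus_comp (continuous_torusMap hm hg).snd ha hb⟩

/-- The matrices of a homeomorphism of boundary tori and its inverse are inverse to each other. -/
theorem torusMap_matrix_mul (hm : MapsTo g K.boundary K'.boundary) (hg : ContinuousOn g K.boundary)
    (hm' : MapsTo g' K'.boundary K.boundary) (hg' : ContinuousOn g' K'.boundary)
    (h : ∀ x ∈ K'.boundary, g (g' x) = x) :
    (!![deg (fun u => (torusMap K K' g (u, 1)).1), deg (fun u => (torusMap K K' g (1, u)).1);
        deg (fun u => (torusMap K K' g (u, 1)).2), deg (fun u => (torusMap K K' g (1, u)).2)]) *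
      !![deg (fun u => (torusMap K' K g' (u, 1)).1), deg (fun u => (torusMap K' K g' (1, u)).1);
        deg (fun u => (torusMap K' K g' (u, 1)).2), deg (fun u => (torusMap K' K g' (1, u)).2)] =
      1 := by
  have hT' := continuous_torusMap hm' hg'
  have e1 : Continuous fun u : Circle => torusMap K' K g' (u, 1) := hT'.comp (by fun_prop)
  have e2 : Continuous fun u : Circle => torusMap K' K g' (1, u) := hT'.comp (by fun_prop)
  have h1 := deg_torusMap_comp hm hg e1.fst e1.snd
  have h2 := deg_torusMap_comp hm hg e2.fst e2.snd
  simp only [Prod.mk.eta, torusMap_torusMap hm' h, deg_id, deg_const] at h1 h2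
  rw [Matrix.mul_fin_two, ← h1.1, ← h1.2, ← h2.1, ← h2.2, Matrix.one_fin_two]

end torusMap

/-! ### The orientation of the gluing map -/

/-- An injective perturbation of a linear isomorphism of the plane has the same orientation. -/
theorem sign_detC_eq {M L : ℂ →L[ℝ] ℂ} {k : ℂ → ℂ} (hk : Continuous k) {R : ℝ}
    (hb : ∀ z, ‖k z‖ ≤ R) (hM : detC M ≠ 0) (hinj : ∀ z, M z + k z = k 0 → z = 0)
    (hL : HasFDerivAt (fun z => M z + k z) L 0) (hL0 : detC L ≠ 0) :
    SignType.sign (detC L) = SignType.sign (detC M) := by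
  have hcoe := continuous_circle_coe
  let F : ℂ → ℂ := fun z => M z + k z - k 0
  have hF : Continuous F := by fun_prop
  have hF0 : ∀ (r : ℝ), 0 < r → ∀ v : Circle, F (r * v) ≠ 0 := fun r hr v h => by
    have := hinj _ (sub_eq_zero.1 h)
    simp [hr.ne'] at this
  obtain ⟨ε, hε, h⟩ := deg_dir_small_circle (F := F) (z₀ := 0) (hL.sub_const (k 0)) (by simp [F]) hL0
  have h1 := h (ε / 2) ⟨half_pos hε, half_lt_self hε⟩ hF.continuousOn
  simp only [zero_add] at h1
  obtain ⟨c, hc, hcM⟩ := exists_pos_mul_le_norm hM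
  have hR : 0 ≤ R := (norm_nonneg _).trans (hb 0)
  set r : ℝ := (2 * R + 1) / c with hr
  have hr0 : 0 < r := by positivity
  have h2 := deg_eq_of_homotopy (S := Ioi (0 : ℝ)) (H := fun r v => dir (F (r * v)))
    isPreconnected_Ioi (continuousOn_dir_comp (Continuous.continuousOn (by fun_prop))
      fun x hx => hF0 x.1 hx.1 x.2) (y := ε / 2) (y' := r) (half_pos hε) hr0
  have h3 := deg_eq_of_homotopy (S := Icc (0 : ℝ) 1)
    (H := fun t v => dir (M (r * v) + t * (k (r * v) - k 0))) isPreconnected_Icc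
    (by
      refine continuousOn_dir_comp (Continuous.continuousOn (by fun_prop)) ?_
      rintro ⟨t, v⟩ ⟨ht, -⟩ h0
      have h4 := congrArg norm (eq_neg_of_add_eq_zero_left h0)
      rw [norm_neg, norm_mul, Complex.norm_real, Real.norm_of_nonneg ht.1] at h4
      have h5 := hcM (r * v)
      rw [norm_mul, Complex.norm_real, Real.norm_of_nonneg hr0.le, Circle.norm_coe, mul_one, hr,
        mul_div_cancel₀ _ hc.ne', ← hr] at h5
      have h6 : ‖k (r * v) - k 0‖ ≤ 2 * R :=
        (norm_sub_le _ _).trans (by linarith [hb (r * v), hb 0])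
      nlinarith [ht.1, ht.2, norm_nonneg (k (r * v) - k 0)])
    (y := 1) (y' := 0) (by simp) (by simp)
  simp only [Complex.ofReal_one, one_mul, Complex.ofReal_zero, zero_mul, add_zero] at h3
  have h4 : deg (fun v => dir (M (r * v))) = (SignType.sign (detC M) : ℤ) := by
    rw [← deg_dir_linear M hM]
    congr 1
    funext v
    have : M (r * v) = r * M v := by
      have := M.map_smul r (v : ℂ)
      simpa using this
    rw [this, dir_ofReal_mul hr0]
    intro h0
    exact Circle.coe_ne_zero v (injective_of_detC_ne_zero hM (h0.trans (map_zero M).symm))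
  have h5 : (fun v : Circle => dir (F (r * v))) = fun v : Circle => dir (M (r * v) + (k (r * v) - k 0)) :=
    funext fun v => by simp only [F, add_sub_assoc]
  have h6 : ((SignType.sign (detC L) : SignType) : ℤ) = (SignType.sign (detC M) : SignType) := by
    rw [← h1, h2, h5, h3, h4]
  revert h6
  generalize SignType.sign (detC L) = a
  generalize SignType.sign (detC M) = b
  revert a b
  decide

theorem differentiableAt_of_exp {E : Type*} [NormedAddCommGroup E] [NormedSpace ℝ E] {θ : E → ℝ}
    {x₀ : E} (hθ : ContinuousAt θ x₀)
    (h : DifferentiableAt ℝ (fun x => (Circle.exp (θ x) : ℂ)) x₀) : DifferentiableAt ℝ θ x₀ := by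
  have h1 : DifferentiableAt ℝ (fun x => (Circle.exp (θ x) : ℂ) / Circle.exp (θ x₀)) x₀ := by
    simp only [div_eq_mul_inv]
    exact h.mul_const _
  have h2 : DifferentiableAt ℝ (fun x => Complex.log ((Circle.exp (θ x) : ℂ) / Circle.exp (θ x₀))) x₀ :=
    DifferentiableAt.comp x₀ (g := Complex.log) ((Complex.differentiableAt_log (by
      rw [div_self (Circle.coe_ne_zero _)]; exact Complex.one_mem_slitPlane)).restrictScalars ℝ) h1
  have h3 : DifferentiableAt ℝ (fun x => θ x₀ +
      (Complex.log ((Circle.exp (θ x) : ℂ) / Circle.exp (θ x₀))).im) x₀ :=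
    (Complex.imCLM.differentiableAt.comp x₀ h2).const_add _
  refine h3.congr_of_eventuallyEq ?_
  have h4 : ContinuousAt (fun x => |θ x - θ x₀|) x₀ := by fun_prop
  filter_upwards [h4.eventually (gt_mem_nhds
    (show |θ x₀ - θ x₀| < Real.pi by simpa using Real.pi_pos))] with x hx
  rw [abs_lt] at hx
  rw [← Circle.coe_div, ← Circle.exp_sub, Circle.coe_exp, Complex.log_exp (by simpa using hx.1)
    (by simpa using hx.2.le)]
  simp

namespace IsOrientedDiffeo

variable {K₁ K₀ : TubedKnot} {f : OpenPartialHomeomorph E4 E4}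

theorem differentiableAt (hf : IsOrientedDiffeo f K₁.exterior K₀.nbhd) {x : E4}
    (hx : x ∈ K₁.exterior) : DifferentiableAt ℝ f x :=
  (hf.smooth.contDiffAt (f.open_source.mem_nhds (hf.subset_source hx))).differentiableAt (by simp)

/-- At a boundary point, the outward normal of the tube of `K₁` is mapped to a vector pointing into
the tube of `K₀`. -/
theorem exists_inward (hf : IsOrientedDiffeo f K₁.exterior K₀.nbhd) {s₀ : ℝ} {w : ℂ}
    (hw : ‖w‖ = 1) (h0 : K₀.lift (s₀, w) = f (K₁.lift (0, 1))) : ∃ a : ℝ, ∃ β : ℂ, inner ℝ w β ≤ 0 ∧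
      fderiv ℝ f (K₁.lift (0, 1)) (fderiv ℝ K₁.lift (0, 1) (0, 1)) =
        fderiv ℝ K₀.lift (s₀, w) (a, β) := by
  set x₀ := K₁.lift (0, 1) with hx₀
  have hx₀e : x₀ ∈ K₁.exterior := K₁.toFun_mem_exterior.2 (by simp)
  obtain ⟨Θ, hΘ0, hΘd, hΘ⟩ := K₀.exists_local_coords (s₀, w)
  rw [h0] at hΘ0 hΘd hΘ
  have hray : HasDerivAt (fun ρ : ℝ => ((0, 1 + ρ) : ℝ × ℂ)) (0, 1) 0 :=
    (hasDerivAt_const (0 : ℝ) (0 : ℝ)).prodMk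
      ((Complex.ofRealCLM.hasDerivAt (x := (0 : ℝ))).const_add 1)
  have hK : HasDerivAt (fun ρ : ℝ => K₁.lift (0, 1 + ρ)) (fderiv ℝ K₁.lift (0, 1) (0, 1)) 0 := by
    refine HasFDerivAt.comp_hasDerivAt (l := K₁.lift) (0 : ℝ) ?_ hray
    simpa using (K₁.differentiable_lift (0, 1)).hasFDerivAt
  have hfK : HasDerivAt (fun ρ : ℝ => f (K₁.lift (0, 1 + ρ)))
      (fderiv ℝ f x₀ (fderiv ℝ K₁.lift (0, 1) (0, 1))) 0 := by
    refine HasFDerivAt.comp_hasDerivAt (l := f) (0 : ℝ) ?_ hK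
    simpa [← hx₀] using (hf.differentiableAt hx₀e).hasFDerivAt
  let Y : ℝ → ℝ × ℂ := fun ρ => Θ (f (K₁.lift (0, 1 + ρ)))
  have hY0 : Y 0 = (s₀, w) := by simp [Y, ← hx₀, hΘ0]
  have hYd : DifferentiableAt ℝ Y 0 := by
    refine DifferentiableAt.comp (g := Θ) (0 : ℝ) ?_ hfK.differentiableAt
    simpa [← hx₀] using hΘd
  have hfc : ContinuousAt (fun ρ : ℝ => f (K₁.lift (0, 1 + ρ))) 0 := hfK.continuousAt
  have hKc : ContinuousAt (fun ρ : ℝ => K₁.lift (0, 1 + ρ)) 0 := hK.continuousAt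
  have hsrc : ∀ᶠ ρ : ℝ in nhds 0, K₁.lift (0, 1 + ρ) ∈ f.source := by
    refine hKc.eventually (f.open_source.mem_nhds ?_)
    simpa [← hx₀] using hf.subset_source hx₀e
  have hloc : ∀ᶠ ρ : ℝ in nhds 0, K₀.lift (Y ρ) = f (K₁.lift (0, 1 + ρ)) := by
    have h1 : ∀ᶠ ρ : ℝ in nhds 0, f (K₁.lift (0, 1 + ρ)) ∈ S3 →
        K₀.lift (Θ (f (K₁.lift (0, 1 + ρ)))) = f (K₁.lift (0, 1 + ρ)) := by
      refine hfc.eventually (p := fun x => x ∈ S3 → K₀.lift (Θ x) = x) ?_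
      simpa [← hx₀] using hΘ
    filter_upwards [h1, hsrc] with ρ hρ hρs
    exact hρ (hf.mapsTo_sphere ⟨hρs, K₁.lift_mem _⟩)
  refine ⟨(deriv Y 0).1, (deriv Y 0).2, ?_, ?_⟩
  · -- the distance to the core of `K₀` is maximal on the boundary
    have hsnd : HasDerivAt (fun ρ => (Y ρ).2) (deriv Y 0).2 0 :=
      HasFDerivAt.comp_hasDerivAt (l := Prod.snd) (l' := ContinuousLinearMap.snd ℝ ℝ ℂ) (0 : ℝ)
        hasFDerivAt_snd hYd.hasDerivAt
    have hn := hsnd.norm_sq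
    rw [hY0] at hn
    have hslope := hn.tendsto_slope_zero_right
    have h2 : ∀ᶠ ρ : ℝ in nhdsWithin 0 (Ioi 0),
        ρ⁻¹ • (‖(Y (0 + ρ)).2‖ ^ 2 - ‖(Y 0).2‖ ^ 2) ≤ 0 := by
      filter_upwards [hloc.filter_mono nhdsWithin_le_nhds, self_mem_nhdsWithin] with ρ hρ hρ0
      have hρ0' : (0 : ℝ) < ρ := hρ0
      have hmem : K₁.lift (0, 1 + ρ) ∈ K₁.exterior := by
        refine K₁.toFun_mem_exterior.2 ?_
        have : ((1 : ℂ) + ρ) = ((1 + ρ : ℝ) : ℂ) := by push_cast; ring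
        simp only [this, Complex.norm_real, Real.norm_eq_abs]
        rw [abs_of_pos (by linarith)]
        linarith
      have h3 := hf.apply_mem_nbhd hmem
      rw [← hρ] at h3
      have h4 : ‖(Y ρ).2‖ ≤ 1 := K₀.toFun_mem_nbhd.1 h3
      rw [zero_add, hY0, hw, smul_eq_mul]
      refine mul_nonpos_of_nonneg_of_nonpos (by positivity) ?_
      nlinarith [norm_nonneg (Y ρ).2]
    have h3 := le_of_tendsto hslope h2
    simp only at h3
    linarith
  · rw [Prod.mk.eta]
    have h1 : HasFDerivAt K₀.lift (fderiv ℝ K₀.lift (s₀, w)) (Y 0) := by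
      rw [hY0]; exact (K₀.differentiable_lift _).hasFDerivAt
    have h2 := h1.comp_hasDerivAt (0 : ℝ) hYd.hasDerivAt
    exact hfK.unique (h2.congr_of_eventuallyEq (hloc.mono fun ρ hρ => hρ.symm))

/-- The gluing map reverses the orientation of the boundary tori, because it preserves the
orientation of the sphere and exchanges the two sides. -/
theorem det_torusMap_neg (hf : IsOrientedDiffeo f K₁.exterior K₀.nbhd) {A B C D : ℤ}
    (hA : deg (fun u => (torusMap K₁ K₀ f (u, 1)).1) = A)
    (hB : deg (fun u => (torusMap K₁ K₀ f (1, u)).1) = B)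
    (hC : deg (fun u => (torusMap K₁ K₀ f (u, 1)).2) = C)
    (hD : deg (fun u => (torusMap K₁ K₀ f (1, u)).2) = D)
    (hdet : A * D - B * C ≠ 0) : A * D - B * C < 0 := by
  have hm : MapsTo f K₁.boundary K₀.boundary := fun x hx => hf.apply_mem_boundary hx
  have hg : ContinuousOn f K₁.boundary := hf.continuousOn.mono K₁.boundary_subset_exterior
  have hT := continuous_torusMap hm hg
  obtain ⟨k₁, hk₁, e₁⟩ := exists_torus_eq hT.fst
  obtain ⟨k₂, hk₂, e₂⟩ := exists_torus_eq hT.snd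
  rw [hA, hB] at e₁
  rw [hC, hD] at e₂
  -- the lift of the gluing map to the plane
  let E : ℂ → Circle × Circle := fun z => (Circle.exp z.re, Circle.exp z.im)
  have hE : Continuous E := (Circle.exp.continuous.comp Complex.continuous_re).prodMk
    (Circle.exp.continuous.comp Complex.continuous_im)
  let Φ₁ : ℂ → ℝ := fun z => A * z.re + B * z.im + k₁ (E z)
  let Φ₂ : ℂ → ℝ := fun z => C * z.re + D * z.im + k₂ (E z)
  have hΦ₁ : Continuous Φ₁ := by
    have := hk₁.comp hE
    fun_prop
  have hΦ₂ : Continuous Φ₂ := by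
    have := hk₂.comp hE
    fun_prop
  have hTE₁ : ∀ z, (torusMap K₁ K₀ f (E z)).1 = Circle.exp (Φ₁ z) := fun z => by
    rw [e₁]
    simp only [E, Φ₁, Circle.exp_add, Circle.exp_intCast_mul]
  have hTE₂ : ∀ z, (torusMap K₁ K₀ f (E z)).2 = Circle.exp (Φ₂ z) := fun z => by
    rw [e₂]
    simp only [E, Φ₂, Circle.exp_add, Circle.exp_intCast_mul]
  let y : ℂ → ℝ × ℂ := fun z => (Φ₁ z, Circle.exp (Φ₂ z))
  let x : ℂ → ℝ × ℂ := fun z => (z.re, Circle.exp z.im)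
  have hy : Continuous y :=
    hΦ₁.prodMk (continuous_circle_coe.comp (Circle.exp.continuous.comp hΦ₂))
  have hyx : ∀ z, K₀.lift (y z) = f (K₁.lift (x z)) := fun z => by
    have := toFun_torusMap hm (E z)
    rw [hTE₁, hTE₂] at this
    exact this
  set x₀ := K₁.lift (0, 1) with hx₀
  have hx0 : x 0 = (0, 1) := by simp [x]
  have hx₀e : x₀ ∈ K₁.exterior := K₁.toFun_mem_exterior.2 (by simp)
  have hexp : ∀ {θ : ℂ → ℝ} {θ' : ℂ →L[ℝ] ℝ}, HasFDerivAt θ θ' 0 →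
      HasFDerivAt (fun z => (Circle.exp (θ z) : ℂ))
        (θ'.smulRight (Complex.I * Circle.exp (θ 0))) 0 := by
    intro θ θ' h
    have h1 : HasFDerivAt (fun z => Complex.exp ((Complex.ofRealCLM (θ z)) * Complex.I)) _ 0 :=
      ((Complex.ofRealCLM.hasFDerivAt.comp (0 : ℂ) h).mul_const Complex.I).cexp
    refine (h1.congr_fderiv ?_).congr_of_eventuallyEq (Filter.Eventually.of_forall fun z => ?_)
    · ext <;> simp [Circle.coe_exp] <;> ring
    · simp [Circle.coe_exp]
  have hxd : HasFDerivAt x (Complex.reCLM.prod (Complex.imCLM.smulRight Complex.I)) 0 := by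
    have := hexp (θ := Complex.im) Complex.imCLM.hasFDerivAt
    refine (Complex.reCLM.hasFDerivAt.prodMk this).congr_fderiv ?_
    simp
  have hfx : HasFDerivAt (fun z => f (K₁.lift (x z))) ((fderiv ℝ f x₀).comp
      ((fderiv ℝ K₁.lift (0, 1)).comp (Complex.reCLM.prod (Complex.imCLM.smulRight Complex.I)))) 0 := by
    have h1 : HasFDerivAt K₁.lift (fderiv ℝ K₁.lift (0, 1)) (x 0) := by
      rw [hx0]; exact (K₁.differentiable_lift _).hasFDerivAt
    have h2 := h1.comp (0 : ℂ) hxd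
    refine HasFDerivAt.comp (g := f) (0 : ℂ) ?_ h2
    rw [hx0]
    exact (hf.differentiableAt hx₀e).hasFDerivAt
  have hyd : DifferentiableAt ℝ y 0 := by
    refine K₀.differentiableAt_of_lift hy.continuousAt ?_
    simp only [hyx]
    exact hfx.differentiableAt
  have hd₁ : HasFDerivAt Φ₁ (fderiv ℝ Φ₁ 0) 0 := hyd.fst.hasFDerivAt
  have hd₂ : HasFDerivAt Φ₂ (fderiv ℝ Φ₂ 0) 0 :=
    (differentiableAt_of_exp hΦ₂.continuousAt hyd.snd).hasFDerivAt
  set L₁ := fderiv ℝ Φ₁ 0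
  set L₂ := fderiv ℝ Φ₂ 0
  set w := (Circle.exp (Φ₂ 0) : ℂ) with hw
  have hw1 : ‖w‖ = 1 := Circle.norm_coe _
  have hwsq : w.re * w.re + w.im * w.im = 1 := by
    rw [← Complex.normSq_apply, Complex.normSq_eq_norm_sq, hw1, one_pow]
  have hy0 : y 0 = (Φ₁ 0, w) := rfl
  -- the derivative of the gluing map in the frames of the two tubes
  have hchain : ∀ v : ℂ, fderiv ℝ f x₀ (fderiv ℝ K₁.lift (0, 1) (v.re, v.im * Complex.I)) =
      fderiv ℝ K₀.lift (Φ₁ 0, w) (L₁ v, L₂ v * (Complex.I * w)) := fun v => by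
    have h1 : HasFDerivAt K₀.lift (fderiv ℝ K₀.lift (Φ₁ 0, w)) (y 0) :=
      (K₀.differentiable_lift _).hasFDerivAt
    have h2 := h1.comp (0 : ℂ) (hd₁.prodMk (hexp hd₂))
    have h3 := hfx.unique (h2.congr_of_eventuallyEq (Filter.Eventually.of_forall fun z => (hyx z).symm))
    have h4 := DFunLike.congr_fun h3 v
    simpa [-Circle.coe_exp, ← hw, mul_comm] using h4
  set T₀ := fderiv ℝ K₀.lift (Φ₁ 0, w) (1, 0)
  set N₀ := fderiv ℝ K₀.lift (Φ₁ 0, w) (0, w) with hN₀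
  set R₀ := fderiv ℝ K₀.lift (Φ₁ 0, w) (0, Complex.I * w) with hR₀
  have hframe : 0 < det4 (f x₀) T₀ N₀ R₀ := by
    have h1 := K₀.lift_pos (Φ₁ 0, w)
    have h2 : K₀.lift (Φ₁ 0, w) = f x₀ := by rw [← hy0, hyx, hx0]
    rw [h2] at h1
    have h3 := det4_comb (f x₀) T₀ (fderiv ℝ K₀.lift (Φ₁ 0, w) (0, 1))
      (fderiv ℝ K₀.lift (Φ₁ 0, w) (0, Complex.I)) ![1, 0, 0] ![0, w.re, w.im] ![0, -w.im, w.re]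
    have h4 := K₀.fderiv_lift_apply (Φ₁ 0, w) 0 w
    have h5 := K₀.fderiv_lift_apply (Φ₁ 0, w) 0 (Complex.I * w)
    simp only [Complex.mul_re, Complex.mul_im, Complex.I_re, Complex.I_im, zero_mul, one_mul,
      zero_sub, zero_add] at h5
    rw [← hN₀] at h4
    rw [← hR₀] at h5
    simp only [Matrix.cons_val_zero, Matrix.cons_val_one, Matrix.cons_val] at h3
    rw [← h4, ← h5] at h3
    simp only [one_smul, zero_smul, add_zero] at h3
    rw [h3]
    refine mul_pos ?_ h1
    linarith
  have hcoord : ∀ (a n r : ℝ), fderiv ℝ K₀.lift (Φ₁ 0, w) (a, n * w + r * (Complex.I * w)) =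
      a • T₀ + n • N₀ + r • R₀ := fun a n r => by
    rw [← map_smul, ← map_smul, ← map_smul, ← map_add, ← map_add]
    congr 1
    ext <;> simp
  obtain ⟨a, β, hβ, hin⟩ := hf.exists_inward hw1 (s₀ := Φ₁ 0) (by rw [← hy0, hyx, hx0])
  set n : ℝ := β.re * w.re + β.im * w.im with hn
  have hn0 : n ≤ 0 := by
    rw [Complex.inner] at hβ
    simp at hβ
    linarith
  have hβe : β = n * w + ((β.im * w.re - β.re * w.im : ℝ) : ℂ) * (Complex.I * w) := by
    apply Complex.ext
    · simp [hn]
      linear_combination (-β.re) * hwsq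
    · simp [hn]
      linear_combination (-β.im) * hwsq
  set r : ℝ := β.im * w.re - β.re * w.im
  rw [hβe, hcoord] at hin
  have hc1 := hchain 1
  have hcI := hchain Complex.I
  have e1 : ∀ v : ℂ, fderiv ℝ K₀.lift (Φ₁ 0, w) (L₁ v, L₂ v * (Complex.I * w)) =
      L₁ v • T₀ + (0 : ℝ) • N₀ + L₂ v • R₀ := fun v => by
    rw [← hcoord]; simp
  rw [e1] at hc1 hcI
  simp only [Complex.one_re, Complex.one_im, Complex.I_re, Complex.I_im, Complex.ofReal_zero,
    Complex.ofReal_one, zero_mul, one_mul] at hc1 hcI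
  have hperp : ∀ v, inner ℝ x₀ (fderiv ℝ K₁.lift (0, 1) v) = 0 := fun v =>
    inner_fderiv_eq_zero (Filter.Eventually.of_forall fun z => K₁.lift_mem z)
      (K₁.differentiable_lift (0, 1)).hasFDerivAt v
  have hor := hf.oriented x₀ hx₀e _ _ _ (hperp (1, 0)) (hperp (0, 1)) (hperp (0, Complex.I))
    (K₁.lift_pos (0, 1))
  rw [hc1, hcI, hin] at hor
  have hcomb := det4_comb (f x₀) T₀ N₀ R₀ ![L₁ 1, 0, L₂ 1] ![a, n, r]
    ![L₁ Complex.I, 0, L₂ Complex.I]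
  simp only [Matrix.cons_val_zero, Matrix.cons_val_one, Matrix.cons_val] at hcomb
  rw [hcomb] at hor
  have hJ : L₁ 1 * L₂ Complex.I - L₂ 1 * L₁ Complex.I < 0 := by
    have h1 := (pos_iff_pos_of_mul_pos hor).2 hframe
    nlinarith
  -- compare with the linear part of the lift
  have hM : ∃ M : ℂ →L[ℝ] ℂ, (∀ z, M z = ⟨A * z.re + B * z.im, C * z.re + D * z.im⟩) := by
    refine ⟨Complex.equivRealProdCLM.symm.toContinuousLinearMap.comp
      (((A : ℝ) • Complex.reCLM + (B : ℝ) • Complex.imCLM).prod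
        ((C : ℝ) • Complex.reCLM + (D : ℝ) • Complex.imCLM)), fun z => ?_⟩
    apply Complex.ext <;> simp [Complex.equivRealProdCLM_symm_apply]
  obtain ⟨M, hM⟩ := hM
  have hMdet : detC M = ((A * D - B * C : ℤ) : ℝ) := by
    rw [detC, hM, hM]
    simp
    ring
  let k : ℂ → ℂ := fun z => ⟨k₁ (E z), k₂ (E z)⟩
  have hkc : Continuous fun c : Circle × Circle => (⟨k₁ c, k₂ c⟩ : ℂ) :=
    Complex.equivRealProdCLM.symm.continuous.comp (hk₁.prodMk hk₂)
  obtain ⟨R, hR⟩ := (isCompact_range hkc).isBounded.exists_norm_le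
  have hMk : ∀ z, M z + k z = ⟨Φ₁ z, Φ₂ z⟩ := fun z => by
    rw [hM]; rfl
  set L : ℂ →L[ℝ] ℂ := Complex.equivRealProdCLM.symm.toContinuousLinearMap.comp (L₁.prod L₂) with hL
  have hLd : HasFDerivAt (fun z => M z + k z) L 0 := by
    refine (Complex.equivRealProdCLM.symm.toContinuousLinearMap.hasFDerivAt.comp (0 : ℂ)
      (hd₁.prodMk hd₂)).congr_of_eventuallyEq (Filter.Eventually.of_forall fun z => ?_)
    simp only [hMk]
    apply Complex.ext <;> simp [Complex.equivRealProdCLM_symm_apply]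
  have hLdet : detC L = L₁ 1 * L₂ Complex.I - L₂ 1 * L₁ Complex.I := by
    simp [detC, hL, Complex.equivRealProdCLM_symm_apply]
  have hTinj : Function.Injective (torusMap K₁ K₀ f) := by
    refine Function.LeftInverse.injective (g := torusMap K₀ K₁ f.symm) fun c =>
      torusMap_torusMap hm (fun x hx => f.left_inv (hf.subset_source (K₁.boundary_subset_exterior hx))) c
  have hinj : ∀ z, M z + k z = k 0 → z = 0 := by
    intro z hz
    have h0 : k 0 = M 0 + k 0 := by rw [map_zero, zero_add]
    rw [h0, hMk, hMk] at hz
    have hz1 := congrArg Complex.re hz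
    have hz2 := congrArg Complex.im hz
    simp only at hz1 hz2
    have hEz : E z = E 0 := hTinj (Prod.ext (by rw [hTE₁, hTE₁, hz1]) (by rw [hTE₂, hTE₂, hz2]))
    have hMz : M z = 0 := by
      rw [hM]
      simp only [Φ₁, Φ₂, hEz, Complex.zero_re, Complex.zero_im, mul_zero, zero_add] at hz1 hz2
      apply Complex.ext <;> simp <;> linarith
    exact injective_of_detC_ne_zero (by rw [hMdet]; exact_mod_cast hdet) (hMz.trans (map_zero M).symm)
  have hsign := sign_detC_eq (M := M) (L := L) (k := k) (hkc.comp hE) (R := R)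
    (fun z => hR _ (mem_range_self (E z))) (by rw [hMdet]; exact_mod_cast hdet) hinj hLd
    (by rw [hLdet]; exact hJ.ne)
  rw [hLdet, sign_neg hJ, hMdet, eq_comm, sign_eq_neg_one_iff] at hsign
  exact_mod_cast hsign

end IsOrientedDiffeo

/-! ### Degrees on the exterior of a knot -/

namespace TubedKnot

variable {K : TubedKnot}

theorem continuousOn_comp_retract {ψ : E4 → Circle} (hψ : ContinuousOn ψ K.exterior) :
    ContinuousOn (fun x => ψ (K.retract x)) K.complement :=
  hψ.comp K.continuousOn_retract fun _ hx => K.retract_mem_exterior hx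

theorem longitude_mem_boundary (u : Circle) : K.longitude u ∈ K.boundary :=
  K.toFun_mem_boundary.2 (by simp)

theorem meridian_mem_boundary (u : Circle) : K.meridian u ∈ K.boundary :=
  K.toFun_mem_boundary.2 (Circle.norm_coe u)

/-- The preferred longitude has degree zero under all maps from the exterior to the circle. -/
theorem Preferred.deg_exterior_eq_zero (h : K.Preferred) {ψ : E4 → Circle}
    (hψ : ContinuousOn ψ K.exterior) : deg (fun u => ψ (K.longitude u)) = 0 := by
  have h1 := NullHomologous.deg_eq_zero h (continuousOn_comp_retract hψ)
  simpa only [K.retract_of_mem_exterior (K.boundary_subset_exterior (longitude_mem_boundary _))]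
    using h1

/-- On maps from the exterior of `K₁` to the circle, `K₂` has `lk` times the degree of the meridian
of `K₁`. -/
theorem deg_core_eq_lk_mul {K₁ K₂ : TubedKnot} {lk : ℤ} (hlk : IsLinkingNumber K₁ K₂ lk)
    (hK₂ : ∀ u, K₂.core u ∈ K₁.exterior) {ψ : E4 → Circle} (hψ : ContinuousOn ψ K₁.exterior) :
    deg (fun u => ψ (K₂.core u)) = lk * deg (fun v => ψ (K₁.meridian v)) := by
  have h1 := HomologyMultiple.deg_eq hlk (continuousOn_comp_retract hψ)
  simpa only [K₁.retract_of_mem_exterior (hK₂ _), K₁.retract_of_mem_exterior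
    (K₁.boundary_subset_exterior (meridian_mem_boundary _))] using h1

/-- A map to the circle on the complement of a knot which has degree zero on the meridian can be
changed inside the tube so that it extends over the knot. -/
theorem exists_extension {X : Set E4} (hX : IsClosed X) (hXS : X ⊆ S3) {δ : E4 → Circle}
    (hδ : ContinuousOn δ (X \ range K.core)) (hKX : K.nbhd ⊆ X)
    (h0 : deg (fun v => δ (K.meridian v)) = 0) :
    ∃ δ' : E4 → Circle, ContinuousOn δ' X ∧ (∀ x ∈ K.exterior, δ' x = δ x) ∧
      deg (fun u => δ' (K.core u)) = deg (fun u => δ (K.longitude u)) := by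
  classical
  have hcoe := continuous_circle_coe
  have hmem : ∀ c : Circle × Circle, K.toFun (c.1, (c.2 : ℂ)) ∈ X \ range K.core := fun c =>
    have hb := toFun_circle_mem_boundary K c
    ⟨hKX (K.boundary_subset_nbhd hb),
      (K.exterior_subset_complement (K.boundary_subset_exterior hb)).2⟩
  have hT : Continuous fun c : Circle × Circle => δ (K.toFun (c.1, (c.2 : ℂ))) :=
    hδ.comp_continuous (K.continuous_toFun.comp (by fun_prop)) hmem
  obtain ⟨k, hk, e⟩ := exists_torus_eq hT
  set d := deg (fun u => δ (K.longitude u)) with hd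
  have e' : ∀ c : Circle × Circle, δ (K.toFun (c.1, (c.2 : ℂ))) = c.1 ^ d * Circle.exp (k c) := by
    intro c
    have h1 := e c
    simp only [Circle.coe_one] at h1
    rw [h1, show deg (fun v : Circle => δ (K.toFun (1, (v : ℂ)))) = 0 from h0, zpow_zero, mul_one]
    rfl
  let G : Circle × ℂ → Circle := fun c => c.1 ^ d * Circle.exp (‖c.2‖ * k (c.1, dir c.2))
  have hG : Continuous G := (continuous_fst.zpow d).mul (Circle.exp.continuous.comp
    (continuous_radial hk))
  let δ' : E4 → Circle := fun x => if x ∈ K.nbhd then G (K.coords x) else δ x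
  have hin : ∀ x ∈ K.nbhd, δ' x = G (K.coords x) := fun x hx => if_pos hx
  have hout : ∀ x ∈ K.exterior, δ' x = δ x := by
    intro x hx
    by_cases hn : x ∈ K.nbhd
    · rw [hin x hn]
      obtain ⟨⟨u, z⟩, ⟨-, hz⟩, rfl⟩ := hn
      have hz1 : ‖z‖ = 1 := le_antisymm (by simpa using hz) (K.toFun_mem_exterior.1 hx)
      obtain ⟨v, rfl⟩ : ∃ v : Circle, (v : ℂ) = z := ⟨⟨z, mem_sphere_zero_iff_norm.2 hz1⟩, rfl⟩
      rw [e' (u, v), coords_toFun]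
      simp only [G, hz1, one_mul, dir_coe]
    · exact if_neg hn
  refine ⟨δ', ?_, hout, ?_⟩
  · have hcov : X ⊆ K.nbhd ∪ X ∩ K.exterior := fun x hx => by
      by_cases hn : x ∈ K.nbhd
      · exact Or.inl hn
      · exact Or.inr ⟨hx, K.mem_exterior_of_notMem_nbhd (hXS hx) hn⟩
    refine (ContinuousOn.union_of_isClosed ?_ ?_ K.isCompact_nbhd.isClosed
      (hX.inter K.isClosed_exterior)).mono hcov
    · exact (hG.comp_continuousOn (K.continuousOn_coords.mono K.nbhd_subset_range)).congr hin
    · refine (hδ.mono ?_).congr fun x hx => hout x hx.2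
      exact fun x hx => ⟨hx.1, (K.exterior_subset_complement hx.2).2⟩
  · have h1 : ∀ u, δ' (K.core u) = u ^ d := fun u => by
      rw [core, hin _ (K.toFun_mem_nbhd.2 (by simp)), coords_toFun]
      simp [G]
    rw [funext h1, deg_zpow continuous_id', deg_id, mul_one]

end TubedKnot

/-! ### The gluing matrix and the preferred longitude of the satellite -/

section gluing

variable {p q : ℤ} {K₀ K₁ : TubedKnot} {f : OpenPartialHomeomorph E4 E4}

/-- In the bases of preferred longitudes and meridians, `f` is given on the boundary torus by the
matrix `ε (0, 1; 1, pq)`, and its inverse by `ε (-pq, 1; 1, 0)`, where `ε = ± 1`. -/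
theorem exists_gluing_matrix (hp : p ≠ 0) (hq : q ≠ 0) (hpq : IsCoprime p q) (hK₁ : K₁.Preferred)
    (hK₀ : IsFiberedTorusKnot p q K₀) (hK₀' : K₀.Preferred)
    (hf : IsOrientedDiffeo f K₁.exterior K₀.nbhd) {m : Circle → E4} (hm : K₁.IsMeridian m) {x : E4}
    (hmx : ∀ u, f (m u) = seifertFiber p q x u) : ∃ ε : ℤ, ε * ε = 1 ∧
      deg (fun u => (torusMap K₁ K₀ f (1, u)).1) = ε ∧
      deg (fun u => (torusMap K₁ K₀ f (1, u)).2) = ε * (p * q) ∧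
      deg (fun u => (torusMap K₀ K₁ f.symm (u, 1)).1) = - ε * (p * q) ∧
      deg (fun u => (torusMap K₀ K₁ f.symm (u, 1)).2) = ε := by
  have hfb : MapsTo f K₁.boundary K₀.boundary := fun x hx => hf.apply_mem_boundary hx
  have hfc : ContinuousOn f K₁.boundary := hf.continuousOn.mono K₁.boundary_subset_exterior
  have hgb : MapsTo f.symm K₀.boundary K₁.boundary := fun x hx => hf.symm_mem_boundary hx
  have hgc : ContinuousOn f.symm K₀.boundary := hf.continuousOn_symm.mono K₀.boundary_subset_nbhd
  have hfg : ∀ y ∈ K₀.boundary, f (f.symm y) = y := fun y hy =>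
    (hf.symm_mem_exterior (K₀.boundary_subset_nbhd hy)).2
  -- the longitude of `K₁` bounds in the exterior, hence has winding number zero
  have hA : deg (fun u => (torusMap K₁ K₀ f (u, 1)).1) = 0 := by
    have h1 := hK₁.deg_exterior_eq_zero (ψ := fun x => (K₀.coords (f x)).1)
      (K₀.continuousOn_coords.comp hf.continuousOn fun x hx =>
        K₀.nbhd_subset_range (hf.apply_mem_nbhd hx)).fst
    rw [← h1]
    simp only [torusMap, Circle.coe_one]
    rfl
  -- the meridian goes to a fibre, of class `(1, pq)`
  obtain ⟨ε, hε, g, h, hg, hh, hmgh⟩ : ∃ ε : ℤ, ε * ε = 1 ∧ ∃ g h : Circle → Circle,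
      HasDegree g 0 ∧ HasDegree h ε ∧ ∀ u, m u = K₁.toFun (g u, (h u : ℂ)) := by
    rcases hm.2 with h | h
    · exact ⟨1, rfl, h⟩
    · exact ⟨-1, rfl, h⟩
  have hfib : ∀ u, seifertFiber p q x u ∈ K₀.boundary := fun u => by
    rw [← hmx, hmgh]
    exact hfb (toFun_circle_mem_boundary K₁ (g u, h u))
  have hdeg := hK₀.deg_fiber hp hq hpq hK₀' hfib
  have hcomp := deg_torusMap_comp hfb hfc hg.continuous hh.continuous
  have htm : ∀ u, torusMap K₁ K₀ f (g u, h u) = ((K₀.coords (seifertFiber p q x u)).1,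
      dir (K₀.coords (seifertFiber p q x u)).2) := fun u => by
    rw [torusMap, ← hmx, hmgh]
  simp only [htm, hdeg.1, hdeg.2, hg.deg_eq, hh.deg_eq, mul_zero, zero_add] at hcomp
  obtain ⟨h1, h2⟩ := hcomp
  have hB : deg (fun u => (torusMap K₁ K₀ f (1, u)).1) = ε := by
    linear_combination (-deg (fun u => (torusMap K₁ K₀ f (1, u)).1)) * hε - ε * h1
  have hD : deg (fun u => (torusMap K₁ K₀ f (1, u)).2) = ε * (p * q) := by
    linear_combination (-deg (fun u => (torusMap K₁ K₀ f (1, u)).2)) * hε - ε * h2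
  have hmul := torusMap_matrix_mul hfb hfc hgb hgc hfg
  rw [hA, hB, hD, Matrix.mul_fin_two, Matrix.one_fin_two] at hmul
  generalize hC : deg (fun u => (torusMap K₁ K₀ f (u, 1)).2) = C at hmul
  generalize deg (fun u => (torusMap K₀ K₁ f.symm (u, 1)).1) = A' at hmul ⊢
  generalize deg (fun u => (torusMap K₀ K₁ f.symm (1, u)).1) = B' at hmul
  generalize deg (fun u => (torusMap K₀ K₁ f.symm (u, 1)).2) = C' at hmul ⊢
  generalize deg (fun u => (torusMap K₀ K₁ f.symm (1, u)).2) = D' at hmul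
  have e00 := congrFun (congrFun hmul 0) 0
  have e01 := congrFun (congrFun hmul 0) 1
  have e10 := congrFun (congrFun hmul 1) 0
  have e11 := congrFun (congrFun hmul 1) 1
  simp at e00 e01 e10 e11
  have hε0 : ε ≠ 0 := by
    rintro rfl
    simp at hε
  have hD' : D' = 0 := e01.resolve_left hε0
  rw [hD', mul_zero, add_zero] at e11
  -- invertibility gives `C = ± 1`, and the reversal of the orientation of the torus gives `C = ε`
  have hCu : C = 1 ∨ C = -1 := Int.isUnit_iff.1 (IsUnit.of_mul_eq_one _ e11)
  have hεu : ε = 1 ∨ ε = -1 := Int.isUnit_iff.1 (IsUnit.of_mul_eq_one _ hε)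
  have hneg := hf.det_torusMap_neg hA hB hC hD (by
    rcases hCu with rfl | rfl <;> rcases hεu with rfl | rfl <;> simp)
  have hCε : C = ε := by
    rcases hCu with rfl | rfl <;> rcases hεu with rfl | rfl <;> simp at hneg <;> rfl
  subst hCε
  have hC' : C' = C := by linear_combination C * e00 - C' * hε
  subst hC'
  refine ⟨C', hε, hB, hD, ?_, rfl⟩
  linear_combination C' * e10 - A' * hε - C' * (p * q) * hε

/-- The preferred longitude of the satellite differs from the image of the preferred longitude of
`K₂` by `pq lk²` meridians. -/
theorem deg_longitude_satellite (hp : p ≠ 0) (hq : q ≠ 0) (hpq : IsCoprime p q) {K₂ : TubedKnot}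
    (hdisj : Disjoint K₁.nbhd K₂.nbhd) (hK₁ : K₁.Preferred) (hK₂ : K₂.Preferred) {lk : ℤ}
    (hlk : IsLinkingNumber K₁ K₂ lk)
    (hK₀ : IsFiberedTorusKnot p q K₀) (hK₀' : K₀.Preferred)
    (hf : IsOrientedDiffeo f K₁.exterior K₀.nbhd) {m : Circle → E4} (hm : K₁.IsMeridian m) {x : E4}
    (hmx : ∀ u, f (m u) = seifertFiber p q x u) {K : TubedKnot}
    (hK : ∀ (u : Circle) (w : ℂ), ‖w‖ ≤ 1 → K.toFun (u, w) = f (K₂.toFun (u, w)))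
    {φ : E4 → Circle} (hφ : ContinuousOn φ K.complement) (hφ1 : deg (fun v => φ (K.meridian v)) = 1) :
    deg (fun u => φ (K.longitude u)) = p * q * lk ^ 2 := by
  obtain ⟨ε, hε, hB, hD, -, -⟩ := exists_gluing_matrix hp hq hpq hK₁ hK₀ hK₀' hf hm hmx
  have hfb : MapsTo f K₁.boundary K₀.boundary := fun x hx => hf.apply_mem_boundary hx
  have hfc : ContinuousOn f K₁.boundary := hf.continuousOn.mono K₁.boundary_subset_exterior
  have hN₂S : K₂.nbhd ⊆ S3 := by
    rintro _ ⟨c, -, rfl⟩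
    exact K₂.mem c
  have hN₂ : K₂.nbhd ⊆ K₁.exterior := fun y hy =>
    K₁.mem_exterior_of_notMem_nbhd (hN₂S hy) (disjoint_right.1 hdisj hy)
  have hcore₂ : ∀ u, K₂.core u ∈ K₂.nbhd := fun u => K₂.toFun_mem_nbhd.2 (by simp)
  have hcoreK : ∀ u, K.core u = f (K₂.core u) := fun u => hK u 0 (by simp)
  have hcore : ∀ u, K.core u ∈ K₀.toFun '' (univ ×ˢ ball 0 1) := fun u => by
    rw [hcoreK]
    exact hf.apply_mem_interior (hN₂ (hcore₂ u)) fun h =>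
      disjoint_right.1 hdisj (hcore₂ u) (K₁.boundary_subset_nbhd h)
  have hψ : ContinuousOn (fun x => (K₀.coords (f x)).1) K₁.exterior :=
    (K₀.continuousOn_coords.comp hf.continuousOn fun x hx =>
      K₀.nbhd_subset_range (hf.apply_mem_nbhd hx)).fst
  -- the winding number of the satellite is `ε lk`
  have hw : deg (fun u => (K₀.coords (K.core u)).1) = lk * ε := by
    simp only [hcoreK]
    rw [TubedKnot.deg_core_eq_lk_mul hlk (fun u => hN₂ (hcore₂ u)) hψ, ← hB]
    rfl
  have hm₀ : deg (fun v => φ (K₀.meridian v)) = lk * ε := by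
    rw [TubedKnot.deg_meridian_eq_deg_core hφ hφ1 hcore, hw]
  have hE₀ : K₀.exterior ⊆ K.complement := by
    rintro y ⟨hyS, hy⟩
    refine ⟨hyS, ?_⟩
    rintro ⟨u, rfl⟩
    exact hy (hcore u)
  have hl₀ : deg (fun u => φ (K₀.longitude u)) = 0 := hK₀'.deg_exterior_eq_zero (hφ.mono hE₀)
  -- the meridian of `K₁` goes to `ε (l₀ + pq m₀)`, and `φ` is trivial on `l₀`
  have hm₁ : deg (fun v => φ (f (K₁.meridian v))) = p * q * lk := by
    have hT := continuous_torusMap hfb hfc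
    have hcoe := continuous_circle_coe
    have hφT : Continuous fun c : Circle × Circle => φ (K₀.toFun (c.1, (c.2 : ℂ))) :=
      hφ.comp_continuous (K₀.continuous_toFun.comp (by fun_prop)) fun c =>
        hE₀ (K₀.boundary_subset_exterior (toFun_circle_mem_boundary K₀ c))
    have hT1 : Continuous fun u : Circle => torusMap K₁ K₀ f (1, u) := hT.comp (by fun_prop)
    have h1 := deg_torus_comp hφT hT1.fst hT1.snd
    simp only [toFun_torusMap hfb, Circle.coe_one, hB, hD] at h1
    rw [show deg (fun u : Circle => φ (K₀.toFun (u, 1))) = 0 from hl₀,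
      show deg (fun u : Circle => φ (K₀.toFun (1, (u : ℂ)))) = lk * ε from hm₀] at h1
    refine Eq.trans h1 ?_
    linear_combination (lk * (p * q)) * hε
  -- the quotient of `φ ∘ f` by a map dual to `K₂` has degree zero on the meridian of `K₂`, so it
  -- extends over the tube, where the definition of the linking number applies to it
  obtain ⟨Φ, hΦ, hΦ1⟩ := K₂.exists_dual_map
  have hcompl : MapsTo f (K₁.exterior \ range K₂.core) K.complement := by
    rintro y ⟨hy, hyn⟩
    refine ⟨hf.mapsTo_sphere ⟨hf.subset_source hy, hf.subset_sphere hy⟩, ?_⟩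
    rintro ⟨u, hu⟩
    rw [hcoreK] at hu
    exact hyn ⟨u, f.injOn (hf.subset_source (hN₂ (hcore₂ u))) (hf.subset_source hy) hu⟩
  have hφf : ContinuousOn (fun y => φ (f y)) (K₁.exterior \ range K₂.core) :=
    hφ.comp (hf.continuousOn.mono sdiff_subset) hcompl
  have hΦ' : ContinuousOn Φ (K₁.exterior \ range K₂.core) :=
    hΦ.mono fun y hy => ⟨hy.1.1, hy.2⟩
  have hbd₂ : ∀ y ∈ K₂.boundary, y ∈ K₁.exterior \ range K₂.core := fun y hy =>
    ⟨hN₂ (K₂.boundary_subset_nbhd hy),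
      (K₂.exterior_subset_complement (K₂.boundary_subset_exterior hy)).2⟩
  have hmer₂ : Continuous K₂.meridian :=
    K₂.continuous_toFun.comp (continuous_const.prodMk continuous_circle_coe)
  have hlon₂ : Continuous K₂.longitude :=
    K₂.continuous_toFun.comp (continuous_id.prodMk continuous_const)
  have hmer₁ : Continuous K₁.meridian :=
    K₁.continuous_toFun.comp (continuous_const.prodMk continuous_circle_coe)
  have hmer₂m := fun v => hbd₂ _ (TubedKnot.meridian_mem_boundary (K := K₂) v)
  have hlon₂m := fun v => hbd₂ _ (TubedKnot.longitude_mem_boundary (K := K₂) v)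
  have hN₁ : ∀ y ∈ K₁.nbhd, y ∈ K₂.complement := by
    rintro y hy
    refine ⟨?_, ?_⟩
    · obtain ⟨c, -, rfl⟩ := hy
      exact K₁.mem c
    · rintro ⟨u, rfl⟩
      exact disjoint_right.1 hdisj (hcore₂ u) hy
  have hmer₁m : ∀ v, K₁.meridian v ∈ K₁.exterior \ range K₂.core := fun v =>
    have hb := TubedKnot.meridian_mem_boundary (K := K₁) v
    ⟨K₁.boundary_subset_exterior hb, (hN₁ _ (K₁.boundary_subset_nbhd hb)).2⟩
  have hδ : ∀ {γ : Circle → E4}, Continuous γ → (∀ v, γ v ∈ K₁.exterior \ range K₂.core) →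
      deg (fun v => φ (f (γ v)) * (Φ (γ v))⁻¹) = deg (fun v => φ (f (γ v))) - deg (fun v => Φ (γ v)) :=
    fun hγ hγm => deg_mul_inv (hφf.comp_continuous hγ hγm) (hΦ'.comp_continuous hγ hγm)
  have hKm : ∀ v, f (K₂.meridian v) = K.meridian v := fun v =>
    (hK 1 v (Circle.norm_coe v).le).symm
  have hKl : ∀ v, f (K₂.longitude v) = K.longitude v := fun v => (hK v 1 (by simp)).symm
  obtain ⟨δ, hδc, hδe, hδd⟩ := TubedKnot.exists_extension (K := K₂)
    (δ := fun y => φ (f y) * (Φ y)⁻¹) K₁.isClosed_exterior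
    sdiff_subset (hφf.mul hΦ'.inv) hN₂ (by
      rw [hδ hmer₂ hmer₂m]
      simp only [hKm, hφ1, hΦ1, sub_self])
  have hmer₁e : ∀ v, K₁.meridian v ∈ K₂.exterior := fun v =>
    K₂.mem_exterior_of_notMem_nbhd (K₁.mem _) (disjoint_left.1 hdisj
      (K₁.boundary_subset_nbhd (TubedKnot.meridian_mem_boundary v)))
  have hΦm₁ : deg (fun v => Φ (K₁.meridian v)) = 0 := by
    refine deg_eq_zero_of_disc (g := fun z => Φ (K₁.toFun (1, z))) (hΦ.comp
      (K₁.continuous_toFun.comp (by fun_prop)).continuousOn fun z hz => hN₁ _ ?_)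
    exact K₁.toFun_mem_nbhd.2 (by simpa using hz)
  have hΦl₂ : deg (fun v => Φ (K₂.longitude v)) = 0 := NullHomologous.deg_eq_zero hK₂ hΦ
  have h1 := TubedKnot.deg_core_eq_lk_mul hlk (fun u => hN₂ (hcore₂ u)) hδc
  simp only [hδe _ (hmer₁e _)] at h1
  rw [hδd, hδ hlon₂ hlon₂m, hδ hmer₁ hmer₁m, hΦl₂, hΦm₁, hm₁] at h1
  simp only [hKl, sub_zero] at h1
  rw [h1]
  ring

end gluing

/-- The components of a finite disjoint union of closed preconnected sets. -/
theorem connectedComponentIn_iUnion {X ι : Type*} [TopologicalSpace X] [Finite ι] {C : ι → Set X}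
    (hc : ∀ i, IsClosed (C i)) (hp : ∀ i, IsPreconnected (C i))
    (hd : Pairwise fun i j => Disjoint (C i) (C j)) {i : ι} {x : X} (hx : x ∈ C i) :
    connectedComponentIn (⋃ i, C i) x = C i := by
  refine Subset.antisymm ?_ ((hp i).subset_connectedComponentIn hx (subset_iUnion C i))
  have h1 : IsClosed (⋃ j : {j // j ≠ i}, C j) := isClosed_iUnion_of_finite fun j => hc j
  have hcov : connectedComponentIn (⋃ i, C i) x ⊆ C i ∪ ⋃ j : {j // j ≠ i}, C j := by
    intro y hy
    obtain ⟨j, hj⟩ := mem_iUnion.1 (connectedComponentIn_subset _ _ hy)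
    by_cases hji : j = i
    · subst hji; exact Or.inl hj
    · exact Or.inr (mem_iUnion.2 ⟨⟨j, hji⟩, hj⟩)
  have hdis : Disjoint (C i) (⋃ j : {j // j ≠ i}, C j) :=
    disjoint_iUnion_right.2 fun j => hd (fun h => j.2 h.symm)
  have hx' : x ∈ connectedComponentIn (⋃ i, C i) x :=
    mem_connectedComponentIn (mem_iUnion.2 ⟨i, hx⟩)
  rcases isPreconnected_iff_subset_of_disjoint_closed.1 isPreconnected_connectedComponentIn _ _
    (hc i) h1 hcov (by rw [hdis.inter_eq, inter_empty]) with h | h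
  · exact h
  · exact absurd (h hx') (disjoint_left.1 hdis hx)

/-! ### Boundary slopes -/

/-- The boundary of a Seifert surface is a preferred longitude: dual maps detect its class. -/
theorem IsSeifertSurface.class_eq {K : TubedKnot} {F : Set E4} (hF : IsSeifertSurface K F)
    {φ : E4 → Circle} (hφ : ContinuousOn φ K.complement)
    (hφ1 : deg (fun v => φ (K.meridian v)) = 1) :
    K.IsCurveOfClass (F ∩ K.boundary) 1 (-deg (fun u => φ (K.longitude u))) := by
  obtain ⟨hFK, -, hFs, b, γ, hγ, hγr, g, h, hg, hh, hgh⟩ := hF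
  have hcoe := continuous_circle_coe
  have hγe : γ = fun u => K.toFun (g u, (h u : ℂ)) := funext hgh
  have hγc : Continuous γ := by
    rw [hγe]
    exact K.continuous_toFun.comp (hg.continuous.prodMk (hcoe.comp hh.continuous))
  have h0 := hFs.deg_eq_zero hγc hγ hγr (hφ.mono (hFK.trans K.exterior_subset_complement))
  have h1 := K.deg_comp_toFun hφ hg.continuous (V := fun u => (h u : ℂ))
    (hcoe.comp hh.continuous) fun v => Circle.coe_ne_zero _
  have h2 : (fun u => φ (γ u)) = fun v => φ (K.toFun (g v, (h v : ℂ))) := by rw [hγe]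
  rw [h2, h1] at h0
  simp only [dir_coe, hφ1, one_mul, hg.deg_eq, mul_one] at h0
  rw [show deg (fun v => h v) = b from hh.deg_eq] at h0
  have hb : -deg (fun u => φ (K.longitude u)) = b := by linarith
  rw [hb]
  exact ⟨γ, hγ, hγr, g, h, hg, hh, hgh⟩

namespace TubedKnot

variable {K : TubedKnot}

theorem HasClass.continuous {γ : Circle → E4} {a b : ℤ} (h : K.HasClass γ a b) : Continuous γ := by
  obtain ⟨g, h, hg, hh, hgh⟩ := h
  have hcoe := continuous_circle_coe
  rw [funext hgh]
  exact K.continuous_toFun.comp (hg.continuous.prodMk (hcoe.comp hh.continuous))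

theorem IsCurveOfClass.isCompact {C : Set E4} {a b : ℤ} (h : K.IsCurveOfClass C a b) :
    IsCompact C := by
  obtain ⟨γ, -, rfl, h⟩ := h
  exact isCompact_range h.continuous

theorem IsCurveOfClass.isConnected {C : Set E4} {a b : ℤ} (h : K.IsCurveOfClass C a b) :
    IsConnected C := by
  obtain ⟨γ, -, rfl, h⟩ := h
  exact isConnected_range h.continuous

/-- A surface that meets the boundary torus in finitely many disjoint curves of class `(a, b)` has
boundary slope `b / a`. -/
theorem hasBoundarySlope_of_iUnion {F : Set E4} {n : ℕ} (hn : n ≠ 0) {C : Fin n → Set E4} {a b : ℤ}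
    (ha : a ≠ 0) (hC : ∀ i, K.IsCurveOfClass (C i) a b)
    (hd : Pairwise fun i j => Disjoint (C i) (C j)) (hFC : F ∩ K.boundary = ⋃ i, C i) :
    K.HasBoundarySlope F ((b : ℚ) / a) := by
  rw [HasBoundarySlope, hFC]
  constructor
  · obtain ⟨x, hx⟩ := (hC ⟨0, Nat.pos_of_ne_zero hn⟩).isConnected.nonempty
    exact ⟨x, mem_iUnion.2 ⟨_, hx⟩⟩
  · intro x hx
    obtain ⟨i, hi⟩ := mem_iUnion.1 hx
    rw [connectedComponentIn_iUnion (fun i => (hC i).isCompact.isClosed)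
      (fun i => (hC i).isConnected.isPreconnected) hd hi]
    exact ⟨a, b, ha, hC i, rfl⟩

/-- A homeomorphism of boundary tori acts on the classes of simple closed curves by its matrix. -/
theorem IsCurveOfClass.image {K' : TubedKnot} {g : E4 → E4} {C : Set E4} {a b : ℤ}
    (h : K.IsCurveOfClass C a b) (hm : MapsTo g K.boundary K'.boundary)
    (hg : ContinuousOn g K.boundary) (hi : InjOn g K.boundary) :
    K'.IsCurveOfClass (g '' C)
      (deg (fun u => (torusMap K K' g (u, 1)).1) * a +
        deg (fun u => (torusMap K K' g (1, u)).1) * b)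
      (deg (fun u => (torusMap K K' g (u, 1)).2) * a +
        deg (fun u => (torusMap K K' g (1, u)).2) * b) := by
  obtain ⟨γ, hγ, rfl, s, t, hs, ht, hst⟩ := h
  have hγb : ∀ u, γ u ∈ K.boundary := fun u => by
    rw [hst]
    exact toFun_circle_mem_boundary K (s u, t u)
  have hc := (continuous_torusMap hm hg).comp (hs.continuous.prodMk ht.continuous)
  have hd := deg_torusMap_comp hm hg hs.continuous ht.continuous
  rw [hs.deg_eq, ht.deg_eq] at hd
  refine ⟨fun u => g (γ u), fun u v huv => hγ (hi (hγb u) (hγb v) huv), range_comp g γ,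
    fun u => (torusMap K K' g (s u, t u)).1, fun u => (torusMap K K' g (s u, t u)).2, ?_, ?_, ?_⟩
  · rw [← hd.1]
    exact hasDegree_deg hc.fst
  · rw [← hd.2]
    exact hasDegree_deg hc.snd
  · intro u
    exact (congrArg g (hst u)).trans (toFun_torusMap hm (s u, t u)).symm

end TubedKnot

end Satellite

end
open Satellite in
theorem mainTheorem11
    -- the 2-bridge link `L_{β/α} = K₁ ∪ K₂`, with disjoint tubular neighbourhoods
    (α β : ℤ) (hα : 4 ≤ α) (hαeven : Even α) (hβ : 0 < β) (hβα : β < α) (hαβ : IsCoprime α β)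
    (K₁ K₂ : TubedKnot) (hL : IsTwoBridgeLink α β K₁ K₂) (hdisj : Disjoint K₁.nbhd K₂.nbhd)
    (hK₁ : K₁.Preferred) (hK₂ : K₂.Preferred)
    (lk : ℤ) (hlk : IsLinkingNumber K₁ K₂ lk) (hlk0 : lk ≠ 0)
    -- the `(p, q)`-torus knot `K₀`
    (p q : ℤ) (hp : 2 ≤ |p|) (hq : 2 ≤ |q|) (hpq : IsCoprime p q)
    (K₀ : TubedKnot) (hK₀ : IsFiberedTorusKnot p q K₀) (hK₀' : K₀.Preferred)
    -- `f : E(K₁) → N(K₀)` takes a meridian of `K₁` to a fibre `h ⊆ ∂N(K₀)`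
    (f : OpenPartialHomeomorph E4 E4) (hf : IsOrientedDiffeo f K₁.exterior K₀.nbhd)
    (m : Circle → E4) (hm : K₁.IsMeridian m)
    (x : E4) (hx : x ∈ K₀.boundary) (hmx : ∀ u, f (m u) = seifertFiber p q x u)
    -- the satellite knot `K = f(K₂)`, with the neighbourhood `f(N(K₂))`
    (K : TubedKnot)
    (hK : ∀ (u : Circle) (w : ℂ), ‖w‖ ≤ 1 → K.toFun (u, w) = f (K₂.toFun (u, w)))
    -- the Seifert surface `F` of `K`, which `∂N(K₀)` cuts along `|lk|` preferred longitudes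
    (F : Set E4) (hF : IsSeifertSurface K F) (hF₀ : MeetsInLongitudes K₀ F lk.natAbs)
    (hFcut : IsOrientableSurface (F ∩ K₀.nbhd) ((F ∩ K.boundary) ∪ (F ∩ K₀.boundary)))
    -- `F' = f⁻¹(F ∩ N(K₀))`
    (F' : Set E4) (hF' : F' = K₁.exterior ∩ f ⁻¹' (F ∩ K₀.nbhd)) :
    K₂.HasBoundarySlope F' (-(lk : ℚ) ^ 2 * (p * q)) ∧
      K₁.HasBoundarySlope F' (-1 / ((p : ℚ) * q)) := by
  have hp0 : p ≠ 0 := by rintro rfl; norm_num at hp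
  have hq0 : q ≠ 0 := by rintro rfl; norm_num at hq
  subst hF'
  constructor
  · obtain ⟨φ, hφ, hφ1⟩ := K.exists_dual_map
    have hcl := hF.class_eq hφ hφ1
    rw [deg_longitude_satellite hp0 hq0 hpq hdisj hK₁ hK₂ hlk hK₀ hK₀' hf hm hmx hK hφ hφ1] at hcl
    obtain ⟨γ, hγ, hγr, g, h, hg, hh, hgh⟩ := hcl
    -- `f` identifies `∂N(K₂)` with `∂N(K)` in the given coordinates
    have hbd : (K₁.exterior ∩ f ⁻¹' (F ∩ K₀.nbhd)) ∩ K₂.boundary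
        = range fun u => K₂.toFun (g u, (h u : ℂ)) := by
      ext y
      constructor
      · rintro ⟨⟨-, hy, -⟩, hyb⟩
        obtain ⟨⟨c, d⟩, rfl⟩ := exists_toFun_circle_eq hyb
        rw [← hK c d (Circle.norm_coe d).le] at hy
        have h1 : K.toFun (c, (d : ℂ)) ∈ range γ := by
          rw [hγr]
          exact ⟨hy, toFun_circle_mem_boundary K (c, d)⟩
        obtain ⟨u, hu⟩ := h1
        rw [hgh] at hu
        exact ⟨u, congrArg K₂.toFun (K.inj hu)⟩
      · rintro ⟨u, rfl⟩
        have h1 : K₂.toFun (g u, (h u : ℂ)) ∈ K₂.boundary :=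
          toFun_circle_mem_boundary K₂ (g u, h u)
        have h2 : K₂.toFun (g u, (h u : ℂ)) ∈ K₁.exterior :=
          K₁.mem_exterior_of_notMem_nbhd (K₂.mem _)
            (disjoint_right.1 hdisj (K₂.boundary_subset_nbhd h1))
        have h3 : γ u ∈ F ∩ K.boundary := hγr ▸ mem_range_self u
        refine ⟨⟨h2, ?_, hf.apply_mem_nbhd h2⟩, h1⟩
        rw [← hK _ _ (Circle.norm_coe _).le, ← hgh]
        exact h3.1
    have key := TubedKnot.hasBoundarySlope_of_iUnion (K := K₂)
      (F := K₁.exterior ∩ f ⁻¹' (F ∩ K₀.nbhd)) one_ne_zero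
      (C := fun _ : Fin 1 => range fun u => K₂.toFun (g u, (h u : ℂ))) one_ne_zero
      (fun _ => ⟨_, fun u v huv => hγ (by rw [hgh, hgh, K₂.inj huv]), rfl, g, h, hg, hh,
        fun _ => rfl⟩)
      (fun i j hij => absurd (Subsingleton.elim i j) hij) (by rw [hbd, iUnion_const])
    convert key using 1
    push_cast
    ring
  · obtain ⟨ε, hε, -, -, hA, hC⟩ := exists_gluing_matrix hp0 hq0 hpq hK₁ hK₀ hK₀' hf hm hmx
    obtain ⟨C, hCd, hCc, hCF⟩ := hF₀
    have hε0 : ε ≠ 0 := by rintro rfl; norm_num at hε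
    have hgb : MapsTo f.symm K₀.boundary K₁.boundary := fun x hx => hf.symm_mem_boundary hx
    have hgc : ContinuousOn f.symm K₀.boundary :=
      hf.continuousOn_symm.mono K₀.boundary_subset_nbhd
    have hfg : ∀ y ∈ K₀.boundary, f (f.symm y) = y := fun y hy =>
      (hf.symm_mem_exterior (K₀.boundary_subset_nbhd hy)).2
    have hgi : InjOn f.symm K₀.boundary := fun x hx y hy hxy => by
      rw [← hfg x hx, hxy, hfg y hy]
    have hCb : ∀ i, C i ⊆ K₀.boundary := fun i y hy => by
      have : y ∈ F ∩ K₀.boundary := hCF ▸ mem_iUnion.2 ⟨i, hy⟩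
      exact this.2
    have hbd : (K₁.exterior ∩ f ⁻¹' (F ∩ K₀.nbhd)) ∩ K₁.boundary = ⋃ i, f.symm '' C i := by
      rw [← image_iUnion, ← hCF]
      ext y
      constructor
      · rintro ⟨⟨hy, hyF, -⟩, hyb⟩
        exact ⟨f y, ⟨hyF, hf.apply_mem_boundary hyb⟩, f.left_inv (hf.subset_source hy)⟩
      · rintro ⟨z, ⟨hzF, hzb⟩, rfl⟩
        have h1 := hgb hzb
        refine ⟨⟨K₁.boundary_subset_exterior h1, ?_⟩, h1⟩
        rw [mem_preimage, hfg z hzb]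
        exact ⟨hzF, K₀.boundary_subset_nbhd hzb⟩
    -- the preimages of the longitudes `l₀` are the curves `ε (m₁ - pq l₁)`
    have key := TubedKnot.hasBoundarySlope_of_iUnion (K := K₁)
      (F := K₁.exterior ∩ f ⁻¹' (F ∩ K₀.nbhd)) (Int.natAbs_ne_zero.2 hlk0)
      (C := fun i => f.symm '' C i) (a := -ε * (p * q)) (b := ε)
      (mul_ne_zero (neg_ne_zero.2 hε0) (mul_ne_zero hp0 hq0))
      (fun i => by
        have h1 := (hCc i).image hgb hgc hgi
        rw [hA, hC] at h1
        simpa using h1)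
      (fun i j hij => (hCd hij).image hgi (hCb i) (hCb j)) hbd
    convert key using 1
    have h1 : (p : ℚ) ≠ 0 := Int.cast_ne_zero.2 hp0
    have h2 : (q : ℚ) ≠ 0 := Int.cast_ne_zero.2 hq0
    have h3 : (ε : ℚ) ≠ 0 := Int.cast_ne_zero.2 hε0
    push_cast
    field_simp
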